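/- Let $h\colon[0,1]\to[0,\infty)$ be continuous with $h(0)=1$, $h(1)=0$, and put $I=\int_0^1 h(\xi)\,d\xi$. For $\rho>0$ and small $\alpha>0$ consider the convex billiard table (the smoothened stadium without straight segments) whose $C^2$ boundary is symmetric about both coordinate axes and consists of two mirror-image copies of a focusing curve $\Gamma$, a right one and a left one, joined at their endpoints on the vertical axis. Here $\Gamma$ consists of a circular arc of radius $\rho$ and opening angle $\pi-2\alpha$, extended at each end by a smoothened part of arc length $s_\alpha=\rho\alpha/I$, whose curvature at arc length $s\in[0,s_\alpha]$ from the circular arc is $\frac1\rho h(s/s_\alpha)$. For an integer $n\ge 0$ and $\zeta\in(0,1)$, call a billiard orbit *of type $(n,\zeta)$* if it is $4(n+1)$-periodic, its reflection points $P_0,P_1,\dots$ run counterclockwise once around the table in one period, $P_0$ is the midpoint of the right copy of $\Gamma$, $P_{2n+2}$ is the midpoint of the left copy, $P_{n+1}$ is the point of the upper smoothened part of the right copy at arc length $\zeta s_\alpha$ from the circular arc, all other $P_i$ with $0\le i\le 2n+2$ lie in the interior of the circular arcs, and the orbit is symmetric about the horizontal axis but not about the vertical axis. Let $M$ be its monodromy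 matrix, that is, the derivative at the orbit of the $4(n+1)$-th iterate of the billiard map in the coordinates (arc length, angle between the outgoing velocity and the inward normal); the orbit is *linearly stable* if $\left|\tfrac12\operatorname{tr}M\right|<1$. **Theorem (asymptotic existence and stability).** Fix $n\ge 0$ and $h$ as above, and suppose that $\zeta_*\in(0,1)$ satisfies $$\frac{2n+1}{2n+2}\,(1-\zeta_*)=\int_{\zeta_*}^1 h(\xi)\,d\xi .$$ 1. There is $\alpha_0>0$ such that for all $\rho>0$ and all $\alpha\in(0,\alpha_0)$ the table has an orbit of type $(n,\zeta)$ for some $\zeta\in(0,1)$. 2. If moreover $$\frac{n+\frac12}{n+1}<h(\zeta_*)<1\qquad\text{and}\qquad h(\zeta_*)\ne\frac{n+\frac34}{n+1},$$ then this orbit, associated with $\zeta_*$, is linearly stable: there are $C,\varepsilon,\alpha_0>0$ such that for all $\rho>0$ and all $\alpha\in(0,\alpha_0)$ there is a linearly stable orbit of type $(n,\zeta)$ with $|\zeta-\zeta_*|\le C\alpha$, and every orbit of type $(n,\zeta)$ with $|\zeta-\zeta_*|<\varepsilon$ is linearly stable. -/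

import Mathlib

open Set Filter Topology

noncomputable section

namespace SmoothStadium

/-! ### The smoothened stadium with separation zero

`ρ` is the radius of the semi-circle, `α` the angle of the arc that is replaced near each of its
endpoints, and `h` the shape function on `[0,1]`. The boundary of the table is a closed curve,
parametrized counterclockwise by arc length `t`. It consists of two copies of the focusing
component `Γ` (the right and the left one), joined at their endpoints on the vertical axis.
`t = 0` is the midpoint of the right copy, on the horizontal axis. The plane is `ℂ`. -/

/-- Arc length of the smoothened part of `Γ` near one of its endpoints. -/
def smoothLength (ρ α : ℝ) (h : ℝ → ℝ) : ℝ := ρ * α / ∫ ξ in (0 : ℝ)..1, h ξ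

/-- Arc length of half of the circular part of `Γ`. -/
def arcLength (ρ α : ℝ) : ℝ := ρ * (Real.pi / 2 - α)

/-- Arc length from the midpoint of `Γ` to its endpoint. -/
def quarterLength (ρ α : ℝ) (h : ℝ → ℝ) : ℝ := arcLength ρ α + smoothLength ρ α h

/-- Length of the whole boundary of the table. -/
def perimeter (ρ α : ℝ) (h : ℝ → ℝ) : ℝ := 4 * quarterLength ρ α h

/-- The distance along the boundary from the point with parameter `t` to the midpoint of the copy
of `Γ` that contains it, i.e. the distance of `t` to the set `2 q ℤ`, `q` the quarter length. -/
def midDist (ρ α : ℝ) (h : ℝ → ℝ) (t : ℝ) : ℝ :=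
  |t - 2 * quarterLength ρ α h * round (t / (2 * quarterLength ρ α h))|

/-- The curvature of the boundary (nonnegative for a focusing boundary): `1/ρ` on the circular
parts, and `h (s / s_α) / ρ` on the smoothened parts, where `s` is the arc length from the end of
the circular part and `s_α` the length of the smoothened part. -/
def curvature (ρ α : ℝ) (h : ℝ → ℝ) (t : ℝ) : ℝ :=
  if midDist ρ α h t ≤ arcLength ρ α then 1 / ρ
  else 1 / ρ * h ((midDist ρ α h t - arcLength ρ α) / smoothLength ρ α h)

/-- The angle of the tangent vector; the tangent points upwards at `t = 0`. -/
def tangentAngle (ρ α : ℝ) (h : ℝ → ℝ) (t : ℝ) : ℝ :=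
  Real.pi / 2 + ∫ r in (0 : ℝ)..t, curvature ρ α h r

/-- The unit tangent vector. The inward unit normal is `Complex.I * tangent`. -/
def tangent (ρ α : ℝ) (h : ℝ → ℝ) (t : ℝ) : ℂ := Complex.exp (tangentAngle ρ α h t * Complex.I)

/-- The abscissa of the midpoint of the right copy of `Γ`, chosen such that the endpoints of `Γ`
lie on the vertical axis. -/
def halfWidth (ρ α : ℝ) (h : ℝ → ℝ) : ℝ :=
  -∫ r in (0 : ℝ)..quarterLength ρ α h, Real.cos (tangentAngle ρ α h r)

/-- The boundary of the table, parametrized by arc length. -/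
def boundary (ρ α : ℝ) (h : ℝ → ℝ) (t : ℝ) : ℂ :=
  (halfWidth ρ α h : ℂ) + ∫ r in (0 : ℝ)..t, tangent ρ α h r

/-! ### Billiard dynamics -/

/-- The billiard map as a relation. A state `z = (s, φ)` is the arc length parameter `s` of a
reflection and the angle `φ ∈ (-π/2, π/2)` from the inward normal `N` to the outgoing velocity
`sin φ • T + cos φ • N`, counted positive in the direction of the tangent `T`. The particle
leaves `z` and hits the boundary at `w`, with incoming velocity `sin φ' • T' - cos φ' • N'`, so that
the specular reflection has outgoing angle `φ'`. (The table is convex, so the chord lies in the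
table, and `w` is determined by `z` up to multiples of the perimeter in the first entry.) -/
def BilliardStep (ρ α : ℝ) (h : ℝ → ℝ) (z w : ℝ × ℝ) : Prop :=
  |z.2| < Real.pi / 2 ∧ |w.2| < Real.pi / 2 ∧
  (∃ τ : ℝ, 0 < τ ∧
    boundary ρ α h w.1 = boundary ρ α h z.1 +
      τ * ((Real.sin z.2 + Real.cos z.2 * Complex.I) * tangent ρ α h z.1)) ∧
  (Real.sin z.2 + Real.cos z.2 * Complex.I) * tangent ρ α h z.1 =
    (Real.sin w.2 - Real.cos w.2 * Complex.I) * tangent ρ α h w.1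

/-- `w` is obtained from `z` by `p` applications of the billiard map. -/
def BilliardIter (ρ α : ℝ) (h : ℝ → ℝ) (p : ℕ) (z w : ℝ × ℝ) : Prop :=
  ∃ x : ℕ → ℝ × ℝ, x 0 = z ∧ x p = w ∧ ∀ i < p, BilliardStep ρ α h (x i) (x (i + 1))

/-- The monodromy matrix of a `p`-periodic orbit `z`: the derivative `M` at `z 0` of the `p`-th
iterate `R` of the billiard map (in a lift with `R (z 0) = z p`). -/
def IsMonodromy (ρ α : ℝ) (h : ℝ → ℝ) (p : ℕ) (z : ℕ → ℝ × ℝ) (M : ℝ × ℝ →L[ℝ] ℝ × ℝ) : Prop :=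
  ∃ R : ℝ × ℝ → ℝ × ℝ, R (z 0) = z p ∧
    (∀ᶠ w in 𝓝 (z 0), BilliardIter ρ α h p w (R w)) ∧ HasFDerivAt R M (z 0)

/-- Linear stability (ellipticity) of a `p`-periodic orbit: `|½ tr M| < 1` for the monodromy
matrix `M`. -/
def LinearlyStable (ρ α : ℝ) (h : ℝ → ℝ) (p : ℕ) (z : ℕ → ℝ × ℝ) : Prop :=
  ∃ M : ℝ × ℝ →L[ℝ] ℝ × ℝ, IsMonodromy ρ α h p z M ∧
    |1 / 2 * LinearMap.trace ℝ (ℝ × ℝ) (M : ℝ × ℝ →ₗ[ℝ] ℝ × ℝ)| < 1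

/-- The set of reflection points of an orbit. -/
def reflectionPoints (ρ α : ℝ) (h : ℝ → ℝ) (z : ℕ → ℝ × ℝ) : Set ℂ :=
  range fun i => boundary ρ α h (z i).1

/-- The `4 (n + 1)`-periodic orbits under consideration, with reflection number `n + 1` at the
point `ζ` of the smoothened part: `z i` is the state at the `i`-th reflection. -/
structure IsOrbit (ρ α : ℝ) (h : ℝ → ℝ) (n : ℕ) (ζ : ℝ) (z : ℕ → ℝ × ℝ) : Prop where
  /-- `z` is a billiard orbit. -/
  step : ∀ i, BilliardStep ρ α h (z i) (z (i + 1))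
  /-- The reflections follow each other counterclockwise. -/
  strictMono : StrictMono fun i => (z i).1
  /-- The orbit closes up after `4 (n + 1)` reflections and one turn around the table. Together
  with the previous condition, `4 (n + 1)` is the least period. -/
  periodic : ∀ i, z (i + 4 * (n + 1)) = ((z i).1 + perimeter ρ α h, (z i).2)
  /-- The orbit starts at the midpoint of the right component. -/
  mid_right : (z 0).1 = 0
  /-- The orbit passes through the midpoint of the left component. -/
  mid_left : (z (2 * n + 2)).1 = 2 * quarterLength ρ α h
  /-- Reflection number `n + 1` is off the smoothened part at the upper end of the right component,
  at arc length `ζ s_α` from the circular part. -/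
  smooth : (z (n + 1)).1 = arcLength ρ α + ζ * smoothLength ρ α h
  /-- This point is neither the end of the circular part nor the endpoint of the component. -/
  mem : ζ ∈ Ioo (0 : ℝ) 1
  /-- All other reflections up to the midpoint of the left component are off the interior of the
  circular parts. -/
  circular : ∀ i ≤ 2 * n + 2, i ≠ n + 1 → midDist ρ α h (z i).1 < arcLength ρ α
  /-- The orbit is symmetric about the horizontal axis. -/
  symm_horizontal : (starRingEnd ℂ) '' reflectionPoints ρ α h z = reflectionPoints ρ α h z
  /-- The orbit is not symmetric about the vertical axis. -/
  not_symm_vertical :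
    (fun P => -(starRingEnd ℂ) P) '' reflectionPoints ρ α h z ≠ reflectionPoints ρ α h z

end SmoothStadium

end

noncomputable section

namespace SmoothStadium

/-! Scaling reduces everything to radius 1. Write m = 2n+1, K = 1/I, l = π/(4(n+1)) (`limitAngle`).
Along a circular arc all chords make the same angle with the boundary, so half an orbit is described
by ζ, the chord angle x on the right arc and the chord angle y on the left arc. Let (X, Y) be the
point ζ of the smoothened part, χ the turning of the tangent from there to the endpoint of Γ, and w
the abscissa of the centre of the right arc. The chord leaving the right arc passes through (X, Y)
iff (X - w) cos mx + Y sin mx = cos x; the left arc gives the same equation with -X and y; the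
reflection law at the point says my = mx + 2χ. This is `ChordSystem`. Conversely, a solution close
to l yields half an orbit, which its mirror image closes up (`ChordSystem.exists_isOrbit`).

Existence. Put x = M - χ/m and y = M + χ/m. The half sum of the two line equations, `chordFun`, is
strictly increasing in M and determines M continuously in ζ; its limit sin mM = cos M gives M = l +
O(α). The half difference, `angleDefect`, becomes a continuous function G of ζ with G = sin l ·
((m+1)/m) K α F(ζ) + O(α²), where F is `leadingTerm` (`eventually_exists_defect`). The hypothesis on
ζ_* says F(ζ_*) = 0, and F > 0 near 1 because h(1) = 0. If F is negative somewhere, G changes sign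
for small α. Otherwise F(0) ≥ 0 forces I < 1, so w is positive of order α, and the second-order term
-w sin(mM) sin χ makes G(ζ_*) negative (`angleDefect_neg`). Either way G has a zero. In the second
part F'(ζ_*) = h(ζ_*) - m/(m+1) > 0, so the sign change happens within O(α) of ζ_*.

Stability. Implicit differentiation gives the derivative of one billiard step (`stepMatrix`). For
every orbit of the type considered, not only a constructed one, symmetry and cyclic order force the
second half to be the mirror image of the first, and the chord equations give angles l + O(α) and
chord lengths 2 sin l + O(α) at the smoothened part, where the curvature is close to k = h(ζ_*).
Steps within an arc are the shear (1, -2; 0, 1). The limiting monodromy matrix is a square H² with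
det H = 1 and ½ tr H = 1 - 4(n+1)(1-k), so half its trace is 2(½ tr H)² - 1. For k < 1 this lies in
(-1, 1) exactly under the two remaining conditions on k, and continuity of the trace finishes the
proof. -/

/-- The shape functions: continuous and nonnegative on `[0,1]`, with `h 0 = 1` and `h 1 = 0`. -/
structure IsShape (h : ℝ → ℝ) : Prop where
  cont : ContinuousOn h (Icc 0 1)
  nonneg : ∀ ξ ∈ Icc (0 : ℝ) 1, 0 ≤ h ξ
  zero : h 0 = 1
  one : h 1 = 0

/-- The continuous extension of `h` by constants. -/
def extend (h : ℝ → ℝ) : ℝ → ℝ := IccExtend (zero_le_one' ℝ) ((Icc (0 : ℝ) 1).domRestrict h)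

lemma extend_of_mem {h : ℝ → ℝ} {x : ℝ} (hx : x ∈ Icc (0 : ℝ) 1) : extend h x = h x := by
  simp [extend, IccExtend_of_mem _ _ hx]

lemma extend_of_nonpos {h : ℝ → ℝ} {x : ℝ} (hx : x ≤ 0) : extend h x = h 0 := by
  simp [extend, IccExtend_of_le_left _ _ hx]

lemma IsShape.continuous_extend {h : ℝ → ℝ} (hh : IsShape h) : Continuous (extend h) :=
  (continuousOn_iff_continuous_domRestrict.mp hh.cont).Icc_extend'

lemma IsShape.extend_nonneg {h : ℝ → ℝ} (hh : IsShape h) (x : ℝ) : 0 ≤ extend h x :=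
  hh.nonneg _ (projIcc (0 : ℝ) 1 zero_le_one x).2

lemma IsShape.intervalIntegrable {h : ℝ → ℝ} (hh : IsShape h) {a b : ℝ} (ha : a ∈ Icc (0 : ℝ) 1)
    (hb : b ∈ Icc (0 : ℝ) 1) : IntervalIntegrable h MeasureTheory.volume a b :=
  (hh.cont.mono (uIcc_subset_Icc ha hb)).intervalIntegrable

lemma IsShape.integral_extend {h : ℝ → ℝ} {a b : ℝ} (ha : a ∈ Icc (0 : ℝ) 1)
    (hb : b ∈ Icc (0 : ℝ) 1) : ∫ ξ in a..b, extend h ξ = ∫ ξ in a..b, h ξ :=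
  intervalIntegral.integral_congr fun _ hx => extend_of_mem (uIcc_subset_Icc ha hb hx)

lemma IsShape.integral_pos {h : ℝ → ℝ} (hh : IsShape h) : 0 < ∫ ξ in (0 : ℝ)..1, h ξ := by
  refine intervalIntegral.integral_pos one_pos hh.cont
    (fun x hx => hh.nonneg x ⟨hx.1.le, hx.2⟩) ⟨0, ⟨le_rfl, zero_le_one⟩, ?_⟩
  simp [hh.zero]

lemma IsShape.integral_nonneg {h : ℝ → ℝ} (hh : IsShape h) {a : ℝ} (ha : a ∈ Icc (0 : ℝ) 1) :
    0 ≤ ∫ ξ in a..1, h ξ :=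
  intervalIntegral.integral_nonneg ha.2 fun x hx => hh.nonneg x ⟨ha.1.trans hx.1, hx.2⟩

lemma IsShape.integral_le {h : ℝ → ℝ} (hh : IsShape h) {a : ℝ} (ha : a ∈ Icc (0 : ℝ) 1) :
    ∫ ξ in a..1, h ξ ≤ ∫ ξ in (0 : ℝ)..1, h ξ := by
  have h0 : (0 : ℝ) ∈ Icc (0 : ℝ) 1 := ⟨le_rfl, zero_le_one⟩
  have h1 : (1 : ℝ) ∈ Icc (0 : ℝ) 1 := ⟨zero_le_one, le_rfl⟩
  rw [← intervalIntegral.integral_add_adjacent_intervals (hh.intervalIntegrable h0 ha)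
    (hh.intervalIntegrable ha h1)]
  have : 0 ≤ ∫ ξ in (0 : ℝ)..a, h ξ :=
    intervalIntegral.integral_nonneg ha.1 fun x hx => hh.nonneg x ⟨hx.1, hx.2.trans ha.2⟩
  linarith

/-- The turning angle between the point `ζ` of the smoothened part and the endpoint of `Γ`. -/
def turn (α : ℝ) (h : ℝ → ℝ) (ζ : ℝ) : ℝ := α / (∫ ξ in (0 : ℝ)..1, h ξ) * ∫ ξ in ζ..1, h ξ

/-! ### Curvature as a function of arc length -/

section geometry

variable {α : ℝ} {h : ℝ → ℝ}

/-- The norm of `AddCircle` supplies evenness, periodicity, continuity and the upper bound by half a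
period at once. -/
lemma midDist_eq_norm (ρ α : ℝ) (h : ℝ → ℝ) (t : ℝ) :
    midDist ρ α h t = ‖(t : AddCircle (2 * quarterLength ρ α h))‖ := by
  rw [AddCircle.norm_eq, midDist, mul_comm _ (round _ : ℝ), div_eq_inv_mul]

lemma arcLength_one : arcLength 1 α = Real.pi / 2 - α := by simp [arcLength]

lemma smoothLength_pos (hh : IsShape h) (hα : 0 < α) : 0 < smoothLength 1 α h := by
  have := hh.integral_pos
  unfold smoothLength
  positivity

lemma quarterLength_pos (hh : IsShape h) (hα : 0 < α) (hα' : α < Real.pi / 2) :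
    0 < quarterLength 1 α h := by
  have := smoothLength_pos hh hα
  rw [quarterLength, arcLength_one]; linarith

lemma midDist_le (hh : IsShape h) (hα : 0 < α) (hα' : α < Real.pi / 2) (t : ℝ) :
    midDist 1 α h t ≤ quarterLength 1 α h := by
  have hq := quarterLength_pos hh hα hα'
  rw [midDist_eq_norm]
  refine (AddCircle.norm_le_half_period _ (by positivity)).trans ?_
  rw [abs_of_pos (by positivity)]; linarith

lemma midDist_neg (t : ℝ) : midDist 1 α h (-t) = midDist 1 α h t := by
  simp [midDist_eq_norm]

lemma midDist_add (t : ℝ) :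
    midDist 1 α h (t + 2 * quarterLength 1 α h) = midDist 1 α h t := by
  simp [midDist_eq_norm]

lemma midDist_of_abs_le (hh : IsShape h) (hα : 0 < α) (hα' : α < Real.pi / 2) {t : ℝ}
    (ht : |t| ≤ quarterLength 1 α h) : midDist 1 α h t = |t| := by
  have hq := quarterLength_pos hh hα hα'
  rw [midDist_eq_norm, AddCircle.norm_coe_eq_abs_iff _ (by positivity),
    abs_of_pos (a := 2 * quarterLength 1 α h) (by positivity)]
  linarith

/-- The two branches of the curvature join because h(0) = 1. A single formula with a continuous
function makes the curvature continuous, hence the boundary C². -/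
lemma curvature_eq_extend (hh : IsShape h) (hα : 0 < α) (hα' : α < Real.pi / 2) (t : ℝ) :
    curvature 1 α h t =
      extend h ((midDist 1 α h t - arcLength 1 α) / smoothLength 1 α h) := by
  have hS := smoothLength_pos hh hα
  unfold curvature
  split_ifs with hm
  · rw [extend_of_nonpos (div_nonpos_of_nonpos_of_nonneg (by linarith) hS.le), hh.zero, one_div_one]
  · rw [one_div_one, one_mul, extend_of_mem]
    push Not at hm
    refine ⟨div_nonneg (by linarith) hS.le, (div_le_one hS).2 ?_⟩
    have := midDist_le hh hα hα' t
    rw [quarterLength] at this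
    linarith

lemma continuous_curvature (hh : IsShape h) (hα : 0 < α) (hα' : α < Real.pi / 2) :
    Continuous (curvature 1 α h) := by
  have : curvature 1 α h = fun t =>
      extend h ((midDist 1 α h t - arcLength 1 α) / smoothLength 1 α h) :=
    funext (curvature_eq_extend hh hα hα')
  rw [this]
  refine hh.continuous_extend.comp ?_
  simp only [midDist_eq_norm]
  have : Continuous fun t : ℝ => ‖(t : AddCircle (2 * quarterLength 1 α h))‖ :=
    continuous_norm.comp (AddCircle.continuous_mk' _)
  fun_prop

lemma curvature_nonneg (hh : IsShape h) (hα : 0 < α) (hα' : α < Real.pi / 2) (t : ℝ) :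
    0 ≤ curvature 1 α h t := by
  rw [curvature_eq_extend hh hα hα']; exact hh.extend_nonneg _

lemma curvature_neg (t : ℝ) : curvature 1 α h (-t) = curvature 1 α h t := by
  simp [curvature, midDist_neg]

lemma curvature_add (t : ℝ) :
    curvature 1 α h (t + 2 * quarterLength 1 α h) = curvature 1 α h t := by
  simp [curvature, midDist_add]

lemma curvature_of_midDist_le {t : ℝ} (ht : midDist 1 α h t ≤ arcLength 1 α) :
    curvature 1 α h t = 1 := by
  simp [curvature, ht]

lemma arcLength_le (hh : IsShape h) (hα : 0 < α) : arcLength 1 α ≤ quarterLength 1 α h := by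
  have := smoothLength_pos hh hα
  rw [quarterLength]; linarith

lemma curvature_of_abs_le (hh : IsShape h) (hα : 0 < α) (hα' : α < Real.pi / 2) {t : ℝ}
    (ht : |t| ≤ arcLength 1 α) : curvature 1 α h t = 1 := by
  refine curvature_of_midDist_le ?_
  rwa [midDist_of_abs_le hh hα hα' (ht.trans (arcLength_le hh hα))]

lemma curvature_smooth (hh : IsShape h) (hα : 0 < α) (hα' : α < Real.pi / 2) {ζ : ℝ}
    (hζ : ζ ∈ Icc (0 : ℝ) 1) :
    curvature 1 α h (arcLength 1 α + ζ * smoothLength 1 α h) = h ζ := by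
  have hS := smoothLength_pos hh hα
  have hA : 0 < arcLength 1 α := by rw [arcLength_one]; linarith
  have h0 : 0 ≤ ζ * smoothLength 1 α h := mul_nonneg hζ.1 hS.le
  have h1 : ζ * smoothLength 1 α h ≤ smoothLength 1 α h := mul_le_of_le_one_left hS.le hζ.2
  rw [curvature_eq_extend hh hα hα', midDist_of_abs_le hh hα hα', abs_of_nonneg (by linarith),
    add_sub_cancel_left, mul_div_cancel_right₀ _ hS.ne', extend_of_mem hζ]
  rw [abs_of_nonneg (by linarith), quarterLength]
  linarith

lemma integral_curvature_smooth (hh : IsShape h) (hα : 0 < α) (hα' : α < Real.pi / 2) {ζ : ℝ}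
    (hζ : ζ ∈ Icc (0 : ℝ) 1) :
    ∫ r in (arcLength 1 α + ζ * smoothLength 1 α h)..(quarterLength 1 α h), curvature 1 α h r =
      turn α h ζ := by
  have hS := smoothLength_pos hh hα
  have hI := hh.integral_pos
  have e1 := intervalIntegral.integral_comp_mul_add (a := ζ) (b := 1) (curvature 1 α h)
    hS.ne' (arcLength 1 α)
  have e2 : ∫ x in ζ..1, curvature 1 α h (smoothLength 1 α h * x + arcLength 1 α) =
      ∫ x in ζ..1, h x := by
    refine intervalIntegral.integral_congr fun x hx => ?_
    have hx' : x ∈ Icc (0 : ℝ) 1 := uIcc_subset_Icc hζ ⟨zero_le_one, le_rfl⟩ hx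
    rw [← curvature_smooth hh hα hα' hx', add_comm, mul_comm]
  rw [e2, eq_inv_smul_iff₀ hS.ne', smul_eq_mul] at e1
  have e3 : turn α h ζ = smoothLength 1 α h * ∫ x in ζ..1, h x := by
    rw [turn, smoothLength, one_mul]
  rw [e3, e1, quarterLength, mul_one, mul_comm ζ, add_comm, add_comm (smoothLength 1 α h)]

/-- The length s_α = ρα/I is chosen for this: the smoothened part turns the tangent by exactly the
angle α of the arc that it replaces. -/
lemma turn_zero (hh : IsShape h) : turn α h 0 = α := by
  have := hh.integral_pos
  rw [turn]; field_simp

lemma turn_nonneg (hh : IsShape h) (hα : 0 < α) {ζ : ℝ} (hζ : ζ ∈ Icc (0 : ℝ) 1) :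
    0 ≤ turn α h ζ :=
  mul_nonneg (div_nonneg hα.le hh.integral_pos.le) (hh.integral_nonneg hζ)

lemma turn_le (hh : IsShape h) (hα : 0 < α) {ζ : ℝ} (hζ : ζ ∈ Icc (0 : ℝ) 1) :
    turn α h ζ ≤ α := by
  conv_rhs => rw [← turn_zero (α := α) hh]
  exact mul_le_mul_of_nonneg_left (hh.integral_le hζ) (div_nonneg hα.le hh.integral_pos.le)

/-! ### The tangent angle -/

/-- Strict differentiability is what the implicit function theorem will need. -/
lemma hasStrictDerivAt_tangentAngle (hh : IsShape h) (hα : 0 < α) (hα' : α < Real.pi / 2) (t : ℝ) :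
    HasStrictDerivAt (tangentAngle 1 α h) (curvature 1 α h t) t := by
  have hc := continuous_curvature hh hα hα'
  exact (intervalIntegral.integral_hasStrictDerivAt_right (hc.intervalIntegrable _ _)
    (hc.stronglyMeasurableAtFilter _ _) hc.continuousAt).const_add _

lemma continuous_tangentAngle (hh : IsShape h) (hα : 0 < α) (hα' : α < Real.pi / 2) :
    Continuous (tangentAngle 1 α h) :=
  continuous_iff_continuousAt.2 fun t =>
    (hasStrictDerivAt_tangentAngle hh hα hα' t).hasDerivAt.continuousAt

lemma tangentAngle_sub (hh : IsShape h) (hα : 0 < α) (hα' : α < Real.pi / 2) (a b : ℝ) :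
    tangentAngle 1 α h b - tangentAngle 1 α h a = ∫ r in a..b, curvature 1 α h r := by
  have hc := continuous_curvature hh hα hα'
  rw [← intervalIntegral.integral_interval_sub_left (a := 0) (hc.intervalIntegrable _ _)
    (hc.intervalIntegrable _ _), tangentAngle, tangentAngle]
  ring

lemma monotone_tangentAngle (hh : IsShape h) (hα : 0 < α) (hα' : α < Real.pi / 2) :
    Monotone (tangentAngle 1 α h) := fun a b hab => by
  have := tangentAngle_sub hh hα hα' a b
  have := intervalIntegral.integral_nonneg (μ := MeasureTheory.volume) hab
    fun r _ => curvature_nonneg hh hα hα' r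
  linarith

lemma tangentAngle_of_abs_le (hh : IsShape h) (hα : 0 < α) (hα' : α < Real.pi / 2) {t : ℝ}
    (ht : |t| ≤ arcLength 1 α) : tangentAngle 1 α h t = Real.pi / 2 + t := by
  have : ∫ r in (0 : ℝ)..t, curvature 1 α h r = ∫ r in (0 : ℝ)..t, (1 : ℝ) := by
    refine intervalIntegral.integral_congr fun r hr => curvature_of_abs_le hh hα hα' ?_
    refine le_trans ?_ ht
    have := abs_sub_left_of_mem_uIcc hr
    simpa using this
  simp [tangentAngle, this]

lemma tangentAngle_neg (t : ℝ) : tangentAngle 1 α h (-t) = Real.pi - tangentAngle 1 α h t := by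
  have := intervalIntegral.integral_comp_neg (a := 0) (b := t) (curvature 1 α h)
  simp only [curvature_neg, neg_zero] at this
  rw [tangentAngle, tangentAngle, this, intervalIntegral.integral_symm (-t) 0]
  ring

/-- The arc turns the tangent by π/2 - α and the smoothened part by α. The tangent is therefore
horizontal at the junction of the two copies, and all symmetries of the curve follow from this. -/
lemma tangentAngle_quarter (hh : IsShape h) (hα : 0 < α) (hα' : α < Real.pi / 2) :
    tangentAngle 1 α h (quarterLength 1 α h) = Real.pi := by
  have e := integral_curvature_smooth hh hα hα' (ζ := 0) ⟨le_rfl, zero_le_one⟩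
  have hA : 0 < arcLength 1 α := by rw [arcLength_one]; linarith
  rw [turn_zero hh, zero_mul, add_zero, ← tangentAngle_sub hh hα hα',
    tangentAngle_of_abs_le hh hα hα' (abs_of_pos hA).le, arcLength_one] at e
  linarith

lemma tangentAngle_smooth (hh : IsShape h) (hα : 0 < α) (hα' : α < Real.pi / 2) {ζ : ℝ}
    (hζ : ζ ∈ Icc (0 : ℝ) 1) :
    tangentAngle 1 α h (arcLength 1 α + ζ * smoothLength 1 α h) = Real.pi - turn α h ζ := by
  have e := integral_curvature_smooth hh hα hα' hζ
  rw [← tangentAngle_sub hh hα hα', tangentAngle_quarter hh hα hα'] at e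
  linarith

lemma tangentAngle_add (hh : IsShape h) (hα : 0 < α) (hα' : α < Real.pi / 2) (t : ℝ) :
    tangentAngle 1 α h (t + 2 * quarterLength 1 α h) = tangentAngle 1 α h t + Real.pi := by
  have e := intervalIntegral.integral_comp_add_right (a := -quarterLength 1 α h) (b := t)
    (curvature 1 α h) (2 * quarterLength 1 α h)
  simp only [curvature_add] at e
  have e1 : -quarterLength 1 α h + 2 * quarterLength 1 α h = quarterLength 1 α h := by ring
  rw [e1, ← tangentAngle_sub hh hα hα', ← tangentAngle_sub hh hα hα', tangentAngle_neg,
    tangentAngle_quarter hh hα hα'] at e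
  linarith

lemma tangentAngle_half_sub (hh : IsShape h) (hα : 0 < α) (hα' : α < Real.pi / 2) (t : ℝ) :
    tangentAngle 1 α h (2 * quarterLength 1 α h - t) = 2 * Real.pi - tangentAngle 1 α h t := by
  rw [sub_eq_neg_add, tangentAngle_add hh hα hα', tangentAngle_neg]; ring

/-! ### The boundary curve -/

lemma continuous_tangent (hh : IsShape h) (hα : 0 < α) (hα' : α < Real.pi / 2) :
    Continuous (tangent 1 α h) := by
  have := continuous_tangentAngle hh hα hα'
  unfold tangent
  fun_prop

lemma hasStrictDerivAt_boundary (hh : IsShape h) (hα : 0 < α) (hα' : α < Real.pi / 2) (t : ℝ) :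
    HasStrictDerivAt (boundary 1 α h) (tangent 1 α h t) t := by
  have hc := continuous_tangent hh hα hα'
  exact (intervalIntegral.integral_hasStrictDerivAt_right (hc.intervalIntegrable _ _)
    (hc.stronglyMeasurableAtFilter _ _) hc.continuousAt).const_add _

lemma boundary_sub (hh : IsShape h) (hα : 0 < α) (hα' : α < Real.pi / 2) (a b : ℝ) :
    boundary 1 α h b - boundary 1 α h a = ∫ r in a..b, tangent 1 α h r := by
  have hc := continuous_tangent hh hα hα'
  rw [← intervalIntegral.integral_interval_sub_left (a := 0) (hc.intervalIntegrable _ _)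
    (hc.intervalIntegrable _ _), boundary, boundary]
  ring

lemma tangent_re (t : ℝ) : (tangent 1 α h t).re = Real.cos (tangentAngle 1 α h t) :=
  Complex.exp_ofReal_mul_I_re _

lemma tangent_im (t : ℝ) : (tangent 1 α h t).im = Real.sin (tangentAngle 1 α h t) :=
  Complex.exp_ofReal_mul_I_im _

lemma hasDerivAt_boundary_re (hh : IsShape h) (hα : 0 < α) (hα' : α < Real.pi / 2) (t : ℝ) :
    HasDerivAt (fun t => (boundary 1 α h t).re) (Real.cos (tangentAngle 1 α h t)) t := by
  rw [← tangent_re]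
  exact Complex.reCLM.hasFDerivAt.comp_hasDerivAt t
    (hasStrictDerivAt_boundary hh hα hα' t).hasDerivAt

lemma hasDerivAt_boundary_im (hh : IsShape h) (hα : 0 < α) (hα' : α < Real.pi / 2) (t : ℝ) :
    HasDerivAt (fun t => (boundary 1 α h t).im) (Real.sin (tangentAngle 1 α h t)) t := by
  rw [← tangent_im]
  exact Complex.imCLM.hasFDerivAt.comp_hasDerivAt t
    (hasStrictDerivAt_boundary hh hα hα' t).hasDerivAt

lemma boundary_zero : boundary 1 α h 0 = halfWidth 1 α h := by simp [boundary]

lemma boundary_re_sub (hh : IsShape h) (hα : 0 < α) (hα' : α < Real.pi / 2) (a b : ℝ) :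
    (boundary 1 α h b).re - (boundary 1 α h a).re =
      ∫ r in a..b, Real.cos (tangentAngle 1 α h r) := by
  have hc := continuous_tangentAngle hh hα hα'
  exact (intervalIntegral.integral_eq_sub_of_hasDerivAt
    (fun t _ => hasDerivAt_boundary_re hh hα hα' t)
    ((Real.continuous_cos.comp hc).intervalIntegrable _ _)).symm

lemma boundary_im_sub (hh : IsShape h) (hα : 0 < α) (hα' : α < Real.pi / 2) (a b : ℝ) :
    (boundary 1 α h b).im - (boundary 1 α h a).im =
      ∫ r in a..b, Real.sin (tangentAngle 1 α h r) := by
  have hc := continuous_tangentAngle hh hα hα'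
  exact (intervalIntegral.integral_eq_sub_of_hasDerivAt
    (fun t _ => hasDerivAt_boundary_im hh hα hα' t)
    ((Real.continuous_sin.comp hc).intervalIntegrable _ _)).symm

lemma boundary_quarter_re (hh : IsShape h) (hα : 0 < α) (hα' : α < Real.pi / 2) :
    (boundary 1 α h (quarterLength 1 α h)).re = 0 := by
  have := boundary_re_sub hh hα hα' 0 (quarterLength 1 α h)
  rw [boundary_zero, Complex.ofReal_re, halfWidth] at this
  linarith

lemma boundary_neg (hh : IsShape h) (hα : 0 < α) (hα' : α < Real.pi / 2) (t : ℝ) :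
    boundary 1 α h (-t) = (starRingEnd ℂ) (boundary 1 α h t) := by
  have hc := continuous_tangentAngle hh hα hα'
  have e1 := boundary_re_sub hh hα hα' 0 t
  have e2 := boundary_re_sub hh hα hα' 0 (-t)
  have e3 := boundary_im_sub hh hα hα' 0 t
  have e4 := boundary_im_sub hh hα hα' 0 (-t)
  have f1 := intervalIntegral.integral_comp_neg (a := 0) (b := t)
    (fun r => Real.cos (tangentAngle 1 α h r))
  have f2 := intervalIntegral.integral_comp_neg (a := 0) (b := t)
    (fun r => Real.sin (tangentAngle 1 α h r))
  simp only [tangentAngle_neg, Real.cos_pi_sub, Real.sin_pi_sub, neg_zero,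
    intervalIntegral.integral_neg] at f1 f2
  rw [intervalIntegral.integral_symm (-t) 0] at e2 e4
  rw [boundary_zero, Complex.ofReal_im] at e3 e4
  apply Complex.ext
  · rw [Complex.conj_re]; linarith
  · rw [Complex.conj_im]; linarith

lemma tangent_add (hh : IsShape h) (hα : 0 < α) (hα' : α < Real.pi / 2) (t : ℝ) :
    tangent 1 α h (t + 2 * quarterLength 1 α h) = -tangent 1 α h t := by
  rw [tangent, tangent, tangentAngle_add hh hα hα']
  push_cast
  rw [add_mul, Complex.exp_add, Complex.exp_pi_mul_I]
  ring

lemma tangent_neg (t : ℝ) :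
    tangent 1 α h (-t) = -(starRingEnd ℂ) (tangent 1 α h t) := by
  apply Complex.ext
  · simp [tangent_re, tangentAngle_neg]
  · simp [tangent_im, tangentAngle_neg]

lemma boundary_add (hh : IsShape h) (hα : 0 < α) (hα' : α < Real.pi / 2) (t : ℝ) :
    boundary 1 α h (t + 2 * quarterLength 1 α h) = -boundary 1 α h t := by
  set q := quarterLength 1 α h with hq
  have e := intervalIntegral.integral_comp_add_right (a := -q) (b := t)
    (tangent 1 α h) (2 * q)
  simp only [hq, tangent_add hh hα hα', intervalIntegral.integral_neg] at e
  have e1 : -quarterLength 1 α h + 2 * quarterLength 1 α h = quarterLength 1 α h := by ring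
  rw [e1, ← boundary_sub hh hα hα', ← boundary_sub hh hα hα', boundary_neg hh hα hα'] at e
  have e2 : boundary 1 α h q + (starRingEnd ℂ) (boundary 1 α h q) = 0 := by
    rw [Complex.add_conj, boundary_quarter_re hh hα hα']; simp
  rw [← hq] at e
  linear_combination -e + e2

lemma boundary_half_sub (hh : IsShape h) (hα : 0 < α) (hα' : α < Real.pi / 2) (t : ℝ) :
    boundary 1 α h (2 * quarterLength 1 α h - t) = -(starRingEnd ℂ) (boundary 1 α h t) := by
  rw [sub_eq_neg_add, boundary_add hh hα hα', boundary_neg hh hα hα']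

lemma boundary_add_perimeter (hh : IsShape h) (hα : 0 < α) (hα' : α < Real.pi / 2) (t : ℝ) :
    boundary 1 α h (t + perimeter 1 α h) = boundary 1 α h t := by
  have : t + perimeter 1 α h = t + 2 * quarterLength 1 α h + 2 * quarterLength 1 α h := by
    rw [perimeter]; ring
  rw [this, boundary_add hh hα hα', boundary_add hh hα hα', neg_neg]

lemma curvature_add_perimeter (t : ℝ) :
    curvature 1 α h (t + perimeter 1 α h) = curvature 1 α h t := by
  have : t + perimeter 1 α h = t + 2 * quarterLength 1 α h + 2 * quarterLength 1 α h := by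
    rw [perimeter]; ring
  rw [this, curvature_add, curvature_add]

end geometry

/-! ### Injectivity of the boundary and location of its points -/

section geometry
variable {α : ℝ} {h : ℝ → ℝ}

lemma boundary_perimeter_sub (hh : IsShape h) (hα : 0 < α) (hα' : α < Real.pi / 2) (t : ℝ) :
    boundary 1 α h (perimeter 1 α h - t) = (starRingEnd ℂ) (boundary 1 α h t) := by
  rw [sub_eq_neg_add, boundary_add_perimeter hh hα hα', boundary_neg hh hα hα']

lemma arcLength_pos (hα' : α < Real.pi / 2) : 0 < arcLength 1 α := by
  rw [arcLength_one]; linarith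

lemma boundary_re_of_abs_le (hh : IsShape h) (hα : 0 < α) (hα' : α < Real.pi / 2) {t : ℝ}
    (ht : |t| ≤ arcLength 1 α) :
    (boundary 1 α h t).re = halfWidth 1 α h - 1 + Real.cos t := by
  have e := boundary_re_sub hh hα hα' 0 t
  have : ∫ r in (0 : ℝ)..t, Real.cos (tangentAngle 1 α h r) = ∫ r in (0 : ℝ)..t, -Real.sin r := by
    refine intervalIntegral.integral_congr fun r hr => ?_
    have h1 : |r| ≤ |t| := by simpa using abs_sub_left_of_mem_uIcc hr
    rw [tangentAngle_of_abs_le hh hα hα' (h1.trans ht), add_comm, Real.cos_add_pi_div_two]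
  rw [this, intervalIntegral.integral_neg, integral_sin, boundary_zero, Complex.ofReal_re,
    Real.cos_zero] at e
  linarith

lemma boundary_im_of_abs_le (hh : IsShape h) (hα : 0 < α) (hα' : α < Real.pi / 2) {t : ℝ}
    (ht : |t| ≤ arcLength 1 α) : (boundary 1 α h t).im = Real.sin t := by
  have e := boundary_im_sub hh hα hα' 0 t
  have : ∫ r in (0 : ℝ)..t, Real.sin (tangentAngle 1 α h r) = ∫ r in (0 : ℝ)..t, Real.cos r := by
    refine intervalIntegral.integral_congr fun r hr => ?_
    have h1 : |r| ≤ |t| := by simpa using abs_sub_left_of_mem_uIcc hr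
    rw [tangentAngle_of_abs_le hh hα hα' (h1.trans ht), add_comm, Real.sin_add_pi_div_two]
  rw [this, integral_cos, boundary_zero, Complex.ofReal_im, Real.sin_zero] at e
  linarith

lemma pi_div_two_lt_tangentAngle (hh : IsShape h) (hα : 0 < α) (hα' : α < Real.pi / 2) {t : ℝ}
    (ht : 0 < t) : Real.pi / 2 < tangentAngle 1 α h t := by
  have hA := arcLength_pos hα'
  have hm : 0 < min t (arcLength 1 α) := lt_min ht hA
  have := monotone_tangentAngle hh hα hα' (min_le_left t (arcLength 1 α))
  rw [tangentAngle_of_abs_le hh hα hα' (by rw [abs_of_pos hm]; exact min_le_right _ _)] at this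
  linarith

lemma cos_tangentAngle_neg (hh : IsShape h) (hα : 0 < α) (hα' : α < Real.pi / 2) {t : ℝ}
    (ht : t ∈ Ioo 0 (2 * quarterLength 1 α h)) : Real.cos (tangentAngle 1 α h t) < 0 := by
  have h1 := pi_div_two_lt_tangentAngle hh hα hα' ht.1
  have h2 := pi_div_two_lt_tangentAngle hh hα hα' (t := 2 * quarterLength 1 α h - t)
    (by linarith [ht.2])
  rw [tangentAngle_half_sub hh hα hα'] at h2
  exact Real.cos_neg_of_pi_div_two_lt_of_lt h1 (by linarith)

lemma strictAntiOn_boundary_re (hh : IsShape h) (hα : 0 < α) (hα' : α < Real.pi / 2) :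
    StrictAntiOn (fun t => (boundary 1 α h t).re) (Icc 0 (2 * quarterLength 1 α h)) := by
  refine strictAntiOn_of_deriv_neg (convex_Icc _ _)
    (fun t _ => (hasDerivAt_boundary_re hh hα hα' t).continuousAt.continuousWithinAt) fun t ht => ?_
  rw [interior_Icc] at ht
  rw [(hasDerivAt_boundary_re hh hα hα' t).deriv]
  exact cos_tangentAngle_neg hh hα hα' ht

lemma boundary_im_pos (hh : IsShape h) (hα : 0 < α) (hα' : α < Real.pi / 2) {t : ℝ}
    (ht : t ∈ Ioo 0 (2 * quarterLength 1 α h)) : 0 < (boundary 1 α h t).im := by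
  have hA := arcLength_pos hα'
  have hAq := arcLength_le hh hα
  have key : ∀ t, 0 < t → t ≤ quarterLength 1 α h → 0 < (boundary 1 α h t).im := by
    intro t ht0 htq
    have hmono : MonotoneOn (fun t => (boundary 1 α h t).im) (Icc 0 (quarterLength 1 α h)) := by
      refine monotoneOn_of_deriv_nonneg (convex_Icc _ _)
        (fun t _ => (hasDerivAt_boundary_im hh hα hα' t).continuousAt.continuousWithinAt)
        (fun t _ =>
          (hasDerivAt_boundary_im hh hα hα' t).differentiableAt.differentiableWithinAt)
        fun t ht => ?_
      rw [interior_Icc] at ht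
      rw [(hasDerivAt_boundary_im hh hα hα' t).deriv]
      have h1 := pi_div_two_lt_tangentAngle hh hα hα' ht.1
      have h2 := monotone_tangentAngle hh hα hα' ht.2.le
      rw [tangentAngle_quarter hh hα hα'] at h2
      exact Real.sin_nonneg_of_nonneg_of_le_pi (by linarith [Real.pi_pos]) h2
    -- The smoothened part can be horizontal where its curvature vanishes, so the strict inequality
    -- is taken from the circular arc.
    have hm : 0 < min t (arcLength 1 α) := lt_min ht0 hA
    have h3 := hmono ⟨hm.le, (min_le_left _ _).trans htq⟩ ⟨ht0.le, htq⟩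
      (min_le_left t (arcLength 1 α))
    have hm2 := min_le_right t (arcLength 1 α)
    simp only at h3
    rw [boundary_im_of_abs_le hh hα hα' (by rw [abs_of_pos hm]; exact hm2)] at h3
    refine lt_of_lt_of_le (Real.sin_pos_of_pos_of_lt_pi hm ?_) h3
    rw [arcLength_one] at hm2 ⊢
    linarith [Real.pi_pos]
  rcases le_total t (quarterLength 1 α h) with hq | hq
  · exact key t ht.1 hq
  · have := key (2 * quarterLength 1 α h - t) (by linarith [ht.2]) (by linarith)
    rwa [boundary_half_sub hh hα hα', Complex.neg_im, Complex.conj_im, neg_neg] at this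

/-- The abscissa is strictly decreasing on the upper half of the curve, the lower half is its mirror
image, and the sign of the ordinate separates the halves. This lets reflection points be identified
with arc length parameters. -/
lemma boundary_injOn (hh : IsShape h) (hα : 0 < α) (hα' : α < Real.pi / 2) :
    InjOn (boundary 1 α h) (Ico 0 (perimeter 1 α h)) := by
  have hq := quarterLength_pos hh hα hα'
  have hneg : ∀ t ∈ Ioo (2 * quarterLength 1 α h) (perimeter 1 α h),
      (boundary 1 α h t).im < 0 := fun t ht => by
    have ht1 := ht.1
    have ht2 := ht.2
    have := boundary_im_pos hh hα hα' (t := perimeter 1 α h - t)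
      ⟨by linarith, by rw [perimeter]; linarith⟩
    rw [boundary_perimeter_sub hh hα hα', Complex.conj_im] at this
    linarith
  have hnn : ∀ t ∈ Icc 0 (2 * quarterLength 1 α h), 0 ≤ (boundary 1 α h t).im := fun t ht => by
    rcases ht.1.eq_or_lt with h0 | h0
    · rw [← h0, boundary_zero]; simp
    rcases ht.2.eq_or_lt with h1 | h1
    · have := boundary_add hh hα hα' 0
      rw [zero_add, boundary_zero] at this
      rw [h1, this]; simp
    · exact (boundary_im_pos hh hα hα' ⟨h0, h1⟩).le
  have hinj := (strictAntiOn_boundary_re hh hα hα').injOn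
  intro a ha b hb hab
  rcases le_or_gt a (2 * quarterLength 1 α h) with h1 | h1 <;>
    rcases le_or_gt b (2 * quarterLength 1 α h) with h2 | h2
  · exact hinj ⟨ha.1, h1⟩ ⟨hb.1, h2⟩ (congrArg Complex.re hab)
  · have := hnn a ⟨ha.1, h1⟩
    have := hneg b ⟨h2, hb.2⟩
    rw [hab] at *; linarith
  · have := hnn b ⟨hb.1, h2⟩
    have := hneg a ⟨h1, ha.2⟩
    rw [hab] at *; linarith
  · have ha2 := ha.2
    have hb2 := hb.2
    have e : (boundary 1 α h (perimeter 1 α h - a)).re =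
        (boundary 1 α h (perimeter 1 α h - b)).re := by
      rw [boundary_perimeter_sub hh hα hα', boundary_perimeter_sub hh hα hα', hab]
    have := hinj (x₁ := perimeter 1 α h - a) (x₂ := perimeter 1 α h - b)
      ⟨by linarith, by rw [perimeter]; linarith⟩ ⟨by linarith, by rw [perimeter]; linarith⟩ e
    linarith

/-! ### Position of the points of the smoothened part -/

/-- The point of the smoothened part with parameter `ζ`. -/
def smoothPoint (α : ℝ) (h : ℝ → ℝ) (ζ : ℝ) : ℝ := arcLength 1 α + ζ * smoothLength 1 α h

lemma smoothPoint_mem (hh : IsShape h) (hα : 0 < α) {ζ : ℝ} (hζ : ζ ∈ Icc (0 : ℝ) 1) :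
    smoothPoint α h ζ ∈ Icc (arcLength 1 α) (quarterLength 1 α h) := by
  have hS := smoothLength_pos hh hα
  have h0 : 0 ≤ ζ * smoothLength 1 α h := mul_nonneg hζ.1 hS.le
  have h1 : ζ * smoothLength 1 α h ≤ smoothLength 1 α h := mul_le_of_le_one_left hS.le hζ.2
  rw [smoothPoint, quarterLength]
  exact ⟨by linarith, by linarith⟩

lemma tangentAngle_mem (hh : IsShape h) (hα : 0 < α) (hα' : α < Real.pi / 2) {t : ℝ}
    (ht : t ∈ Icc (arcLength 1 α) (quarterLength 1 α h)) :
    tangentAngle 1 α h t ∈ Icc (Real.pi - α) Real.pi := by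
  have h1 := monotone_tangentAngle hh hα hα' ht.1
  have h2 := monotone_tangentAngle hh hα hα' ht.2
  rw [tangentAngle_quarter hh hα hα'] at h2
  rw [tangentAngle_of_abs_le hh hα hα' (abs_of_pos (arcLength_pos hα')).le, arcLength_one] at h1
  exact ⟨by linarith, h2⟩

/-- On the smoothened part the tangent is within α of the horizontal, so the horizontal displacement
to the endpoint, which lies on the vertical axis, is the remaining arc length up to a factor in [cos
α, 1]. -/
lemma boundary_re_smoothPoint_mem (hh : IsShape h) (hα : 0 < α) (hα' : α < Real.pi / 2) {ζ : ℝ}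
    (hζ : ζ ∈ Icc (0 : ℝ) 1) :
    (boundary 1 α h (smoothPoint α h ζ)).re ∈
      Icc (smoothLength 1 α h * (1 - ζ) * Real.cos α) (smoothLength 1 α h * (1 - ζ)) := by
  have hc := continuous_tangentAngle hh hα hα'
  have hm := smoothPoint_mem hh hα hζ
  have e := boundary_re_sub hh hα hα' (smoothPoint α h ζ) (quarterLength 1 α h)
  rw [boundary_quarter_re hh hα hα'] at e
  have hl : quarterLength 1 α h - smoothPoint α h ζ = smoothLength 1 α h * (1 - ζ) := by
    rw [smoothPoint, quarterLength]; ring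
  have i1 := intervalIntegral.integral_mono_on (μ := MeasureTheory.volume) (f := fun _ => (-1 : ℝ))
    (g := fun r => Real.cos (tangentAngle 1 α h r)) hm.2 intervalIntegrable_const
    ((Real.continuous_cos.comp hc).intervalIntegrable _ _) fun r _ => Real.neg_one_le_cos _
  have i2 := intervalIntegral.integral_mono_on (μ := MeasureTheory.volume)
    (g := fun _ => -Real.cos α)
    (f := fun r => Real.cos (tangentAngle 1 α h r)) hm.2
    ((Real.continuous_cos.comp hc).intervalIntegrable _ _) intervalIntegrable_const fun r hr => by
      have := tangentAngle_mem hh hα hα' ⟨hm.1.trans hr.1, hr.2⟩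
      rw [← Real.cos_pi_sub]
      exact Real.cos_le_cos_of_nonneg_of_le_pi (by linarith [Real.pi_pos]) this.2 this.1
  rw [intervalIntegral.integral_const, smul_eq_mul, hl] at i1 i2
  exact ⟨by linarith, by linarith⟩

/-- The smoothened part starts at height cos α and rises with slope between 0 and sin α per unit of
arc length. -/
lemma boundary_im_smoothPoint_mem (hh : IsShape h) (hα : 0 < α) (hα' : α < Real.pi / 2) {ζ : ℝ}
    (hζ : ζ ∈ Icc (0 : ℝ) 1) :
    (boundary 1 α h (smoothPoint α h ζ)).im ∈
      Icc (Real.cos α) (Real.cos α + smoothLength 1 α h * Real.sin α) := by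
  have hc := continuous_tangentAngle hh hα hα'
  have hm := smoothPoint_mem hh hα hζ
  have hS := smoothLength_pos hh hα
  have hsin : 0 ≤ Real.sin α :=
    Real.sin_nonneg_of_nonneg_of_le_pi hα.le (by linarith [Real.pi_pos])
  have e := boundary_im_sub hh hα hα' (arcLength 1 α) (smoothPoint α h ζ)
  rw [boundary_im_of_abs_le hh hα hα' (abs_of_pos (arcLength_pos hα')).le, arcLength_one,
    Real.sin_pi_div_two_sub, ← arcLength_one] at e
  have hl : smoothPoint α h ζ - arcLength 1 α = ζ * smoothLength 1 α h := by
    rw [smoothPoint]; ring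
  have i1 := intervalIntegral.integral_nonneg (μ := MeasureTheory.volume)
    (f := fun r => Real.sin (tangentAngle 1 α h r)) hm.1 fun r hr => by
      have := tangentAngle_mem hh hα hα' ⟨hr.1, hr.2.trans hm.2⟩
      exact Real.sin_nonneg_of_nonneg_of_le_pi (by linarith [this.1, Real.pi_pos]) this.2
  have i2 := intervalIntegral.integral_mono_on (μ := MeasureTheory.volume)
    (g := fun _ => Real.sin α)
    (f := fun r => Real.sin (tangentAngle 1 α h r)) hm.1
    ((Real.continuous_sin.comp hc).intervalIntegrable _ _) intervalIntegrable_const fun r hr => by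
      have := tangentAngle_mem hh hα hα' ⟨hr.1, hr.2.trans hm.2⟩
      rw [← Real.sin_pi_sub]
      exact Real.sin_le_sin_of_le_of_le_pi_div_two (by linarith [this.2, Real.pi_pos]) (by linarith)
        (by linarith [this.1])
  rw [intervalIntegral.integral_const, smul_eq_mul, hl] at i2
  have : ζ * smoothLength 1 α h * Real.sin α ≤ smoothLength 1 α h * Real.sin α :=
    mul_le_mul_of_nonneg_right (mul_le_of_le_one_left hS.le hζ.2) hsin
  exact ⟨by linarith, by linarith⟩

/-- `halfWidth 1 α h - 1` is the abscissa of the centre of the right arc. The bounds compare the two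
descriptions of the junction ζ = 0: as a point of the arc it has abscissa w + sin α. -/
lemma halfWidth_sub_one_mem (hh : IsShape h) (hα : 0 < α) (hα' : α < Real.pi / 2) :
    halfWidth 1 α h - 1 ∈ Icc (smoothLength 1 α h * Real.cos α - Real.sin α)
      (smoothLength 1 α h - Real.sin α) := by
  have h0 := boundary_re_smoothPoint_mem hh hα hα' (ζ := 0) ⟨le_rfl, zero_le_one⟩
  have h1 := boundary_re_of_abs_le hh hα hα' (abs_of_pos (arcLength_pos hα')).le
  rw [smoothPoint, zero_mul, add_zero, h1, arcLength_one, Real.cos_pi_div_two_sub, sub_zero,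
    mul_one] at h0
  exact ⟨by linarith [h0.1], by linarith [h0.2]⟩

lemma tangentAngle_smoothPoint (hh : IsShape h) (hα : 0 < α) (hα' : α < Real.pi / 2) {ζ : ℝ}
    (hζ : ζ ∈ Icc (0 : ℝ) 1) : tangentAngle 1 α h (smoothPoint α h ζ) = Real.pi - turn α h ζ :=
  tangentAngle_smooth hh hα hα' hζ

end geometry

section steps
variable {α : ℝ} {h : ℝ → ℝ}

/-! ### Symmetries of the billiard map -/

lemma BilliardStep.add_half (hh : IsShape h) (hα : 0 < α) (hα' : α < Real.pi / 2) {z w : ℝ × ℝ}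
    (hs : BilliardStep 1 α h z w) :
    BilliardStep 1 α h (z.1 + 2 * quarterLength 1 α h, z.2)
      (w.1 + 2 * quarterLength 1 α h, w.2) := by
  obtain ⟨h1, h2, ⟨τ, hτ, e⟩, e'⟩ := hs
  refine ⟨h1, h2, ⟨τ, hτ, ?_⟩, ?_⟩
  · simp only [boundary_add hh hα hα', tangent_add hh hα hα']
    linear_combination -e
  · simp only [tangent_add hh hα hα']
    linear_combination -e'

lemma BilliardStep.add_perimeter (hh : IsShape h) (hα : 0 < α) (hα' : α < Real.pi / 2)
    {z w : ℝ × ℝ} (hs : BilliardStep 1 α h z w) (k : ℕ) :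
    BilliardStep 1 α h (z.1 + k * perimeter 1 α h, z.2) (w.1 + k * perimeter 1 α h, w.2) := by
  induction k with
  | zero => simpa using hs
  | succ k ih =>
    have e : ∀ t : ℝ, t + ((k + 1 : ℕ) : ℝ) * perimeter 1 α h =
        t + k * perimeter 1 α h + 2 * quarterLength 1 α h + 2 * quarterLength 1 α h := fun t => by
      rw [perimeter]; push_cast; ring
    rw [e, e]
    exact (ih.add_half hh hα hα').add_half hh hα hα'

/-- Time reversal and the mirror image each change the sign of the angle, so their composition keeps
it. -/
lemma BilliardStep.reverse (hh : IsShape h) (hα : 0 < α) (hα' : α < Real.pi / 2) {z w : ℝ × ℝ}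
    (hs : BilliardStep 1 α h z w) : BilliardStep 1 α h (-w.1, w.2) (-z.1, z.2) := by
  obtain ⟨h1, h2, ⟨τ, hτ, e⟩, e'⟩ := hs
  have e1 := congrArg (starRingEnd ℂ) e
  have e2 := congrArg (starRingEnd ℂ) e'
  simp only [map_add, map_sub, map_mul, Complex.conj_ofReal, Complex.conj_I] at e1 e2
  refine ⟨h2, h1, ⟨τ, hτ, ?_⟩, ?_⟩
  · simp only [boundary_neg hh hα hα', tangent_neg]
    linear_combination -e1 - τ * e2
  · simp only [tangent_neg]
    linear_combination e2

lemma BilliardStep.half_sub (hh : IsShape h) (hα : 0 < α) (hα' : α < Real.pi / 2) {z w : ℝ × ℝ}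
    (hs : BilliardStep 1 α h z w) :
    BilliardStep 1 α h (2 * quarterLength 1 α h - w.1, w.2)
      (2 * quarterLength 1 α h - z.1, z.2) := by
  have := (hs.reverse hh hα hα').add_half hh hα hα'
  simpa [neg_add_eq_sub] using this

lemma BilliardStep.perimeter_sub (hh : IsShape h) (hα : 0 < α) (hα' : α < Real.pi / 2)
    {z w : ℝ × ℝ} (hs : BilliardStep 1 α h z w) :
    BilliardStep 1 α h (perimeter 1 α h - w.1, w.2) (perimeter 1 α h - z.1, z.2) := by
  have := (hs.reverse hh hα hα').add_perimeter hh hα hα' 1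
  simpa [neg_add_eq_sub] using this

/-! ### Directions of the chords -/

/-- The absolute direction of an outgoing ray depends on φ - θ only, that of an incoming ray on φ +
θ, with θ the tangent angle. The reflection law thus becomes an identity between angles modulo 2π.
-/
lemma outgoing_eq (φ t : ℝ) :
    (Real.sin φ + Real.cos φ * Complex.I) * tangent 1 α h t =
      ⟨Real.sin (φ - tangentAngle 1 α h t), Real.cos (φ - tangentAngle 1 α h t)⟩ := by
  apply Complex.ext
  · simp only [Complex.mul_re, Complex.add_re, Complex.add_im, Complex.mul_im, Complex.ofReal_re,
      Complex.ofReal_im, Complex.I_re, Complex.I_im, tangent_re, tangent_im, Real.sin_sub]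
    ring
  · simp only [Complex.mul_re, Complex.add_re, Complex.add_im, Complex.mul_im, Complex.ofReal_re,
      Complex.ofReal_im, Complex.I_re, Complex.I_im, tangent_re, tangent_im, Real.cos_sub]
    ring

lemma incoming_eq (φ t : ℝ) :
    (Real.sin φ - Real.cos φ * Complex.I) * tangent 1 α h t =
      ⟨Real.sin (φ + tangentAngle 1 α h t), -Real.cos (φ + tangentAngle 1 α h t)⟩ := by
  apply Complex.ext
  · simp only [Complex.mul_re, Complex.sub_re, Complex.sub_im, Complex.mul_im, Complex.ofReal_re,
      Complex.ofReal_im, Complex.I_re, Complex.I_im, tangent_re, tangent_im, Real.sin_add]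
    ring
  · simp only [Complex.mul_re, Complex.sub_re, Complex.sub_im, Complex.mul_im, Complex.ofReal_re,
      Complex.ofReal_im, Complex.I_re, Complex.I_im, tangent_re, tangent_im, Real.cos_add]
    ring

lemma norm_outgoing (φ t : ℝ) :
    ‖((Real.sin φ : ℂ) + Real.cos φ * Complex.I) * tangent 1 α h t‖ = 1 := by
  rw [outgoing_eq, Complex.norm_eq_sqrt_sq_add_sq, Real.sin_sq_add_cos_sq, Real.sqrt_one]

lemma BilliardStep.norm_pos {z w : ℝ × ℝ} (hs : BilliardStep 1 α h z w) :
    0 < ‖boundary 1 α h w.1 - boundary 1 α h z.1‖ := by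
  obtain ⟨-, -, ⟨τ, hτ, e⟩, -⟩ := hs
  rw [e, add_sub_cancel_left, norm_mul, norm_outgoing, mul_one]
  simpa using hτ.ne'

lemma BilliardStep.boundary_eq {z w : ℝ × ℝ} (hs : BilliardStep 1 α h z w) :
    boundary 1 α h w.1 = boundary 1 α h z.1 +
      ‖boundary 1 α h w.1 - boundary 1 α h z.1‖ *
        ((Real.sin z.2 + Real.cos z.2 * Complex.I) * tangent 1 α h z.1) := by
  obtain ⟨-, -, ⟨τ, hτ, e⟩, -⟩ := hs
  have : ‖boundary 1 α h w.1 - boundary 1 α h z.1‖ = τ := by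
    rw [e, add_sub_cancel_left, norm_mul, norm_outgoing, mul_one, Complex.norm_real,
      Real.norm_of_nonneg hτ.le]
  rwa [this]

lemma abs_lt_pi_div_two_injOn {φ ψ : ℝ} (hφ : |φ| < Real.pi / 2) (hψ : |ψ| < Real.pi / 2)
    (e : Real.sin φ = Real.sin ψ) : φ = ψ := by
  rw [abs_lt] at hφ hψ
  exact Real.injOn_sin ⟨hφ.1.le, hφ.2.le⟩ ⟨hψ.1.le, hψ.2.le⟩ e

lemma tangent_ne_zero (t : ℝ) : tangent 1 α h t ≠ 0 := Complex.exp_ne_zero _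

/-- The reflection points determine the angles. -/
lemma BilliardStep.angle_eq {z w z' w' : ℝ × ℝ} (hs : BilliardStep 1 α h z w)
    (hs' : BilliardStep 1 α h z' w') (hz : z.1 = z'.1) (hw : w.1 = w'.1) :
    z.2 = z'.2 ∧ w.2 = w'.2 := by
  have e1 := hs.boundary_eq
  have e2 := hs'.boundary_eq
  have hp := hs.norm_pos
  rw [← hz, ← hw] at e2
  have hp' : (‖boundary 1 α h w.1 - boundary 1 α h z.1‖ : ℂ) ≠ 0 := by exact_mod_cast hp.ne'
  have e3 := mul_left_cancel₀ hp' (add_left_cancel (e1.symm.trans e2))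
  have e4 := hs.2.2.2.symm.trans (e3.trans ((congrArg _ (by rw [hz])).trans hs'.2.2.2))
  constructor
  · refine abs_lt_pi_div_two_injOn hs.1 hs'.1 ?_
    have := congrArg Complex.re (mul_right_cancel₀ (tangent_ne_zero _) e3)
    simpa [-Complex.ofReal_sin, -Complex.ofReal_cos] using this
  · refine abs_lt_pi_div_two_injOn hs.2.1 hs'.2.1 ?_
    rw [hw] at e4
    have := congrArg Complex.re (mul_right_cancel₀ (tangent_ne_zero _) e4)
    simpa [-Complex.ofReal_sin, -Complex.ofReal_cos] using this

lemma BilliardStep.cos_eq_one {z w : ℝ × ℝ} (hs : BilliardStep 1 α h z w) :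
    Real.cos (tangentAngle 1 α h w.1 - tangentAngle 1 α h z.1 + z.2 + w.2 - Real.pi) = 1 := by
  have e := hs.2.2.2
  rw [outgoing_eq, incoming_eq, Complex.mk.injEq] at e
  have : tangentAngle 1 α h w.1 - tangentAngle 1 α h z.1 + z.2 + w.2 - Real.pi =
      (z.2 - tangentAngle 1 α h z.1) + (w.2 + tangentAngle 1 α h w.1) - Real.pi := by ring
  rw [this, Real.cos_sub_pi, Real.cos_add, e.1, e.2]
  linear_combination Real.sin_sq_add_cos_sq (w.2 + tangentAngle 1 α h w.1)

lemma BilliardStep.angle_add {z w : ℝ × ℝ} (hs : BilliardStep 1 α h z w)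
    (h0 : 0 < tangentAngle 1 α h w.1 - tangentAngle 1 α h z.1)
    (h1 : tangentAngle 1 α h w.1 - tangentAngle 1 α h z.1 < 2 * Real.pi) :
    tangentAngle 1 α h w.1 - tangentAngle 1 α h z.1 = Real.pi - z.2 - w.2 := by
  have e := hs.cos_eq_one
  have h2 := abs_lt.1 hs.1
  have h3 := abs_lt.1 hs.2.1
  -- With the turning in (0, 2π) and both reflection angles in (-π/2, π/2), the argument lies in
  -- (-2π, 2π), where 0 is the only point with cosine 1.
  rw [Real.cos_eq_one_iff_of_lt_of_lt (by linarith) (by linarith)] at e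
  linarith

/-! ### Chords that start on the right circular arc -/

/-- A ray leaving the unit circle at position a with chord angle x runs along the line at distance
cos x from the centre (for acute x) whose normal has direction a + x. The hypotheses say that the
target lies on this line, on the forward side, and that the tangent there has the direction required
by the reflection law. -/
lemma billiardStep_of_circle (hh : IsShape h) (hα : 0 < α) (hα' : α < Real.pi / 2)
    {a x t x' : ℝ} (ha : |a| ≤ arcLength 1 α) (hx : x ∈ Ioo 0 Real.pi) (hx' : x' ∈ Ioo 0 Real.pi)
    (hθ : tangentAngle 1 α h t = Real.pi / 2 + a + x + x')
    (e : ((boundary 1 α h t).re - (halfWidth 1 α h - 1)) * Real.cos (a + x) +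
      (boundary 1 α h t).im * Real.sin (a + x) = Real.cos x)
    (hτ : 0 < (boundary 1 α h t).im * Real.cos (a + x) -
      ((boundary 1 α h t).re - (halfWidth 1 α h - 1)) * Real.sin (a + x) + Real.sin x) :
    BilliardStep 1 α h (a, Real.pi / 2 - x) (t, Real.pi / 2 - x') := by
  have hθa := tangentAngle_of_abs_le hh hα hα' ha
  have e1 : Real.pi / 2 - x - tangentAngle 1 α h a = -(a + x) := by rw [hθa]; ring
  have e2 : Real.pi / 2 - x' + tangentAngle 1 α h t = a + x + Real.pi := by rw [hθ]; ring
  have c1 : Real.cos a = Real.cos (a + x) * Real.cos x + Real.sin (a + x) * Real.sin x := by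
    rw [← Real.cos_sub, add_sub_cancel_right]
  have c2 : Real.sin a = Real.sin (a + x) * Real.cos x - Real.cos (a + x) * Real.sin x := by
    rw [← Real.sin_sub, add_sub_cancel_right]
  have sc := Real.sin_sq_add_cos_sq (a + x)
  refine ⟨abs_lt.2 ⟨by linarith [hx.2], by linarith [hx.1]⟩,
    abs_lt.2 ⟨by linarith [hx'.2], by linarith [hx'.1]⟩, ⟨_, hτ, ?_⟩, ?_⟩
  · simp only [outgoing_eq, e1, Real.sin_neg, Real.cos_neg]
    apply Complex.ext
    · rw [Complex.add_re, Complex.re_ofReal_mul, boundary_re_of_abs_le hh hα hα' ha, c1]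
      linear_combination (-((boundary 1 α h t).re - (halfWidth 1 α h - 1))) * sc +
        Real.cos (a + x) * e
    · rw [Complex.add_im, Complex.im_ofReal_mul, boundary_im_of_abs_le hh hα hα' ha, c2]
      linear_combination (-(boundary 1 α h t).im) * sc + Real.sin (a + x) * e
  · rw [outgoing_eq, incoming_eq, e1, e2, Real.sin_neg, Real.cos_neg, Real.sin_add_pi,
      Real.cos_add_pi, neg_neg]

lemma BilliardStep.circle_eq (hh : IsShape h) (hα : 0 < α) (hα' : α < Real.pi / 2)
    {z w : ℝ × ℝ} (hs : BilliardStep 1 α h z w) (ha : |z.1| ≤ arcLength 1 α) {x : ℝ}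
    (hx : z.2 = Real.pi / 2 - x) :
    ((boundary 1 α h w.1).re - (halfWidth 1 α h - 1)) * Real.cos (z.1 + x) +
      (boundary 1 α h w.1).im * Real.sin (z.1 + x) = Real.cos x ∧
    ‖boundary 1 α h w.1 - boundary 1 α h z.1‖ = (boundary 1 α h w.1).im * Real.cos (z.1 + x) -
      ((boundary 1 α h w.1).re - (halfWidth 1 α h - 1)) * Real.sin (z.1 + x) + Real.sin x := by
  have e := hs.boundary_eq
  set τ := ‖boundary 1 α h w.1 - boundary 1 α h z.1‖
  have hθa := tangentAngle_of_abs_le hh hα hα' ha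
  have e1 : z.2 - tangentAngle 1 α h z.1 = -(z.1 + x) := by rw [hθa, hx]; ring
  have c1 : Real.cos z.1 = Real.cos (z.1 + x) * Real.cos x + Real.sin (z.1 + x) * Real.sin x := by
    rw [← Real.cos_sub, add_sub_cancel_right]
  have c2 : Real.sin z.1 = Real.sin (z.1 + x) * Real.cos x - Real.cos (z.1 + x) * Real.sin x := by
    rw [← Real.sin_sub, add_sub_cancel_right]
  have sc := Real.sin_sq_add_cos_sq (z.1 + x)
  rw [outgoing_eq, e1, Real.sin_neg, Real.cos_neg] at e
  have er := congrArg Complex.re e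
  have ei := congrArg Complex.im e
  rw [Complex.add_re, Complex.re_ofReal_mul, boundary_re_of_abs_le hh hα hα' ha, c1] at er
  rw [Complex.add_im, Complex.im_ofReal_mul, boundary_im_of_abs_le hh hα hα' ha, c2] at ei
  rw [er, ei]
  constructor
  · linear_combination Real.cos x * sc
  · linear_combination (-τ + Real.sin x) * sc

lemma billiardStep_circle (hh : IsShape h) (hα : 0 < α) (hα' : α < Real.pi / 2)
    {a x : ℝ} (ha : |a| ≤ arcLength 1 α) (hx : x ∈ Ioo 0 Real.pi)
    (ha' : |a + 2 * x| ≤ arcLength 1 α) :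
    BilliardStep 1 α h (a, Real.pi / 2 - x) (a + 2 * x, Real.pi / 2 - x) := by
  have e : a + 2 * x = (a + x) + x := by ring
  have sc := Real.sin_sq_add_cos_sq (a + x)
  have hs := Real.sin_pos_of_pos_of_lt_pi hx.1 hx.2
  refine billiardStep_of_circle hh hα hα' ha hx hx ?_ ?_ ?_
  · rw [tangentAngle_of_abs_le hh hα hα' ha']; ring
  · rw [boundary_re_of_abs_le hh hα hα' ha', boundary_im_of_abs_le hh hα hα' ha', e,
      Real.cos_add (a + x) x, Real.sin_add (a + x) x]
    linear_combination Real.cos x * sc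
  · rw [boundary_re_of_abs_le hh hα hα' ha', boundary_im_of_abs_le hh hα hα' ha', e,
      Real.cos_add (a + x) x, Real.sin_add (a + x) x]
    have : (Real.sin (a + x) * Real.cos x + Real.cos (a + x) * Real.sin x) * Real.cos (a + x) -
        (halfWidth 1 α h - 1 + (Real.cos (a + x) * Real.cos x - Real.sin (a + x) * Real.sin x) -
          (halfWidth 1 α h - 1)) * Real.sin (a + x) + Real.sin x = 2 * Real.sin x := by
      linear_combination Real.sin x * sc
    rw [this]; linarith

lemma BilliardStep.circle_circle (hh : IsShape h) (hα : 0 < α) (hα' : α < Real.pi / 2)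
    {z w : ℝ × ℝ} (hs : BilliardStep 1 α h z w) (hz : |z.1| ≤ arcLength 1 α)
    (hw : |w.1| ≤ arcLength 1 α) (hzw : z.1 < w.1) :
    w.2 = z.2 ∧ w.1 = z.1 + 2 * (Real.pi / 2 - z.2) ∧
      ‖boundary 1 α h w.1 - boundary 1 α h z.1‖ = 2 * Real.cos z.2 := by
  obtain ⟨x, hx⟩ : ∃ x, x = Real.pi / 2 - z.2 := ⟨_, rfl⟩
  have hx1 : z.2 = Real.pi / 2 - x := by rw [hx]; ring
  obtain ⟨e1, e2⟩ := hs.circle_eq hh hα hα' hz hx1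
  have hA := arcLength_one (α := α)
  have hz' := abs_le.1 hz
  have hw' := abs_le.1 hw
  have hθz := tangentAngle_of_abs_le hh hα hα' hz
  have hθw := tangentAngle_of_abs_le hh hα hα' hw
  have e3 := hs.angle_add (by rw [hθz, hθw]; linarith)
    (by rw [hθz, hθw]; linarith [Real.pi_pos])
  rw [hθz, hθw] at e3
  have h1 := abs_lt.1 hs.1
  have h2 := abs_lt.1 hs.2.1
  rw [boundary_re_of_abs_le hh hα hα' hw, boundary_im_of_abs_le hh hα hα' hw] at e1 e2
  have e4 : Real.cos (w.1 - (z.1 + x)) = Real.cos x := by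
    rw [Real.cos_sub, ← e1]; ring
  -- By `e3` the left-hand side is π/2 - w.2, so both sides lie in [0, π], where the cosine is
  -- injective.
  have e5 : w.1 - (z.1 + x) = x :=
    Real.injOn_cos ⟨by linarith, by linarith⟩ ⟨by linarith, by linarith⟩ e4
  refine ⟨by linarith, by linarith, ?_⟩
  have e6 : w.1 = z.1 + x + x := by linarith
  have sc := Real.sin_sq_add_cos_sq (z.1 + x)
  rw [e2, hx1, Real.cos_pi_div_two_sub, e6, Real.cos_add (z.1 + x) x,
    Real.sin_add (z.1 + x) x]
  linear_combination Real.sin x * sc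

end steps

/-! ### The derivative of the billiard map -/

section derivative
variable {α : ℝ} {h : ℝ → ℝ}

/-- The derivative of the billiard map: `κ`, `κ'` are the curvatures and `c`, `c'` the cosines of
the angles at the two ends of a chord of length `τ`. -/
def stepMatrix (κ c κ' c' τ : ℝ) : Matrix (Fin 2) (Fin 2) ℝ :=
  !![(τ * κ - c) / c', -τ / c'; κ - κ' * ((τ * κ - c) / c'), -1 + κ' * (τ / c')]

/-- A matrix as a linear map of `ℝ × ℝ`. -/
def toCLM (A : Matrix (Fin 2) (Fin 2) ℝ) : ℝ × ℝ →L[ℝ] ℝ × ℝ :=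
  (Matrix.toLin (Module.Basis.finTwoProd ℝ) (Module.Basis.finTwoProd ℝ) A).toContinuousLinearMap

lemma toCLM_apply (A : Matrix (Fin 2) (Fin 2) ℝ) (v : ℝ × ℝ) :
    toCLM A v = (A 0 0 * v.1 + A 0 1 * v.2, A 1 0 * v.1 + A 1 1 * v.2) := by
  rw [toCLM, LinearMap.coe_toContinuousLinearMap', Matrix.eta_fin_two A,
    Matrix.toLin_finTwoProd_apply]
  simp

lemma toCLM_mul (A B : Matrix (Fin 2) (Fin 2) ℝ) : toCLM (A * B) = (toCLM A).comp (toCLM B) := by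
  refine ContinuousLinearMap.ext fun v => ?_
  rw [ContinuousLinearMap.comp_apply]
  simp only [toCLM, LinearMap.coe_toContinuousLinearMap']
  rw [Matrix.toLin_mul (Module.Basis.finTwoProd ℝ) (Module.Basis.finTwoProd ℝ)
    (Module.Basis.finTwoProd ℝ),
    LinearMap.comp_apply]

lemma toCLM_one : toCLM 1 = ContinuousLinearMap.id ℝ (ℝ × ℝ) := by
  refine ContinuousLinearMap.ext fun v => ?_
  simp [toCLM]

lemma trace_toCLM (A : Matrix (Fin 2) (Fin 2) ℝ) :
    LinearMap.trace ℝ (ℝ × ℝ) (toCLM A : ℝ × ℝ →ₗ[ℝ] ℝ × ℝ) = A.trace := by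
  rw [toCLM, LinearMap.coe_toContinuousLinearMap,
    LinearMap.trace_eq_matrix_trace ℝ (Module.Basis.finTwoProd ℝ), LinearMap.toMatrix_toLin]

lemma BilliardStep.cos_sin_sum {z w : ℝ × ℝ} (hs : BilliardStep 1 α h z w) :
    Real.cos (w.2 + tangentAngle 1 α h w.1 + z.2 - tangentAngle 1 α h z.1) = -1 ∧
    Real.sin (w.2 + tangentAngle 1 α h w.1 + z.2 - tangentAngle 1 α h z.1) = 0 := by
  have e := hs.cos_eq_one
  have e1 : tangentAngle 1 α h w.1 - tangentAngle 1 α h z.1 + z.2 + w.2 - Real.pi =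
    (w.2 + tangentAngle 1 α h w.1 + z.2 - tangentAngle 1 α h z.1) - Real.pi := by ring
  rw [e1, Real.cos_sub_pi] at e
  have e2 : Real.cos (w.2 + tangentAngle 1 α h w.1 + z.2 - tangentAngle 1 α h z.1) = -1 := by
    linarith
  refine ⟨e2, ?_⟩
  rw [Real.sin_eq_zero_iff_cos_eq]; exact Or.inr e2

/-- The vanishing of this function says that the outgoing ray of the state `p.1` passes through the
boundary point `p.2`. -/
def chordDefect (α : ℝ) (h : ℝ → ℝ) (p : (ℝ × ℝ) × ℝ) : ℝ :=
  ((boundary 1 α h p.2).re - (boundary 1 α h p.1.1).re) *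
      Real.cos (p.1.2 - tangentAngle 1 α h p.1.1) -
    ((boundary 1 α h p.2).im - (boundary 1 α h p.1.1).im) *
      Real.sin (p.1.2 - tangentAngle 1 α h p.1.1)

/-- The component of a chord in the direction of the outgoing ray. -/
def chordProj (α : ℝ) (h : ℝ → ℝ) (p : (ℝ × ℝ) × ℝ) : ℝ :=
  ((boundary 1 α h p.2).re - (boundary 1 α h p.1.1).re) *
      Real.sin (p.1.2 - tangentAngle 1 α h p.1.1) +
    ((boundary 1 α h p.2).im - (boundary 1 α h p.1.1).im) *
      Real.cos (p.1.2 - tangentAngle 1 α h p.1.1)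

lemma BilliardStep.chord_re_im {z w : ℝ × ℝ} (hs : BilliardStep 1 α h z w) :
    (boundary 1 α h w.1).re - (boundary 1 α h z.1).re =
      ‖boundary 1 α h w.1 - boundary 1 α h z.1‖ * Real.sin (z.2 - tangentAngle 1 α h z.1) ∧
    (boundary 1 α h w.1).im - (boundary 1 α h z.1).im =
      ‖boundary 1 α h w.1 - boundary 1 α h z.1‖ * Real.cos (z.2 - tangentAngle 1 α h z.1) := by
  have e := hs.boundary_eq
  rw [outgoing_eq] at e
  have er := congrArg Complex.re e
  have ei := congrArg Complex.im e
  rw [Complex.add_re, Complex.re_ofReal_mul] at er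
  rw [Complex.add_im, Complex.im_ofReal_mul] at ei
  exact ⟨by linarith, by linarith⟩

/-- The partial derivative in the end point is -cos φ', which is nonzero because the ray arrives
transversally. This is the nondegeneracy behind the implicit function theorem. -/
lemma BilliardStep.hasStrictFDerivAt_chordDefect (hh : IsShape h) (hα : 0 < α)
    (hα' : α < Real.pi / 2) {z w : ℝ × ℝ} (hs : BilliardStep 1 α h z w) :
    ∃ f' : (ℝ × ℝ) × ℝ →L[ℝ] ℝ, HasStrictFDerivAt (chordDefect α h) f' (z, w.1) ∧
      ∀ v, f' v = (‖boundary 1 α h w.1 - boundary 1 α h z.1‖ * curvature 1 α h z.1 -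
        Real.cos z.2) * v.1.1 - ‖boundary 1 α h w.1 - boundary 1 α h z.1‖ * v.1.2 -
        Real.cos w.2 * v.2 := by
  set L11 := (ContinuousLinearMap.fst ℝ ℝ ℝ).comp (ContinuousLinearMap.fst ℝ (ℝ × ℝ) ℝ) with hL11
  set L12 := (ContinuousLinearMap.snd ℝ ℝ ℝ).comp (ContinuousLinearMap.fst ℝ (ℝ × ℝ) ℝ) with hL12
  set L2 := ContinuousLinearMap.snd ℝ (ℝ × ℝ) ℝ with hL2
  have h11 : HasStrictFDerivAt (fun p : (ℝ × ℝ) × ℝ => p.1.1) L11 (z, w.1) := L11.hasStrictFDerivAt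
  have h12 : HasStrictFDerivAt (fun p : (ℝ × ℝ) × ℝ => p.1.2) L12 (z, w.1) := L12.hasStrictFDerivAt
  have h2 : HasStrictFDerivAt (fun p : (ℝ × ℝ) × ℝ => p.2) L2 (z, w.1) := L2.hasStrictFDerivAt
  have hre : ∀ t, HasStrictDerivAt (fun t => (boundary 1 α h t).re)
      (Real.cos (tangentAngle 1 α h t)) t := fun t => by
    rw [← tangent_re]
    exact Complex.reCLM.hasStrictFDerivAt.comp_hasStrictDerivAt t
      (hasStrictDerivAt_boundary hh hα hα' t)
  have him : ∀ t, HasStrictDerivAt (fun t => (boundary 1 α h t).im)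
      (Real.sin (tangentAngle 1 α h t)) t := fun t => by
    rw [← tangent_im]
    exact Complex.imCLM.hasStrictFDerivAt.comp_hasStrictDerivAt t
      (hasStrictDerivAt_boundary hh hα hα' t)
  have hψ := h12.sub
    ((hasStrictDerivAt_tangentAngle hh hα hα' z.1).comp_hasStrictFDerivAt (z, w.1) h11)
  have hx := ((hre w.1).comp_hasStrictFDerivAt (z, w.1) h2).sub
    ((hre z.1).comp_hasStrictFDerivAt (z, w.1) h11)
  have hy := ((him w.1).comp_hasStrictFDerivAt (z, w.1) h2).sub
    ((him z.1).comp_hasStrictFDerivAt (z, w.1) h11)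
  refine ⟨_, (hx.mul hψ.cos).sub (hy.mul hψ.sin), fun v => ?_⟩
  obtain ⟨e1, e2⟩ := hs.chord_re_im
  have e3 := hs.2.2.2
  rw [outgoing_eq, incoming_eq, Complex.mk.injEq] at e3
  have c1 : Real.cos z.2 = Real.cos (z.2 - tangentAngle 1 α h z.1) *
      Real.cos (tangentAngle 1 α h z.1) - Real.sin (z.2 - tangentAngle 1 α h z.1) *
      Real.sin (tangentAngle 1 α h z.1) := by rw [← Real.cos_add, sub_add_cancel]
  have c2 : -Real.cos w.2 = Real.cos (z.2 - tangentAngle 1 α h z.1) *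
      Real.cos (tangentAngle 1 α h w.1) - Real.sin (z.2 - tangentAngle 1 α h z.1) *
      Real.sin (tangentAngle 1 α h w.1) := by
    rw [e3.1, e3.2]
    have := Real.cos_sub (w.2 + tangentAngle 1 α h w.1) (tangentAngle 1 α h w.1)
    rw [add_sub_cancel_right] at this
    linarith
  have sc := Real.sin_sq_add_cos_sq (z.2 - tangentAngle 1 α h z.1)
  simp only [hL11, hL12, hL2, sub_apply, add_apply,
    smul_apply, ContinuousLinearMap.comp_apply, ContinuousLinearMap.coe_fst',
    ContinuousLinearMap.coe_snd', smul_eq_mul, Pi.sub_apply, Function.comp_apply, e1, e2]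
  linear_combination (-‖boundary 1 α h w.1 - boundary 1 α h z.1‖ *
    (v.1.2 - curvature 1 α h z.1 * v.1.1)) * sc + v.1.1 * c1 - v.2 * c2

/-- The implicit function theorem applied to `chordDefect` gives the next parameter T(y) for states
y near z. The angle follows from the reflection law, and the signs that make this a billiard step
are open conditions. -/
lemma BilliardStep.exists_hasFDerivAt (hh : IsShape h) (hα : 0 < α) (hα' : α < Real.pi / 2)
    {z w : ℝ × ℝ} (hs : BilliardStep 1 α h z w) :
    ∃ R : ℝ × ℝ → ℝ × ℝ, R z = w ∧ (∀ᶠ y in 𝓝 z, BilliardStep 1 α h y (R y)) ∧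
      HasFDerivAt R (toCLM (stepMatrix (curvature 1 α h z.1) (Real.cos z.2)
        (curvature 1 α h w.1) (Real.cos w.2) ‖boundary 1 α h w.1 - boundary 1 α h z.1‖)) z := by
  obtain ⟨f', hf, hf'⟩ := hs.hasStrictFDerivAt_chordDefect hh hα hα'
  set τ := ‖boundary 1 α h w.1 - boundary 1 α h z.1‖ with hτ
  have hcw : 0 < Real.cos w.2 := Real.cos_pos_of_mem_Ioo (abs_lt.1 hs.2.1)
  have hinv : (f' ∘L .inr ℝ (ℝ × ℝ) ℝ).IsInvertible := by
    refine ⟨ContinuousLinearEquiv.unitsEquivAut ℝ (Units.mk0 (-Real.cos w.2) (by linarith)), ?_⟩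
    refine ContinuousLinearMap.ext fun v => ?_
    simp [hf', mul_comm]
  set T := hf.implicitFunctionOfProdDomain hinv with hT
  have hTz : T z = w.1 :=
    (hf.eventually_apply_eq_iff_implicitFunctionOfProdDomain hinv).self_of_nhds.mp rfl
  have hTd := (hf.hasStrictFDerivAt_implicitFunctionOfProdDomain hinv).hasFDerivAt
  have hT0 := hf.eventually_apply_implicitFunctionOfProdDomain hinv
  rw [← hT] at hTd hT0
  obtain ⟨T', hT'⟩ : ∃ T', HasFDerivAt T T' z := ⟨_, hTd⟩
  obtain ⟨e1, e2⟩ := hs.chord_re_im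
  have hbase : chordDefect α h (z, w.1) = 0 := by
    simp only [chordDefect, e1, e2]; ring
  -- Implicit differentiation: `chordDefect` is constant along the graph of T.
  have hT'v : ∀ v, T' v = ((τ * curvature 1 α h z.1 - Real.cos z.2) / Real.cos w.2) * v.1 +
      -τ / Real.cos w.2 * v.2 := fun v => by
    have hid : HasFDerivAt (fun y => (y, T y)) ((ContinuousLinearMap.id ℝ _).prod T') z :=
      (hasFDerivAt_id z).prodMk hT'
    have hf1 : HasFDerivAt (chordDefect α h) f' (z, T z) := by rw [hTz]; exact hf.hasFDerivAt
    have hcomp := hf1.comp z hid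
    have hconst : HasFDerivAt (chordDefect α h ∘ fun y => (y, T y)) (0 : ℝ × ℝ →L[ℝ] ℝ) z :=
      (hasFDerivAt_const _ z).congr_of_eventuallyEq hT0
    have := congrArg (fun L => L v) (hcomp.unique hconst)
    simp only [ContinuousLinearMap.comp_apply, ContinuousLinearMap.prod_apply, hf',
      zero_apply, ContinuousLinearMap.coe_id', id_eq] at this
    field_simp
    linarith
  have hTc : ContinuousAt T z := hT'.continuousAt
  have hθc := continuous_tangentAngle hh hα hα'
  have hγc : Continuous (boundary 1 α h) := continuous_iff_continuousAt.2 fun t =>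
    (hasStrictDerivAt_boundary hh hα hα' t).hasDerivAt.continuousAt
  -- By `cos_sin_sum`, the first four terms add up to an odd multiple of π. Keeping this multiple
  -- fixed selects the branch of the reflection law with Φ(z) = w.2.
  set Φ : ℝ × ℝ → ℝ := fun y => w.2 + tangentAngle 1 α h w.1 + z.2 - tangentAngle 1 α h z.1 +
    tangentAngle 1 α h y.1 - y.2 - tangentAngle 1 α h (T y) with hΦ
  have hΦz : Φ z = w.2 := by simp only [hΦ, hTz]; ring
  have hd1 : HasFDerivAt (fun y : ℝ × ℝ => tangentAngle 1 α h y.1)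
      (curvature 1 α h z.1 • ContinuousLinearMap.fst ℝ ℝ ℝ) z :=
    (hasStrictDerivAt_tangentAngle hh hα hα' z.1).hasDerivAt.comp_hasFDerivAt z hasFDerivAt_fst
  have hd2 : HasFDerivAt (fun y : ℝ × ℝ => tangentAngle 1 α h (T y))
      (curvature 1 α h w.1 • T') z := by
    have := (hasStrictDerivAt_tangentAngle hh hα hα' (T z)).hasDerivAt.comp_hasFDerivAt z hT'
    rwa [hTz] at this
  have hΦd : HasFDerivAt Φ (curvature 1 α h z.1 • ContinuousLinearMap.fst ℝ ℝ ℝ -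
      ContinuousLinearMap.snd ℝ ℝ ℝ - curvature 1 α h w.1 • T') z :=
    ((hd1.const_add _).sub hasFDerivAt_snd).sub hd2
  refine ⟨fun y => (T y, Φ y), Prod.ext hTz hΦz, ?_, ?_⟩
  · have hP : ContinuousAt (fun y => chordProj α h (y, T y)) z := by
      unfold chordProj
      have hγT : ContinuousAt (fun y => boundary 1 α h (T y)) z := hγc.continuousAt.comp hTc
      have hre := Complex.continuous_re.continuousAt.comp hγT
      have him := Complex.continuous_im.continuousAt.comp hγT
      simp only [Function.comp_def] at hre him
      have a0 : ContinuousAt (fun y : ℝ × ℝ => boundary 1 α h y.1) z :=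
        (hγc.comp continuous_fst).continuousAt
      have a1 := Complex.continuous_re.continuousAt.comp a0
      have a2 := Complex.continuous_im.continuousAt.comp a0
      have a3 : ContinuousAt (fun y : ℝ × ℝ => y.2 - tangentAngle 1 α h y.1) z :=
        (continuous_snd.sub (hθc.comp continuous_fst)).continuousAt
      exact ((hre.sub a1).mul (Real.continuous_sin.continuousAt.comp a3)).add
        ((him.sub a2).mul (Real.continuous_cos.continuousAt.comp a3))
    have hPz : 0 < chordProj α h (z, T z) := by
      rw [hTz]
      simp only [chordProj, e1, e2]
      have sc := Real.sin_sq_add_cos_sq (z.2 - tangentAngle 1 α h z.1)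
      have := hs.norm_pos
      calc 0 < τ := this
        _ = _ := by linear_combination -τ * sc
    have o1 : ∀ᶠ y : ℝ × ℝ in 𝓝 z, |y.2| < Real.pi / 2 :=
      (continuous_abs.comp continuous_snd).continuousAt.eventually_lt continuousAt_const hs.1
    have o2 : ∀ᶠ y : ℝ × ℝ in 𝓝 z, |Φ y| < Real.pi / 2 :=
      hΦd.continuousAt.abs.eventually_lt continuousAt_const (by rw [hΦz]; exact hs.2.1)
    have o3 : ∀ᶠ y in 𝓝 z, 0 < chordProj α h (y, T y) :=
      continuousAt_const.eventually_lt hP hPz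
    filter_upwards [o1, o2, o3, hT0] with y y1 y2 y3 y4
    refine ⟨y1, y2, ⟨_, y3, ?_⟩, ?_⟩
    · rw [hbase] at y4
      simp only [outgoing_eq]
      have sc := Real.sin_sq_add_cos_sq (y.2 - tangentAngle 1 α h y.1)
      simp only [chordDefect] at y4
      apply Complex.ext
      · rw [Complex.add_re, Complex.re_ofReal_mul]
        simp only [chordProj]
        linear_combination Real.cos (y.2 - tangentAngle 1 α h y.1) * y4 -
          ((boundary 1 α h (T y)).re - (boundary 1 α h y.1).re) * sc
      · rw [Complex.add_im, Complex.im_ofReal_mul]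
        simp only [chordProj]
        linear_combination -Real.sin (y.2 - tangentAngle 1 α h y.1) * y4 -
          ((boundary 1 α h (T y)).im - (boundary 1 α h y.1).im) * sc
    · obtain ⟨c1, c2⟩ := hs.cos_sin_sum
      have : Φ y + tangentAngle 1 α h (T y) = (w.2 + tangentAngle 1 α h w.1 + z.2 -
          tangentAngle 1 α h z.1) - (y.2 - tangentAngle 1 α h y.1) := by
        simp only [hΦ]; ring
      simp only [outgoing_eq, incoming_eq, this]
      rw [Real.sin_sub _ (y.2 - _), Real.cos_sub _ (y.2 - _), c1, c2]
      simp
  · refine (hT'.prodMk hΦd).congr_fderiv (ContinuousLinearMap.ext fun v => ?_)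
    simp only [toCLM_apply, ContinuousLinearMap.prod_apply, sub_apply,
      smul_apply, ContinuousLinearMap.coe_fst', ContinuousLinearMap.coe_snd',
      smul_eq_mul, hT'v, stepMatrix]
    simp
    ring

/-! ### Compositions -/

/-- The matrix of the derivative of the billiard map at the step from `z` to `w`. -/
def stepDeriv (α : ℝ) (h : ℝ → ℝ) (z w : ℝ × ℝ) : Matrix (Fin 2) (Fin 2) ℝ :=
  stepMatrix (curvature 1 α h z.1) (Real.cos z.2) (curvature 1 α h w.1) (Real.cos w.2)
    ‖boundary 1 α h w.1 - boundary 1 α h z.1‖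

/-- The product of the matrices `D (p - 1) * ⋯ * D 0`. -/
def prodMatrix (D : ℕ → Matrix (Fin 2) (Fin 2) ℝ) : ℕ → Matrix (Fin 2) (Fin 2) ℝ
  | 0 => 1
  | p + 1 => D p * prodMatrix D p

lemma prodMatrix_add_of_eq {D : ℕ → Matrix (Fin 2) (Fin 2) ℝ} {C : Matrix (Fin 2) (Fin 2) ℝ}
    {p j : ℕ} (hC : ∀ i < j, D (p + i) = C) : prodMatrix D (p + j) = C ^ j * prodMatrix D p := by
  induction j with
  | zero => simp
  | succ j ih =>
    rw [← add_assoc, prodMatrix, ih fun i hi => hC i (by omega), hC j (by omega), pow_succ',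
      mul_assoc]

lemma BilliardIter.succ {ρ : ℝ} {p : ℕ} {z w v : ℝ × ℝ} (hi : BilliardIter ρ α h p z w)
    (hs : BilliardStep ρ α h w v) : BilliardIter ρ α h (p + 1) z v := by
  obtain ⟨x, x0, xp, hx⟩ := hi
  refine ⟨fun i => if i ≤ p then x i else v, by simp [x0], by simp, fun i hi => ?_⟩
  rcases (Nat.lt_succ_iff.1 hi).lt_or_eq with hlt | rfl
  · have h1 : i ≤ p := hlt.le
    have h2 : i + 1 ≤ p := hlt
    simpa [h1, h2] using hx i hlt
  · simpa [xp] using hs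

lemma isMonodromy_of_step (hh : IsShape h) (hα : 0 < α) (hα' : α < Real.pi / 2)
    {z : ℕ → ℝ × ℝ} (hz : ∀ i, BilliardStep 1 α h (z i) (z (i + 1))) (p : ℕ) :
    IsMonodromy 1 α h p z (toCLM (prodMatrix (fun i => stepDeriv α h (z i) (z (i + 1))) p)) := by
  induction p with
  | zero =>
    refine ⟨id, rfl, Eventually.of_forall fun w => ⟨fun _ => w, rfl, rfl, by simp⟩, ?_⟩
    rw [prodMatrix, toCLM_one]
    exact hasFDerivAt_id _
  | succ p ih =>
    obtain ⟨R, R0, R1, R2⟩ := ih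
    obtain ⟨S, S0, S1, S2⟩ := (hz p).exists_hasFDerivAt hh hα hα'
    refine ⟨S ∘ R, by simp [R0, S0], ?_, ?_⟩
    · have : Tendsto R (𝓝 (z 0)) (𝓝 (z p)) := by
        have := R2.continuousAt.tendsto
        rwa [R0] at this
      filter_upwards [R1, this.eventually S1] with w w1 w2
      exact w1.succ w2
    · rw [prodMatrix, toCLM_mul]
      refine HasFDerivAt.comp (z 0) ?_ R2
      rw [R0]
      exact S2

end derivative

/-! ### Every orbit of the given type satisfies the chord equations -/

section orbits
variable {α : ℝ} {h : ℝ → ℝ}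

lemma billiardStep_circle_seq (hh : IsShape h) (hα : 0 < α) (hα' : α < Real.pi / 2)
    {a : ℕ → ℝ × ℝ} {n : ℕ} (hs : ∀ i < n, BilliardStep 1 α h (a i) (a (i + 1)))
    (h0 : (a 0).1 = 0) (hA : ∀ i ≤ n, |(a i).1| ≤ arcLength 1 α)
    (hlt : ∀ i < n, (a i).1 < (a (i + 1)).1) {x : ℝ} (hx : (a 0).2 = Real.pi / 2 - x) :
    ∀ i ≤ n, a i = (2 * i * x, Real.pi / 2 - x) := by
  intro i
  induction i with
  | zero => intro _; ext <;> simp [h0, hx]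
  | succ i ih =>
    intro hi
    have e := ih (by omega)
    obtain ⟨e1, e2, -⟩ := (hs i hi).circle_circle hh hα hα' (hA i (by omega)) (hA _ hi) (hlt i hi)
    rw [e] at e1 e2
    refine Prod.ext (e2.trans ?_) e1
    push_cast
    ring

lemma boundary_add_mul_perimeter (hh : IsShape h) (hα : 0 < α) (hα' : α < Real.pi / 2) (t : ℝ)
    (k : ℕ) : boundary 1 α h (t + k * perimeter 1 α h) = boundary 1 α h t := by
  induction k with
  | zero => simp
  | succ k ih =>
    rw [← ih, ← boundary_add_perimeter hh hα hα' (t + k * perimeter 1 α h)]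
    congr 1; push_cast; ring

lemma norm_boundary_half_sub (hh : IsShape h) (hα : 0 < α) (hα' : α < Real.pi / 2) (a b : ℝ) :
    ‖boundary 1 α h (2 * quarterLength 1 α h - a) - boundary 1 α h (2 * quarterLength 1 α h - b)‖ =
      ‖boundary 1 α h a - boundary 1 α h b‖ := by
  rw [boundary_half_sub hh hα hα', boundary_half_sub hh hα hα', neg_sub_neg, ← map_sub,
    Complex.norm_conj, norm_sub_rev]

namespace IsOrbit

variable {n : ℕ} {ζ : ℝ} {z : ℕ → ℝ × ℝ}

lemma fst_lt (ho : IsOrbit 1 α h n ζ z) {i j : ℕ} (hij : i < j) : (z i).1 < (z j).1 :=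
  ho.strictMono hij

lemma fst_le (ho : IsOrbit 1 α h n ζ z) {i j : ℕ} (hij : i ≤ j) : (z i).1 ≤ (z j).1 :=
  ho.strictMono.monotone hij

lemma periodic_mul (ho : IsOrbit 1 α h n ζ z) (i k : ℕ) :
    z (i + 4 * (n + 1) * k) = ((z i).1 + k * perimeter 1 α h, (z i).2) := by
  induction k with
  | zero => simp
  | succ k ih =>
    rw [mul_add, mul_one, ← add_assoc, ho.periodic, ih]
    refine Prod.ext ?_ rfl
    push_cast; ring

lemma fst_period (ho : IsOrbit 1 α h n ζ z) : (z (4 * (n + 1))).1 = perimeter 1 α h := by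
  have := ho.periodic 0
  rw [zero_add] at this
  rw [this, ho.mid_right, zero_add]

/-- The symmetry of the orbit is only an equality of point sets; injectivity of the boundary turns
it into a statement about parameters in one period. -/
lemma exists_mirror (ho : IsOrbit 1 α h n ζ z) (hh : IsShape h) (hα : 0 < α)
    (hα' : α < Real.pi / 2) {i : ℕ} (hi : 0 < i) (hi' : i < 4 * (n + 1)) :
    ∃ j, 0 < j ∧ j < 4 * (n + 1) ∧ (z j).1 = perimeter 1 α h - (z i).1 := by
  have hp := ho.fst_period
  have h0 := ho.mid_right
  have hi1 := ho.fst_lt hi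
  have hi2 := ho.fst_lt hi'
  have hmem : (starRingEnd ℂ) (boundary 1 α h (z i).1) ∈ reflectionPoints 1 α h z := by
    rw [← ho.symm_horizontal]
    exact mem_image_of_mem _ (mem_range_self i)
  obtain ⟨j, hj⟩ := hmem
  have hlt : j % (4 * (n + 1)) < 4 * (n + 1) := Nat.mod_lt _ (by omega)
  have e := ho.periodic_mul (j % (4 * (n + 1))) (j / (4 * (n + 1)))
  rw [Nat.mod_add_div] at e
  simp only [e, boundary_add_mul_perimeter hh hα hα', ← boundary_perimeter_sub hh hα hα'] at hj
  have hj1 := ho.fst_le (Nat.zero_le (j % (4 * (n + 1))))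
  have hj2 := ho.fst_lt hlt
  have e2 := boundary_injOn hh hα hα' (x₁ := (z (j % (4 * (n + 1)))).1)
    (x₂ := perimeter 1 α h - (z i).1) ⟨by linarith, by linarith⟩ ⟨by linarith, by linarith⟩ hj
  refine ⟨_, Nat.pos_of_ne_zero fun hj0 => ?_, hlt, e2⟩
  rw [hj0, h0] at e2
  linarith

/-- The mirror image is an order-reversing involution of the parameters strictly inside one period,
so it must send index i to index 4(n+1) - i. -/
lemma fst_mirror (ho : IsOrbit 1 α h n ζ z) (hh : IsShape h) (hα : 0 < α)
    (hα' : α < Real.pi / 2) {i : ℕ} (hi : i ≤ 4 * (n + 1)) :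
    (z (4 * (n + 1) - i)).1 = perimeter 1 α h - (z i).1 := by
  have hp := ho.fst_period
  have h0 := ho.mid_right
  induction i with
  | zero => rw [Nat.sub_zero, hp, h0, sub_zero]
  | succ i ih =>
    have ih' := ih (by omega)
    rcases hi.eq_or_lt with he | hlt
    · rw [he, Nat.sub_self, hp, h0, sub_self]
    obtain ⟨j, hj0, hj1, hj⟩ := ho.exists_mirror hh hα hα' (Nat.succ_pos i) hlt
    obtain ⟨k, hk0, hk1, hk⟩ := ho.exists_mirror hh hα hα' (i := 4 * (n + 1) - (i + 1))
      (by omega) (by omega)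
    -- If j is the mirror of i + 1 and k that of 4(n+1) - (i+1), order reversal and the induction
    -- hypothesis give j ≤ 4(n+1) - (i+1) and i + 1 ≤ k. The two resulting inequalities are
    -- opposite.
    have a1 : j < 4 * (n + 1) - i := ho.strictMono.lt_iff_lt.1 <| by
      have := ho.fst_lt (Nat.lt_succ_self i)
      simp only [ih', hj]; linarith
    have a2 : i < k := ho.strictMono.lt_iff_lt.1 <| by
      have := ho.fst_lt (show 4 * (n + 1) - (i + 1) < 4 * (n + 1) - i by omega)
      simp only [hk]; linarith
    have a3 := ho.fst_le (show j ≤ 4 * (n + 1) - (i + 1) by omega)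
    have a4 := ho.fst_le (show i + 1 ≤ k from a2)
    linarith

lemma mirror (ho : IsOrbit 1 α h n ζ z) (hh : IsShape h) (hα : 0 < α)
    (hα' : α < Real.pi / 2) {i : ℕ} (hi : i ≤ 2 * n + 2) :
    z (4 * (n + 1) - i) = (perimeter 1 α h - (z i).1, (z i).2) := by
  refine Prod.ext (ho.fst_mirror hh hα hα' (by omega)) ?_
  rcases hi.eq_or_lt with rfl | hlt
  · rw [show 4 * (n + 1) - (2 * n + 2) = 2 * n + 2 by omega]
  · have s1 := (ho.step i).perimeter_sub hh hα hα'
    have s2 := ho.step (4 * (n + 1) - (i + 1))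
    rw [show 4 * (n + 1) - (i + 1) + 1 = 4 * (n + 1) - i by omega] at s2
    exact (s2.angle_eq s1 (ho.fst_mirror hh hα hα' (by omega))
      (ho.fst_mirror hh hα hα' (by omega))).2

lemma fst_mem_arc_right (ho : IsOrbit 1 α h n ζ z) (hh : IsShape h) (hα : 0 < α)
    (hα' : α < Real.pi / 2) {i : ℕ} (hi : i ≤ n) : 0 ≤ (z i).1 ∧ (z i).1 < arcLength 1 α := by
  have h0 := ho.fst_le (Nat.zero_le i)
  rw [ho.mid_right] at h0
  have h1 := ho.fst_lt (show i < n + 1 by omega)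
  rw [ho.smooth] at h1
  have h2 := (smoothPoint_mem hh hα ⟨ho.mem.1.le, ho.mem.2.le⟩).2
  rw [smoothPoint] at h2
  have h3 := ho.circular i (by omega) (by omega)
  rw [midDist_of_abs_le hh hα hα' (by rw [abs_of_nonneg h0]; linarith), abs_of_nonneg h0] at h3
  exact ⟨h0, h3⟩

lemma fst_mem_arc_left (ho : IsOrbit 1 α h n ζ z) (hh : IsShape h) (hα : 0 < α)
    (hα' : α < Real.pi / 2) {i : ℕ} (hi : i ≤ n) :
    0 ≤ 2 * quarterLength 1 α h - (z (2 * n + 2 - i)).1 ∧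
      2 * quarterLength 1 α h - (z (2 * n + 2 - i)).1 < arcLength 1 α := by
  have h0 := ho.fst_le (show 2 * n + 2 - i ≤ 2 * n + 2 by omega)
  rw [ho.mid_left] at h0
  have h1 := ho.fst_lt (show n + 1 < 2 * n + 2 - i by omega)
  rw [ho.smooth] at h1
  have h2 := (smoothPoint_mem hh hα ⟨ho.mem.1.le, ho.mem.2.le⟩).1
  rw [smoothPoint] at h2
  have hA := arcLength_pos hα'
  have hAq := arcLength_le hh hα
  have h3 := ho.circular (2 * n + 2 - i) (by omega) (by omega)
  set t := (z (2 * n + 2 - i)).1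
  have e : midDist 1 α h t = midDist 1 α h (2 * quarterLength 1 α h - t) := by
    rw [sub_eq_neg_add, midDist_add, midDist_neg]
  -- The first case is void: the point comes after the smoothened reflection, so t exceeds
  -- `arcLength 1 α`, and on the right copy `midDist` is t itself.
  rcases le_total t (quarterLength 1 α h) with htq | htq
  · rw [midDist_of_abs_le hh hα hα' (by rw [abs_of_nonneg (by linarith)]; exact htq),
      abs_of_nonneg (by linarith)] at h3
    linarith
  · rw [e, midDist_of_abs_le hh hα hα' (by rw [abs_of_nonneg (by linarith)]; linarith),
      abs_of_nonneg (by linarith)] at h3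
    exact ⟨by linarith, h3⟩

lemma right_eq (ho : IsOrbit 1 α h n ζ z) (hh : IsShape h) (hα : 0 < α)
    (hα' : α < Real.pi / 2) {x : ℝ} (hx : (z 0).2 = Real.pi / 2 - x) {i : ℕ} (hi : i ≤ n) :
    z i = (2 * i * x, Real.pi / 2 - x) := by
  refine billiardStep_circle_seq hh hα hα' (fun i _ => ho.step i) ho.mid_right (fun i hi => ?_)
    (fun i _ => ho.fst_lt (Nat.lt_succ_self i)) hx i hi
  obtain ⟨h1, h2⟩ := ho.fst_mem_arc_right hh hα hα' hi
  rw [abs_of_nonneg h1]; exact h2.le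

lemma left_eq (ho : IsOrbit 1 α h n ζ z) (hh : IsShape h) (hα : 0 < α)
    (hα' : α < Real.pi / 2) {y : ℝ} (hy : (z (2 * n + 2)).2 = Real.pi / 2 - y) {i : ℕ}
    (hi : i ≤ n) :
    (2 * quarterLength 1 α h - (z (2 * n + 2 - i)).1, (z (2 * n + 2 - i)).2) =
      (2 * i * y, Real.pi / 2 - y) := by
  refine billiardStep_circle_seq hh hα hα' (a := fun i =>
    (2 * quarterLength 1 α h - (z (2 * n + 2 - i)).1, (z (2 * n + 2 - i)).2)) (fun i hi => ?_)
    (by simp [ho.mid_left]) (fun i hi => ?_) (fun i hi => ?_) hy i hi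
  · have := (ho.step (2 * n + 2 - (i + 1))).half_sub hh hα hα'
    rwa [show 2 * n + 2 - (i + 1) + 1 = 2 * n + 2 - i by omega] at this
  · obtain ⟨h1, h2⟩ := ho.fst_mem_arc_left hh hα hα' hi
    rw [abs_of_nonneg h1]; exact h2.le
  · have := ho.fst_lt (show 2 * n + 2 - (i + 1) < 2 * n + 2 - i by omega)
    simp only; linarith

lemma smooth_eq (ho : IsOrbit 1 α h n ζ z) : (z (n + 1)).1 = smoothPoint α h ζ := ho.smooth

/-- The equations for the chord from the right arc to the smoothened part. -/
lemma right_chord (ho : IsOrbit 1 α h n ζ z) (hh : IsShape h) (hα : 0 < α)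
    (hα' : α < Real.pi / 2) {x x' : ℝ} (hx : (z 0).2 = Real.pi / 2 - x)
    (hx' : (z (n + 1)).2 = Real.pi / 2 - x') :
    ((boundary 1 α h (smoothPoint α h ζ)).re - (halfWidth 1 α h - 1)) *
        Real.cos ((2 * n + 1) * x) +
      (boundary 1 α h (smoothPoint α h ζ)).im * Real.sin ((2 * n + 1) * x) = Real.cos x ∧
    ‖boundary 1 α h (z (n + 1)).1 - boundary 1 α h (z n).1‖ =
      (boundary 1 α h (smoothPoint α h ζ)).im * Real.cos ((2 * n + 1) * x) -
      ((boundary 1 α h (smoothPoint α h ζ)).re - (halfWidth 1 α h - 1)) *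
        Real.sin ((2 * n + 1) * x) + Real.sin x ∧
    x' = Real.pi / 2 - turn α h ζ - (2 * n + 1) * x := by
  have hn := ho.right_eq hh hα hα' hx le_rfl
  obtain ⟨h1, h2⟩ := ho.fst_mem_arc_right hh hα hα' (le_refl n)
  have habs : |(z n).1| ≤ arcLength 1 α := by rw [abs_of_nonneg h1]; exact h2.le
  have hφ : (z n).2 = Real.pi / 2 - x := by rw [hn]
  obtain ⟨e1, e2⟩ := (ho.step n).circle_eq hh hα hα' habs hφ
  have hfst : (z n).1 + x = (2 * n + 1) * x := by rw [hn]; ring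
  rw [hfst, ho.smooth_eq] at e1 e2
  refine ⟨e1, by rw [ho.smooth_eq, e2], ?_⟩
  have hζ : ζ ∈ Icc (0 : ℝ) 1 := ⟨ho.mem.1.le, ho.mem.2.le⟩
  have e3 := (ho.step n).angle_add
  have ht0 := turn_nonneg hh hα hζ
  have ht1 := turn_le hh hα hζ
  have hA := arcLength_one (α := α)
  rw [ho.smooth_eq, tangentAngle_smoothPoint hh hα hα' hζ, tangentAngle_of_abs_le hh hα hα' habs,
    hx', hφ] at e3
  have := e3 (by linarith) (by linarith [Real.pi_pos])
  linarith

/-- The equations for the chord from the smoothened part to the left arc. -/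
lemma left_chord (ho : IsOrbit 1 α h n ζ z) (hh : IsShape h) (hα : 0 < α)
    (hα' : α < Real.pi / 2) {y x' : ℝ} (hy : (z (2 * n + 2)).2 = Real.pi / 2 - y)
    (hx' : (z (n + 1)).2 = Real.pi / 2 - x') :
    (-(boundary 1 α h (smoothPoint α h ζ)).re - (halfWidth 1 α h - 1)) *
        Real.cos ((2 * n + 1) * y) +
      (boundary 1 α h (smoothPoint α h ζ)).im * Real.sin ((2 * n + 1) * y) = Real.cos y ∧
    ‖boundary 1 α h (z (n + 2)).1 - boundary 1 α h (z (n + 1)).1‖ =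
      (boundary 1 α h (smoothPoint α h ζ)).im * Real.cos ((2 * n + 1) * y) -
      (-(boundary 1 α h (smoothPoint α h ζ)).re - (halfWidth 1 α h - 1)) *
        Real.sin ((2 * n + 1) * y) + Real.sin y ∧
    x' = Real.pi / 2 + turn α h ζ - (2 * n + 1) * y := by
  have hn := ho.left_eq hh hα hα' hy le_rfl
  obtain ⟨h1, h2⟩ := ho.fst_mem_arc_left hh hα hα' (le_refl n)
  rw [show 2 * n + 2 - n = n + 2 by omega] at hn h1 h2
  have hn1 := congrArg Prod.fst hn
  have hφ := congrArg Prod.snd hn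
  simp only at hn1 hφ
  have habs : |2 * quarterLength 1 α h - (z (n + 2)).1| ≤ arcLength 1 α := by
    rw [abs_of_nonneg h1]; exact h2.le
  have hstep := (ho.step (n + 1)).half_sub hh hα hα'
  rw [show n + 1 + 1 = n + 2 from rfl] at hstep
  obtain ⟨e1, e2⟩ := hstep.circle_eq hh hα hα' habs hφ
  have hfst : 2 * quarterLength 1 α h - (z (n + 2)).1 + y = (2 * n + 1) * y := by rw [hn1]; ring
  simp only [hfst, ho.smooth_eq] at e1 e2
  rw [norm_boundary_half_sub hh hα hα'] at e2
  rw [boundary_half_sub hh hα hα' (smoothPoint α h ζ), Complex.neg_re, Complex.neg_im,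
    Complex.conj_re, Complex.conj_im, neg_neg] at e1 e2
  refine ⟨e1, ?_, ?_⟩
  · rw [← e2, ho.smooth_eq, norm_sub_rev]
  have hζ : ζ ∈ Icc (0 : ℝ) 1 := ⟨ho.mem.1.le, ho.mem.2.le⟩
  have e3 := hstep.angle_add
  have ht0 := turn_nonneg hh hα hζ
  have ht1 := turn_le hh hα hζ
  have hA := arcLength_one (α := α)
  simp only [ho.smooth_eq, tangentAngle_half_sub hh hα hα' (smoothPoint α h ζ),
    tangentAngle_smoothPoint hh hα hα' hζ, tangentAngle_of_abs_le hh hα hα' habs, hx', hφ] at e3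
  have := e3 (by linarith) (by linarith [Real.pi_pos])
  linarith

end IsOrbit

/-! ### The trace of the monodromy matrix -/

/-- Within the unit circle the map is (s, φ) ↦ (s + π - 2φ, φ), whose derivative is this shear. -/
lemma stepMatrix_circle {c : ℝ} (hc : c ≠ 0) : stepMatrix 1 c 1 c (2 * c) = !![1, -2; 0, 1] := by
  unfold stepMatrix
  congr 1
  funext i j
  fin_cases i <;> fin_cases j <;> simp <;> field_simp <;> norm_num

lemma stepDeriv_perimeter_sub (hh : IsShape h) (hα : 0 < α) (hα' : α < Real.pi / 2)
    (z w : ℝ × ℝ) : stepDeriv α h (perimeter 1 α h - z.1, z.2) (perimeter 1 α h - w.1, w.2) =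
      stepDeriv α h z w := by
  have e : ∀ t, curvature 1 α h (perimeter 1 α h - t) = curvature 1 α h t := fun t => by
    rw [sub_eq_neg_add, curvature_add_perimeter, curvature_neg]
  simp only [stepDeriv, e, boundary_perimeter_sub hh hα hα', ← map_sub, Complex.norm_conj]

lemma stepDeriv_half_sub (hh : IsShape h) (hα : 0 < α) (hα' : α < Real.pi / 2)
    (z w : ℝ × ℝ) :
    stepDeriv α h (2 * quarterLength 1 α h - z.1, z.2) (2 * quarterLength 1 α h - w.1, w.2) =
      stepDeriv α h z w := by
  have e : ∀ t, curvature 1 α h (2 * quarterLength 1 α h - t) = curvature 1 α h t := fun t => by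
    rw [sub_eq_neg_add, curvature_add, curvature_neg]
  simp only [stepDeriv, e, norm_boundary_half_sub hh hα hα']

lemma stepDeriv_comm_of_circle (hh : IsShape h) (hα : 0 < α) (hα' : α < Real.pi / 2)
    {z w : ℝ × ℝ} (hs : BilliardStep 1 α h z w) (hz : |z.1| ≤ arcLength 1 α)
    (hw : |w.1| ≤ arcLength 1 α) (hzw : z.1 < w.1) :
    stepDeriv α h z w = !![1, -2; 0, 1] ∧ stepDeriv α h w z = !![1, -2; 0, 1] := by
  obtain ⟨e1, -, e3⟩ := hs.circle_circle hh hα hα' hz hw hzw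
  have hc : Real.cos z.2 ≠ 0 := (Real.cos_pos_of_mem_Ioo (abs_lt.1 hs.1)).ne'
  rw [stepDeriv, stepDeriv, curvature_of_abs_le hh hα hα' hz, curvature_of_abs_le hh hα hα' hw, e1,
    norm_sub_rev (boundary 1 α h z.1), e3, stepMatrix_circle hc]
  exact ⟨rfl, rfl⟩

/-- The monodromy matrix in terms of the angles `π/2 - x`, `π/2 - x'`, `π/2 - y` at the right arc,
the smoothened part and the left arc, the lengths `τ`, `τ'` of the chords that end in the smoothened
part, and the curvature `k` there. -/
def monodromyMatrix (n : ℕ) (x x' y τ τ' k : ℝ) : Matrix (Fin 2) (Fin 2) ℝ :=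
  !![1, -2; 0, 1] ^ n * (stepMatrix k (Real.sin x') 1 (Real.sin x) τ *
    (stepMatrix 1 (Real.sin y) k (Real.sin x') τ' * (!![1, -2; 0, 1] ^ n * (!![1, -2; 0, 1] ^ n *
      (stepMatrix k (Real.sin x') 1 (Real.sin y) τ' *
        (stepMatrix 1 (Real.sin x) k (Real.sin x') τ * !![1, -2; 0, 1] ^ n))))))

/-- The period splits into n shears on the right arc, the two chords through the smoothened point,
2n shears on the left arc, the two mirrored chords in reverse order, and n shears on the right arc.
-/
lemma IsOrbit.prodMatrix_eq {n : ℕ} {ζ : ℝ} {z : ℕ → ℝ × ℝ} (ho : IsOrbit 1 α h n ζ z)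
    (hh : IsShape h) (hα : 0 < α) (hα' : α < Real.pi / 2) {x x' y : ℝ}
    (hx : (z 0).2 = Real.pi / 2 - x) (hx' : (z (n + 1)).2 = Real.pi / 2 - x')
    (hy : (z (2 * n + 2)).2 = Real.pi / 2 - y) :
    prodMatrix (fun i => stepDeriv α h (z i) (z (i + 1))) (4 * (n + 1)) =
      monodromyMatrix n x x' y ‖boundary 1 α h (z (n + 1)).1 - boundary 1 α h (z n).1‖
        ‖boundary 1 α h (z (n + 2)).1 - boundary 1 α h (z (n + 1)).1‖ (h ζ) := by
  set D := fun i => stepDeriv α h (z i) (z (i + 1)) with hD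
  have hζ : ζ ∈ Icc (0 : ℝ) 1 := ⟨ho.mem.1.le, ho.mem.2.le⟩
  have hr : ∀ i < n, D i = !![1, -2; 0, 1] ∧ stepDeriv α h (z (i + 1)) (z i) = !![1, -2; 0, 1] := by
    intro i hi
    obtain ⟨h1, h2⟩ := ho.fst_mem_arc_right hh hα hα' hi.le
    obtain ⟨h3, h4⟩ := ho.fst_mem_arc_right hh hα hα' (show i + 1 ≤ n from hi)
    exact stepDeriv_comm_of_circle hh hα hα' (ho.step i) (by rw [abs_of_nonneg h1]; exact h2.le)
      (by rw [abs_of_nonneg h3]; exact h4.le) (ho.fst_lt (Nat.lt_succ_self i))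
  have hl : ∀ i < n, stepDeriv α h (z (2 * n + 2 - (i + 1))) (z (2 * n + 2 - i)) =
      !![1, -2; 0, 1] ∧ stepDeriv α h (z (2 * n + 2 - i)) (z (2 * n + 2 - (i + 1))) =
      !![1, -2; 0, 1] := by
    intro i hi
    obtain ⟨h1, h2⟩ := ho.fst_mem_arc_left hh hα hα' hi.le
    obtain ⟨h3, h4⟩ := ho.fst_mem_arc_left hh hα hα' (show i + 1 ≤ n from hi)
    have hstep := (ho.step (2 * n + 2 - (i + 1))).half_sub hh hα hα'
    rw [show 2 * n + 2 - (i + 1) + 1 = 2 * n + 2 - i by omega] at hstep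
    have := stepDeriv_comm_of_circle hh hα hα' hstep (by rw [abs_of_nonneg h1]; exact h2.le)
      (by rw [abs_of_nonneg h3]; exact h4.le) (by
        have := ho.fst_lt (show 2 * n + 2 - (i + 1) < 2 * n + 2 - i by omega)
        simp only; linarith)
    rw [stepDeriv_half_sub hh hα hα', stepDeriv_half_sub hh hα hα'] at this
    exact this.symm
  -- The second half runs through the mirror images backwards, so its matrices are those of the
  -- first half with the two ends of the chord exchanged.
  have hmir : ∀ i ≤ 2 * n + 1, D (4 * (n + 1) - (i + 1)) = stepDeriv α h (z (i + 1)) (z i) := by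
    intro i hi
    simp only [hD]
    rw [show 4 * (n + 1) - (i + 1) + 1 = 4 * (n + 1) - i by omega,
      ho.mirror hh hα hα' (show i + 1 ≤ 2 * n + 2 by omega),
      ho.mirror hh hα hα' (show i ≤ 2 * n + 2 by omega), stepDeriv_perimeter_sub hh hα hα']
  have hkn : curvature 1 α h (z n).1 = 1 := by
    obtain ⟨h1, h2⟩ := ho.fst_mem_arc_right hh hα hα' (le_refl n)
    exact curvature_of_abs_le hh hα hα' (by rw [abs_of_nonneg h1]; exact h2.le)
  have hkn2 : curvature 1 α h (z (n + 2)).1 = 1 := by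
    have h1 := ho.circular (n + 2) (by omega) (by omega)
    exact curvature_of_midDist_le h1.le
  have hk : curvature 1 α h (z (n + 1)).1 = h ζ := by
    rw [ho.smooth]; exact curvature_smooth hh hα hα' hζ
  have hcn : Real.cos (z n).2 = Real.sin x := by
    rw [ho.right_eq hh hα hα' hx le_rfl, Real.cos_pi_div_two_sub]
  have hcn1 : Real.cos (z (n + 1)).2 = Real.sin x' := by rw [hx', Real.cos_pi_div_two_sub]
  have hcn2 : Real.cos (z (n + 2)).2 = Real.sin y := by
    have := congrArg Prod.snd (ho.left_eq hh hα hα' hy le_rfl)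
    rw [show 2 * n + 2 - n = n + 2 by omega] at this
    rw [this, Real.cos_pi_div_two_sub]
  set τ := ‖boundary 1 α h (z (n + 1)).1 - boundary 1 α h (z n).1‖ with hτ
  set τ' := ‖boundary 1 α h (z (n + 2)).1 - boundary 1 α h (z (n + 1)).1‖ with hτ'
  have d1 : D n = stepMatrix 1 (Real.sin x) (h ζ) (Real.sin x') τ := by
    simp only [hD, stepDeriv, hkn, hk, hcn, hcn1, hτ]
  have d2 : D (n + 1) = stepMatrix (h ζ) (Real.sin x') 1 (Real.sin y) τ' := by
    simp only [hD, stepDeriv, hkn2, hk, hcn2, hcn1, hτ', show n + 1 + 1 = n + 2 from rfl]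
  have d3 : D (2 * n + 2 + n) = stepMatrix 1 (Real.sin y) (h ζ) (Real.sin x') τ' := by
    have := hmir (n + 1) (by omega)
    rw [show 4 * (n + 1) - (n + 1 + 1) = 2 * n + 2 + n by omega] at this
    rw [this, stepDeriv, show n + 1 + 1 = n + 2 from rfl, hkn2, hk, hcn2, hcn1, hτ', norm_sub_rev]
  have d4 : D (2 * n + 2 + n + 1) = stepMatrix (h ζ) (Real.sin x') 1 (Real.sin x) τ := by
    have := hmir n (by omega)
    rw [show 4 * (n + 1) - (n + 1) = 2 * n + 2 + n + 1 by omega] at this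
    rw [this, stepDeriv, hkn, hk, hcn, hcn1, hτ, norm_sub_rev]
  have p1 : prodMatrix D n = !![1, -2; 0, 1] ^ n := by
    have := prodMatrix_add_of_eq (D := D) (p := 0) (j := n) (C := !![1, -2; 0, 1])
      fun i hi => by rw [zero_add]; exact (hr i hi).1
    rwa [zero_add, prodMatrix, mul_one] at this
  have p2 : prodMatrix D (2 * n + 2) = !![1, -2; 0, 1] ^ n * prodMatrix D (n + 2) := by
    rw [show 2 * n + 2 = n + 2 + n by omega]
    refine prodMatrix_add_of_eq fun i hi => ?_
    -- `hl` counts from the midpoint of the left copy, hence the reversed index.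
    have := (hl (n - 1 - i) (by omega)).1
    rwa [show 2 * n + 2 - (n - 1 - i + 1) = n + 2 + i by omega,
      show 2 * n + 2 - (n - 1 - i) = n + 2 + i + 1 by omega] at this
  have p3 : prodMatrix D (2 * n + 2 + n) = !![1, -2; 0, 1] ^ n * prodMatrix D (2 * n + 2) := by
    refine prodMatrix_add_of_eq fun i hi => ?_
    have := hmir (2 * n + 1 - i) (by omega)
    rw [show 4 * (n + 1) - (2 * n + 1 - i + 1) = 2 * n + 2 + i by omega] at this
    rw [this]
    have := (hl i hi).2
    rwa [show 2 * n + 2 - i = 2 * n + 1 - i + 1 by omega,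
      show 2 * n + 2 - (i + 1) = 2 * n + 1 - i by omega] at this
  have p4 : prodMatrix D (4 * (n + 1)) =
      !![1, -2; 0, 1] ^ n * prodMatrix D (2 * n + 2 + n + 2) := by
    rw [show 4 * (n + 1) = 2 * n + 2 + n + 2 + n by omega]
    refine prodMatrix_add_of_eq fun i hi => ?_
    have := hmir (n - 1 - i) (by omega)
    rw [show 4 * (n + 1) - (n - 1 - i + 1) = 2 * n + 2 + n + 2 + i by omega] at this
    rw [this]
    exact (hr _ (by omega)).2
  rw [p4, prodMatrix, prodMatrix, p3, p2, prodMatrix, prodMatrix, p1, d1, d2, d3, d4,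
    monodromyMatrix]

end orbits

/-! ### The limit angle and the equation for the mean chord angle -/

/-- The limit of the angles between the chords and the boundary. -/
def limitAngle (n : ℕ) : ℝ := Real.pi / (4 * (n + 1))

lemma limitAngle_pos (n : ℕ) : 0 < limitAngle n := by
  unfold limitAngle; have := Real.pi_pos; positivity

lemma mul_limitAngle (n : ℕ) : (2 * n + 1) * limitAngle n = Real.pi / 2 - limitAngle n := by
  unfold limitAngle; field_simp; ring

lemma limitAngle_le (n : ℕ) : (2 * n + 1) * limitAngle n ≤ Real.pi / 2 := by
  have := mul_limitAngle n
  have := limitAngle_pos n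
  linarith

lemma limitAngle_lt_pi_div_two (n : ℕ) : limitAngle n < Real.pi / 2 := by
  have h1 := mul_limitAngle n
  have h2 := limitAngle_pos n
  have : 0 < (2 * n + 1) * limitAngle n := by positivity
  linarith

lemma sin_limitAngle_pos (n : ℕ) : 0 < Real.sin (limitAngle n) :=
  Real.sin_pos_of_pos_of_lt_pi (limitAngle_pos n)
    (by linarith [limitAngle_lt_pi_div_two n, Real.pi_pos])

lemma cos_limitAngle_pos (n : ℕ) : 0 < Real.cos (limitAngle n) :=
  Real.cos_pos_of_mem_Ioo
    ⟨by linarith [limitAngle_pos n, Real.pi_pos], limitAngle_lt_pi_div_two n⟩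

lemma sin_mul_limitAngle (n : ℕ) :
    Real.sin ((2 * n + 1) * limitAngle n) = Real.cos (limitAngle n) := by
  rw [mul_limitAngle, Real.sin_pi_div_two_sub]

lemma cos_mul_limitAngle (n : ℕ) :
    Real.cos ((2 * n + 1) * limitAngle n) = Real.sin (limitAngle n) := by
  rw [mul_limitAngle, Real.cos_pi_div_two_sub]

/-- The left-hand side of the equation for the mean chord angle. -/
def chordFun (n : ℕ) (A D B x : ℝ) : ℝ :=
  A * Real.sin ((2 * n + 1) * x) - D * Real.cos ((2 * n + 1) * x) - B * Real.cos x

lemma chordFun_limitAngle (n : ℕ) : chordFun n 1 0 1 (limitAngle n) = 0 := by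
  rw [chordFun, sin_mul_limitAngle]; ring

lemma abs_mul_le_of_abs_le {a b c : ℝ} (ha : |a| ≤ c) (hb : |b| ≤ 1) : |a * b| ≤ c := by
  rw [abs_mul]
  calc |a| * |b| ≤ |a| * 1 := mul_le_mul_of_nonneg_left hb (abs_nonneg _)
    _ ≤ c := by rw [mul_one]; exact ha

/-- For A = B = 1, D = 0 the derivative m cos(mx) + sin x is positive on the compact interval, hence
bounded below by some c₀ > 0. A small perturbation of the coefficients keeps half of this bound. -/
lemma exists_slope_chordFun (n : ℕ) : ∃ c > (0 : ℝ), ∃ η > (0 : ℝ), ∀ A D B : ℝ,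
    |A - 1| ≤ η → |D| ≤ η → |B - 1| ≤ η → ∀ a ∈ Icc 0 (Real.pi / (2 * (2 * n + 1))),
      ∀ b ∈ Icc 0 (Real.pi / (2 * (2 * n + 1))), a ≤ b →
        c * (b - a) ≤ chordFun n A D B b - chordFun n A D B a := by
  set m : ℝ := 2 * n + 1 with hm
  have hm0 : 0 < m := by positivity
  have hmI : ∀ x ∈ Icc 0 (Real.pi / (2 * m)), m * x ≤ Real.pi / 2 := fun x hx => by
    have := hx.2
    rw [le_div_iff₀ (by positivity)] at this
    linarith
  have hle : Real.pi / (2 * m) < Real.pi := by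
    rw [div_lt_iff₀ (by positivity)]
    have : 1 ≤ m := by rw [hm]; linarith [Nat.cast_nonneg (α := ℝ) n]
    nlinarith [Real.pi_pos]
  obtain ⟨x₀, hx₀, hmin⟩ := (isCompact_Icc (a := 0) (b := Real.pi / (2 * m))).exists_isMinOn
    ⟨0, ⟨le_rfl, by positivity⟩⟩ (f := fun x => m * Real.cos (m * x) + Real.sin x) (by fun_prop)
  set c₀ := m * Real.cos (m * x₀) + Real.sin x₀ with hc₀
  have hc₀pos : 0 < c₀ := by
    rcases hx₀.1.eq_or_lt with h0 | h0
    · rw [hc₀, ← h0]; simp [hm0]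
    · have h1 : 0 ≤ Real.cos (m * x₀) := Real.cos_nonneg_of_mem_Icc
        ⟨by linarith [Real.pi_pos, mul_pos hm0 h0], hmI x₀ hx₀⟩
      have h2 := Real.sin_pos_of_pos_of_lt_pi h0 (hx₀.2.trans_lt hle)
      positivity
  -- A perturbation of each coefficient by at most η changes the derivative by at most (2m + 1)η,
  -- which is c₀/2.
  refine ⟨c₀ / 2, by positivity, c₀ / (2 * (2 * m + 1)), by positivity,
    fun A D B hA hD hB a ha b hb hab => ?_⟩
  set η := c₀ / (2 * (2 * m + 1)) with hη
  have hη' : (2 * m + 1) * η = c₀ / 2 := by rw [hη]; field_simp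
  have hderiv : ∀ x, HasDerivAt (chordFun n A D B)
      (A * (Real.cos (m * x) * m) - D * (-Real.sin (m * x) * m) - B * -Real.sin x) x := fun x => by
    have h1 : HasDerivAt (fun x => m * x) m x := by simpa using (hasDerivAt_id x).const_mul m
    exact ((h1.sin.const_mul A).sub (h1.cos.const_mul D)).sub ((Real.hasDerivAt_cos x).const_mul B)
  refine (convex_Icc 0 (Real.pi / (2 * m))).mul_sub_le_image_sub_of_le_deriv
    (fun x _ => (hderiv x).continuousAt.continuousWithinAt)
    (fun x _ => (hderiv x).differentiableAt.differentiableWithinAt) (fun x hx => ?_) a ha b hb hab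
  rw [(hderiv x).deriv]
  have h0 : c₀ ≤ m * Real.cos (m * x) + Real.sin x := hmin (interior_subset hx)
  have h1 := (abs_le.1 (abs_mul_le_of_abs_le hA (Real.abs_cos_le_one (m * x)))).1
  have h2 := (abs_le.1 (abs_mul_le_of_abs_le hD (Real.abs_sin_le_one (m * x)))).1
  have h3 := (abs_le.1 (abs_mul_le_of_abs_le hB (Real.abs_sin_le_one x))).1
  nlinarith

/-- The line equation is a perturbation of `chordFun n 1 0 1 x = 0`, which vanishes at the limit
angle and has slope bounded below. -/
lemma exists_abs_sub_limitAngle_le (n : ℕ) : ∃ C > (0 : ℝ), ∀ u v x : ℝ,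
    x ∈ Icc 0 (Real.pi / (2 * (2 * n + 1))) →
    u * Real.cos ((2 * n + 1) * x) + v * Real.sin ((2 * n + 1) * x) = Real.cos x →
    |x - limitAngle n| ≤ C * (|u| + |v - 1|) := by
  obtain ⟨c, hc, η, hη, hs⟩ := exists_slope_chordFun n
  refine ⟨c⁻¹, inv_pos.2 hc, fun u v x hx e => ?_⟩
  have hs' := hs 1 0 1 (by simp [hη.le]) (by simp [hη.le]) (by simp [hη.le])
  have hl : limitAngle n ∈ Icc 0 (Real.pi / (2 * (2 * n + 1))) := by
    refine ⟨(limitAngle_pos n).le, ?_⟩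
    rw [le_div_iff₀ (by positivity)]
    linarith [limitAngle_le n]
  have h0 : |chordFun n 1 0 1 x| ≤ |u| + |v - 1| := by
    have : chordFun n 1 0 1 x =
        -(u * Real.cos ((2 * n + 1) * x)) - (v - 1) * Real.sin ((2 * n + 1) * x) := by
      rw [chordFun, ← e]; ring
    rw [this]
    refine (abs_sub _ _).trans (add_le_add ?_ ?_)
    · rw [abs_neg]; exact abs_mul_le_of_abs_le le_rfl (Real.abs_cos_le_one _)
    · exact abs_mul_le_of_abs_le le_rfl (Real.abs_sin_le_one _)
  rw [← div_eq_inv_mul, le_div_iff₀ hc]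
  have h1 := abs_le.1 h0
  rcases le_total x (limitAngle n) with hle | hle
  · have := hs' x hx _ hl hle
    rw [chordFun_limitAngle] at this
    rw [abs_of_nonpos (by linarith)]
    linarith
  · have := hs' _ hl x hx hle
    rw [chordFun_limitAngle] at this
    rw [abs_of_nonneg (by linarith)]
    linarith

/-! ### The limit of the trace -/

lemma shear_pow (n : ℕ) : (!![1, -2; 0, 1] : Matrix (Fin 2) (Fin 2) ℝ) ^ n =
    !![1, -2 * (n : ℝ); 0, 1] := by
  induction n with
  | zero => simp [Matrix.one_fin_two]
  | succ n ih =>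
    rw [pow_succ, ih, Matrix.mul_fin_two]
    congr 1
    funext i j
    fin_cases i <;> fin_cases j <;> simp
    ring

/-- With x = x' = y and equal chord lengths the two half turns have the same matrix H, of
determinant 1 and ½ tr H = 1 - 4(n+1)(1-k). The formula is tr H² = (tr H)² - 2. -/
lemma trace_monodromyMatrix_limit (n : ℕ) (k : ℝ) {x : ℝ} (hx : Real.sin x ≠ 0) :
    (monodromyMatrix n x x x (2 * Real.sin x) (2 * Real.sin x) k).trace =
      2 * (2 * (1 - 4 * (n + 1) * (1 - k)) ^ 2 - 1) := by
  have e1 : stepMatrix 1 (Real.sin x) k (Real.sin x) (2 * Real.sin x) =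
      !![1, -2; 1 - k, 2 * k - 1] := by
    unfold stepMatrix
    congr 1
    funext i j
    fin_cases i <;> fin_cases j <;> simp <;> field_simp <;> ring
  have e2 : stepMatrix k (Real.sin x) 1 (Real.sin x) (2 * Real.sin x) =
      !![2 * k - 1, -2; 1 - k, 1] := by
    unfold stepMatrix
    congr 1
    funext i j
    fin_cases i <;> fin_cases j <;> simp <;> field_simp <;> ring
  rw [monodromyMatrix, e1, e2, shear_pow]
  simp only [Matrix.mul_fin_two, Matrix.trace_fin_two_of]
  ring

lemma exists_abs_trace_lt (n : ℕ) {k : ℝ} (h1 : ((n : ℝ) + 1 / 2) / ((n : ℝ) + 1) < k) (h2 : k < 1)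
    (h3 : k ≠ ((n : ℝ) + 3 / 4) / ((n : ℝ) + 1)) :
    ∃ ε > (0 : ℝ), ∀ x x' y τ τ' k' : ℝ, |x - limitAngle n| < ε → |x' - limitAngle n| < ε →
      |y - limitAngle n| < ε → |τ - 2 * Real.sin (limitAngle n)| < ε →
      |τ' - 2 * Real.sin (limitAngle n)| < ε → |k' - k| < ε →
      |1 / 2 * (monodromyMatrix n x x' y τ τ' k').trace| < 1 := by
  set l := limitAngle n with hl
  have hs : Real.sin l ≠ 0 := (sin_limitAngle_pos n).ne'
  set G : ℝ × ℝ × ℝ × ℝ × ℝ × ℝ → ℝ := fun p => |1 / 2 *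
    (monodromyMatrix n p.1 p.2.1 p.2.2.1 p.2.2.2.1 p.2.2.2.2.1 p.2.2.2.2.2).trace| with hG
  set P : ℝ × ℝ × ℝ × ℝ × ℝ × ℝ := (l, l, l, 2 * Real.sin l, 2 * Real.sin l, k) with hP
  have hn : (0 : ℝ) < n + 1 := by positivity
  have hGP : G P < 1 := by
    simp only [hG, hP]
    rw [trace_monodromyMatrix_limit n k hs, abs_lt]
    rw [div_lt_iff₀ hn] at h1
    rw [ne_eq, eq_div_iff hn.ne'] at h3
    -- The excluded value of k is the one where ½ tr H = 0 and ½ tr H² = -1; the bounds on k say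
    -- that |½ tr H| < 1.
    have h4 : (1 - 4 * (n + 1) * (1 - k)) ≠ 0 := fun h => h3 (by linarith)
    have h5 : 0 < (1 - 4 * (n + 1) * (1 - k)) ^ 2 := by positivity
    have h6 : (1 - 4 * (n + 1) * (1 - k)) ^ 2 < 1 := by
      rw [sq_lt_one_iff_abs_lt_one, abs_lt]
      constructor <;> nlinarith
    constructor <;> linarith
  have hstep : ∀ f1 f2 f3 f4 f5 : ℝ × ℝ × ℝ × ℝ × ℝ × ℝ → ℝ, ContinuousAt f1 P →
      ContinuousAt f2 P → ContinuousAt f3 P → ContinuousAt f4 P → ContinuousAt f5 P → f4 P ≠ 0 →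
      ContinuousAt (fun p => stepMatrix (f1 p) (f2 p) (f3 p) (f4 p) (f5 p)) P := by
    intro f1 f2 f3 f4 f5 c1 c2 c3 c4 c5 h0
    have a1 : ContinuousAt (fun p => (f5 p * f1 p - f2 p) / f4 p) P :=
      ((c5.mul c1).sub c2).div c4 h0
    have a2 : ContinuousAt (fun p => -f5 p / f4 p) P := c5.neg.div c4 h0
    have a3 : ContinuousAt (fun p => f5 p / f4 p) P := c5.div c4 h0
    refine continuousAt_pi.2 fun i => continuousAt_pi.2 fun j => ?_
    fin_cases i <;> fin_cases j
    · exact a1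
    · exact a2
    · exact c1.sub (c3.mul a1)
    · exact continuousAt_const.add (c3.mul a3)
  have hGc : ContinuousAt G P := by
    have q1 : ContinuousAt (fun p : ℝ × ℝ × ℝ × ℝ × ℝ × ℝ => Real.sin p.1) P := by fun_prop
    have q2 : ContinuousAt (fun p : ℝ × ℝ × ℝ × ℝ × ℝ × ℝ => Real.sin p.2.1) P := by fun_prop
    have q3 : ContinuousAt (fun p : ℝ × ℝ × ℝ × ℝ × ℝ × ℝ => Real.sin p.2.2.1) P := by fun_prop
    have q4 : ContinuousAt (fun p : ℝ × ℝ × ℝ × ℝ × ℝ × ℝ => p.2.2.2.1) P := by fun_prop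
    have q5 : ContinuousAt (fun p : ℝ × ℝ × ℝ × ℝ × ℝ × ℝ => p.2.2.2.2.1) P := by fun_prop
    have q6 : ContinuousAt (fun p : ℝ × ℝ × ℝ × ℝ × ℝ × ℝ => p.2.2.2.2.2) P := by fun_prop
    have q0 : ContinuousAt (fun _ : ℝ × ℝ × ℝ × ℝ × ℝ × ℝ => (1 : ℝ)) P := continuousAt_const
    have qC : ContinuousAt (fun _ : ℝ × ℝ × ℝ × ℝ × ℝ × ℝ =>
      (!![1, -2; 0, 1] : Matrix (Fin 2) (Fin 2) ℝ) ^ n) P := continuousAt_const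
    have r := qC.mul ((hstep _ _ _ _ _ q6 q2 q0 q1 q4 hs).mul ((hstep _ _ _ _ _ q0 q3 q6 q2 q5
      hs).mul (qC.mul (qC.mul ((hstep _ _ _ _ _ q6 q2 q0 q3 q5 hs).mul
        ((hstep _ _ _ _ _ q0 q1 q6 q2 q4 hs).mul qC))))))
    have ht : Continuous (fun A : Matrix (Fin 2) (Fin 2) ℝ => |1 / 2 * A.trace|) := by fun_prop
    exact ht.continuousAt.comp r
  obtain ⟨ε, hε, hball⟩ := Metric.eventually_nhds_iff.1
    (hGc.eventually_lt continuousAt_const hGP)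
  refine ⟨ε, hε, fun x x' y τ τ' k' b1 b2 b3 b4 b5 b6 => ?_⟩
  refine hball (y := (x, x', y, τ, τ', k')) ?_
  simp only [hP, Prod.dist_eq, Real.dist_eq, max_lt_iff]
  exact ⟨b1, b2, b3, b4, b5, b6⟩

/-! ### Estimates for small α and linear stability -/

section bounds
variable {α : ℝ} {h : ℝ → ℝ}

lemma smoothLength_eq : smoothLength 1 α h = (∫ ξ in (0 : ℝ)..1, h ξ)⁻¹ * α := by
  rw [smoothLength, one_mul, div_eq_inv_mul]

lemma abs_halfWidth_sub_one_le (hh : IsShape h) (hα : 0 < α) (hα' : α < Real.pi / 2) :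
    |halfWidth 1 α h - 1| ≤ ((∫ ξ in (0 : ℝ)..1, h ξ)⁻¹ + 1) * α := by
  have hm := halfWidth_sub_one_mem hh hα hα'
  have hS := smoothLength_pos hh hα
  have hc : 0 ≤ Real.cos α := Real.cos_nonneg_of_mem_Icc ⟨by linarith, hα'.le⟩
  have hs := Real.sin_lt hα
  have hs' : 0 ≤ Real.sin α :=
    Real.sin_nonneg_of_nonneg_of_le_pi hα.le (by linarith [Real.pi_pos])
  have : 0 ≤ smoothLength 1 α h * Real.cos α := by positivity
  rw [add_mul, ← smoothLength_eq, abs_le]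
  exact ⟨by linarith [hm.1], by linarith [hm.2]⟩

lemma abs_boundary_im_sub_one_le (hh : IsShape h) (hα : 0 < α) (hα' : α < Real.pi / 2) {ζ : ℝ}
    (hζ : ζ ∈ Icc (0 : ℝ) 1) :
    |(boundary 1 α h (smoothPoint α h ζ)).im - 1| ≤
      ((∫ ξ in (0 : ℝ)..1, h ξ)⁻¹ + 1) * α ^ 2 := by
  have hm := boundary_im_smoothPoint_mem hh hα hα' hζ
  have hS := smoothLength_pos hh hα
  have hc := Real.one_sub_sq_div_two_le_cos (x := α)
  have hs : smoothLength 1 α h * Real.sin α ≤ smoothLength 1 α h * α :=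
    mul_le_mul_of_nonneg_left (Real.sin_lt hα).le hS.le
  have : ((∫ ξ in (0 : ℝ)..1, h ξ)⁻¹ + 1) * α ^ 2 = smoothLength 1 α h * α + α ^ 2 := by
    rw [smoothLength_eq]; ring
  have h2 := Real.cos_le_one α
  have h3 : 0 < smoothLength 1 α h * α := by positivity
  rw [this, abs_le]
  exact ⟨by linarith [hm.1, sq_nonneg α], by linarith [hm.2, sq_nonneg α]⟩

lemma boundary_re_smoothPoint_nonneg (hh : IsShape h) (hα : 0 < α) (hα' : α < Real.pi / 2) {ζ : ℝ}
    (hζ : ζ ∈ Icc (0 : ℝ) 1) : 0 ≤ (boundary 1 α h (smoothPoint α h ζ)).re := by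
  have hm := boundary_re_smoothPoint_mem hh hα hα' hζ
  have hS := smoothLength_pos hh hα
  have hc : 0 ≤ Real.cos α := Real.cos_nonneg_of_mem_Icc ⟨by linarith, hα'.le⟩
  have : 0 ≤ 1 - ζ := by linarith [hζ.2]
  exact le_trans (by positivity) hm.1

lemma boundary_re_smoothPoint_le (hh : IsShape h) (hα : 0 < α) (hα' : α < Real.pi / 2) {ζ : ℝ}
    (hζ : ζ ∈ Icc (0 : ℝ) 1) :
    (boundary 1 α h (smoothPoint α h ζ)).re ≤ (∫ ξ in (0 : ℝ)..1, h ξ)⁻¹ * α := by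
  have hm := boundary_re_smoothPoint_mem hh hα hα' hζ
  have hS := smoothLength_pos hh hα
  rw [← smoothLength_eq]
  nlinarith [hm.2, hζ.1]

end bounds

/-- Every orbit close to a nondegenerate one is linearly stable. -/
lemma exists_linearlyStable (n : ℕ) {h : ℝ → ℝ} (hh : IsShape h) {ζs : ℝ}
    (hζs : ζs ∈ Ioo (0 : ℝ) 1) (h1 : ((n : ℝ) + 1 / 2) / ((n : ℝ) + 1) < h ζs) (h2 : h ζs < 1)
    (h3 : h ζs ≠ ((n : ℝ) + 3 / 4) / ((n : ℝ) + 1)) :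
    ∃ ε > (0 : ℝ), ∃ α₀ > (0 : ℝ), ∀ α ∈ Ioo 0 α₀, ∀ (ζ : ℝ) (z : ℕ → ℝ × ℝ),
      IsOrbit 1 α h n ζ z → |ζ - ζs| < ε → LinearlyStable 1 α h (4 * (n + 1)) z := by
  obtain ⟨ε, hε, htr⟩ := exists_abs_trace_lt n h1 h2 h3
  obtain ⟨C, hC, hx⟩ := exists_abs_sub_limitAngle_le n
  have hcont : ContinuousAt h ζs := hh.cont.continuousAt (Icc_mem_nhds hζs.1 hζs.2)
  obtain ⟨δ, hδ, hhζ⟩ := Metric.continuousAt_iff.1 hcont ε hε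
  set K := (∫ ξ in (0 : ℝ)..1, h ξ)⁻¹ with hK
  have hK0 : 0 < K := inv_pos.2 hh.integral_pos
  set m : ℝ := 2 * n + 1 with hm
  have hm1 : 1 ≤ m := by rw [hm]; linarith [Nat.cast_nonneg (α := ℝ) n]
  set B := 3 * K + 2 with hB
  have hB0 : 0 < B := by positivity
  set E := 4 + B + 2 * (m + 1) * (C * B + 2) with hE
  have hE0 : 0 < E := by positivity
  refine ⟨δ, hδ, min 1 (ε / E), by positivity, fun α hα ζ z ho hζ => ?_⟩
  have hα0 := hα.1
  have hα1 : α < 1 := hα.2.trans_le (min_le_left _ _)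
  have hαE : E * α < ε := by
    have := hα.2.trans_le (min_le_right _ _)
    rw [lt_div_iff₀ hE0] at this
    linarith
  have hα' : α < Real.pi / 2 := by linarith [Real.pi_gt_three]
  have hζm : ζ ∈ Icc (0 : ℝ) 1 := ⟨ho.mem.1.le, ho.mem.2.le⟩
  refine ⟨_, isMonodromy_of_step hh hα0 hα' ho.step _, ?_⟩
  obtain ⟨x, ex⟩ : ∃ x, (z 0).2 = Real.pi / 2 - x := ⟨Real.pi / 2 - (z 0).2, by ring⟩
  obtain ⟨x', ex'⟩ : ∃ x, (z (n + 1)).2 = Real.pi / 2 - x :=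
    ⟨Real.pi / 2 - (z (n + 1)).2, by ring⟩
  obtain ⟨y, ey⟩ : ∃ x, (z (2 * n + 2)).2 = Real.pi / 2 - x :=
    ⟨Real.pi / 2 - (z (2 * n + 2)).2, by ring⟩
  rw [trace_toCLM, ho.prodMatrix_eq hh hα0 hα' ex ex' ey]
  obtain ⟨r1, r2, r3⟩ := ho.right_chord hh hα0 hα' ex ex'
  -- The left line equation is not needed: y is controlled through the reflection law and x.
  obtain ⟨-, l2, l3⟩ := ho.left_chord hh hα0 hα' ey ex'
  have bw := abs_halfWidth_sub_one_le hh hα0 hα'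
  have bi := abs_boundary_im_sub_one_le hh hα0 hα' hζm
  have b0 := boundary_re_smoothPoint_nonneg hh hα0 hα' hζm
  have b1 := boundary_re_smoothPoint_le hh hα0 hα' hζm
  have ht0 := turn_nonneg hh hα0 hζm
  have ht1 := turn_le hh hα0 hζm
  rw [← hm] at r1 r2 r3 l2 l3
  rw [← hK] at bw bi b1
  set X := (boundary 1 α h (smoothPoint α h ζ)).re
  set Y := (boundary 1 α h (smoothPoint α h ζ)).im
  set w := halfWidth 1 α h - 1
  have bw' := abs_le.1 bw
  have hu : |X - w| ≤ (2 * K + 1) * α := by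
    rw [abs_le]; constructor <;> linarith
  have hu' : |-X - w| ≤ (2 * K + 1) * α := by
    rw [abs_le]; constructor <;> linarith
  have hv : |Y - 1| ≤ (K + 1) * α := bi.trans <|
    mul_le_mul_of_nonneg_left (by nlinarith) (by positivity)
  have hxpos : 0 < x := by
    have := (abs_lt.1 (ho.step 0).1).2; linarith
  have hx'pos : 0 < x' := by
    have := (abs_lt.1 (ho.step (n + 1)).1).2; linarith
  have dx : |x - limitAngle n| ≤ C * B * α := by
    refine (hx _ _ x ⟨hxpos.le, ?_⟩ r1).trans ?_
    -- The angle x' at the smoothened part is positive, which forces mx < π/2.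
    · rw [le_div_iff₀ (by positivity)]; linarith
    · rw [mul_assoc]
      refine mul_le_mul_of_nonneg_left ?_ hC.le
      rw [hB]; linarith
  have hml : m * limitAngle n = Real.pi / 2 - limitAngle n := mul_limitAngle n
  have dmx : |m * x - m * limitAngle n| ≤ m * (C * B) * α := by
    rw [← mul_sub, abs_mul, abs_of_pos (show 0 < m by linarith), mul_assoc]
    exact mul_le_mul_of_nonneg_left dx (by linarith)
  have dx' : |x' - limitAngle n| ≤ α + m * (C * B) * α := by
    have := abs_le.1 dmx
    rw [abs_le]; constructor <;> linarith
  have hyx : m * y = m * x + 2 * turn α h ζ := by linarith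
  have dmy : |m * y - m * limitAngle n| ≤ m * (C * B) * α + 2 * α := by
    have := abs_le.1 dmx
    rw [abs_le]; constructor <;> linarith
  have dy : |y - limitAngle n| ≤ m * (C * B) * α + 2 * α := by
    refine le_trans ?_ dmy
    rw [← mul_sub, abs_mul, abs_of_pos (show 0 < m by linarith)]
    exact le_mul_of_one_le_left (abs_nonneg _) hm1
  have hτ : ∀ u t d : ℝ, |u| ≤ (2 * K + 1) * α → |t - limitAngle n| ≤ d →
      |m * t - m * limitAngle n| ≤ m * (C * B) * α + 2 * α →
      |Y * Real.cos (m * t) - u * Real.sin (m * t) + Real.sin t - 2 * Real.sin (limitAngle n)| ≤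
        B * α + (m * (C * B) * α + 2 * α) + d := by
    intro u t d hu ht hmt
    have a1 := abs_mul_le_of_abs_le hv (Real.abs_cos_le_one (m * t))
    have a2 := abs_mul_le_of_abs_le hu (Real.abs_sin_le_one (m * t))
    have a3 : |Real.cos (m * t) - Real.sin (limitAngle n)| ≤ m * (C * B) * α + 2 * α := by
      rw [← cos_mul_limitAngle]
      exact (Real.abs_cos_sub_cos_le _ _).trans hmt
    have a4 : |Real.sin t - Real.sin (limitAngle n)| ≤ d := (Real.abs_sin_sub_sin_le _ _).trans ht
    have a5 : Y * Real.cos (m * t) - u * Real.sin (m * t) + Real.sin t -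
        2 * Real.sin (limitAngle n) = (Y - 1) * Real.cos (m * t) - u * Real.sin (m * t) +
        (Real.cos (m * t) - Real.sin (limitAngle n)) + (Real.sin t - Real.sin (limitAngle n)) := by
      ring
    have a6 : B * α = (K + 1) * α + (2 * K + 1) * α := by rw [hB]; ring
    rw [a5, a6]
    rw [abs_le] at a1 a2 a3 a4 ⊢
    constructor <;> linarith
  have hCB : 0 ≤ C * B * α := by positivity
  have hmCB : 0 ≤ m * (C * B) * α := by positivity
  have hEα : E * α = 4 * α + B * α + 2 * (m * (C * B) * α) + 2 * (C * B * α) +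
      4 * (m + 1) * α := by
    rw [hE]; ring
  have hmα : 0 ≤ (m - 1) * α := mul_nonneg (by linarith) hα0.le
  have hBα : 0 ≤ B * α := by positivity
  have hτ1 := hτ _ x _ hu dx (dmx.trans (by linarith))
  have hτ2 := hτ _ y _ hu' dy dmy
  refine htr _ _ _ _ _ _ ?_ ?_ ?_ ?_ ?_ ?_
  · linarith
  · linarith
  · linarith
  · rw [r2]; linarith
  · rw [l2]; linarith
  · have := hhζ (x := ζ) (by rwa [Real.dist_eq])
    rwa [Real.dist_eq] at this

/-! ### Reduction to one equation in ζ -/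

/-- If f_t(l') has a sign, it keeps it for nearby t, and monotonicity then puts the zero on the
right side of l'. Separate continuity is enough. -/
lemma exists_continuousOn_zero {a b : ℝ} (hab : a ≤ b) {s : Set ℝ} {f : ℝ → ℝ → ℝ}
    (hc : ∀ x ∈ Icc a b, ContinuousOn (fun t => f t x) s)
    (hcx : ∀ t ∈ s, ContinuousOn (f t) (Icc a b))
    (hmono : ∀ t ∈ s, StrictMonoOn (f t) (Icc a b)) (ha : ∀ t ∈ s, f t a < 0)
    (hb : ∀ t ∈ s, 0 < f t b) :
    ∃ M : ℝ → ℝ, ContinuousOn M s ∧ ∀ t ∈ s, M t ∈ Ioo a b ∧ f t (M t) = 0 := by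
  have hex : ∀ t, ∃ x, t ∈ s → x ∈ Ioo a b ∧ f t x = 0 := fun t => by
    by_cases ht : t ∈ s
    · obtain ⟨x, hx, hx0⟩ := intermediate_value_Ioo hab (hcx t ht) ⟨ha t ht, hb t ht⟩
      exact ⟨x, fun _ => ⟨hx, hx0⟩⟩
    · exact ⟨0, fun h => absurd h ht⟩
  choose M hM using hex
  refine ⟨M, fun t ht => ?_, fun t ht => hM t ht⟩
  obtain ⟨hMt, hMt0⟩ := hM t ht
  have hmem := Ioo_subset_Icc_self hMt
  refine tendsto_order.2 ⟨fun l hl => ?_, fun l hl => ?_⟩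
  · obtain ⟨l', h1, h2⟩ := exists_between (max_lt hl hMt.1)
    have hl' : l' ∈ Icc a b := ⟨(le_max_right _ _).trans h1.le, h2.le.trans hMt.2.le⟩
    have hneg : f t l' < 0 := hMt0 ▸ hmono t ht hl' hmem h2
    filter_upwards [(hc l' hl' t ht).eventually_lt continuousWithinAt_const hneg,
      self_mem_nhdsWithin] with u hu hus
    by_contra! hle
    obtain ⟨hMu, hMu0⟩ := hM u hus
    have := (hmono u hus).monotoneOn (Ioo_subset_Icc_self hMu) hl'
      (hle.trans ((le_max_left _ _).trans h1.le))
    linarith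
  · obtain ⟨l', h1, h2⟩ := exists_between (lt_min hl hMt.2)
    have hl' : l' ∈ Icc a b := ⟨hMt.1.le.trans h1.le, h2.le.trans (min_le_right _ _)⟩
    have hpos : 0 < f t l' := hMt0 ▸ hmono t ht hmem hl' h1
    filter_upwards [continuousWithinAt_const.eventually_lt (hc l' hl' t ht) hpos,
      self_mem_nhdsWithin] with u hu hus
    by_contra! hle
    obtain ⟨hMu, hMu0⟩ := hM u hus
    have := (hmono u hus).monotoneOn hl' (Ioo_subset_Icc_self hMu)
      ((h2.le.trans (min_le_left _ _)).trans hle)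
    linarith

/-- For parameters close to `1, 0, 1` the function `chordFun` is strictly increasing with opposite
signs at the ends of `[0, π/(2(2n+1))]`, and its zero is close to the limit angle. -/
lemma exists_chordFun_bounds (n : ℕ) : ∃ C > (0 : ℝ), ∃ η > (0 : ℝ), ∀ A D B : ℝ,
    |A - 1| ≤ η → |D| ≤ η → |B - 1| ≤ η →
      StrictMonoOn (chordFun n A D B) (Icc 0 (Real.pi / (2 * (2 * n + 1)))) ∧
      chordFun n A D B 0 < 0 ∧ 0 < chordFun n A D B (Real.pi / (2 * (2 * n + 1))) ∧
      ∀ x ∈ Icc 0 (Real.pi / (2 * (2 * n + 1))), chordFun n A D B x = 0 →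
        |x - limitAngle n| ≤ C * (|A - 1| + |D| + |B - 1|) := by
  obtain ⟨c, hc, η, hη, hs⟩ := exists_slope_chordFun n
  set m : ℝ := 2 * n + 1 with hm
  have hm1 : 1 ≤ m := by rw [hm]; linarith [Nat.cast_nonneg (α := ℝ) n]
  set b := Real.pi / (2 * m) with hb
  have hb0 : 0 < b := by have := Real.pi_pos; positivity
  have hmb : m * b = Real.pi / 2 := by rw [hb]; field_simp
  have hbπ : b ≤ Real.pi / 2 := by rw [← hmb]; exact le_mul_of_one_le_left hb0.le hm1
  have hcb : Real.cos b < 1 := by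
    rw [← Real.cos_zero]
    exact Real.cos_lt_cos_of_nonneg_of_le_pi_div_two le_rfl hbπ hb0
  have hcb0 : 0 ≤ Real.cos b := Real.cos_nonneg_of_mem_Icc ⟨by linarith, hbπ⟩
  have hl : limitAngle n ∈ Icc 0 b := by
    refine ⟨(limitAngle_pos n).le, ?_⟩
    rw [hb, le_div_iff₀ (by positivity)]
    linarith [limitAngle_le n]
  -- The bound 1/4 makes the value -D - B at 0 negative. At the right end b = π/(2m) the value is A
  -- - B cos b, and (1 - cos b)/4 keeps it positive.
  refine ⟨c⁻¹, inv_pos.2 hc, min η (min (1 / 4) ((1 - Real.cos b) / 4)),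
    by have : 0 < 1 - Real.cos b := by linarith
       positivity, fun A D B hA hD hB => ?_⟩
  have m1 := min_le_left η (min (1 / 4) ((1 - Real.cos b) / 4))
  have m2 := (min_le_right η (min (1 / 4) ((1 - Real.cos b) / 4))).trans (min_le_left _ _)
  have m3 := (min_le_right η (min (1 / 4) ((1 - Real.cos b) / 4))).trans (min_le_right _ _)
  have hslope := hs A D B (hA.trans m1) (hD.trans m1) (hB.trans m1)
  have hA' := abs_le.1 (hA.trans m3)
  have hB' := abs_le.1 (hB.trans m3)
  have hD2 := abs_le.1 (hD.trans m2)
  have hB2 := abs_le.1 (hB.trans m2)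
  refine ⟨fun x hx y hy hxy => ?_, ?_, ?_, fun x hx hx0 => ?_⟩
  · have := hslope x hx y hy hxy.le
    have : 0 < c * (y - x) := mul_pos hc (by linarith)
    linarith
  · simp only [chordFun, mul_zero, Real.sin_zero, Real.cos_zero]
    linarith
  · rw [chordFun, ← hm, hmb, Real.sin_pi_div_two, Real.cos_pi_div_two]
    nlinarith
  · have h0 : |chordFun n A D B (limitAngle n)| ≤ |A - 1| + |D| + |B - 1| := by
      have : chordFun n A D B (limitAngle n) =
          (A - 1) * Real.cos (limitAngle n) - D * Real.sin (limitAngle n) -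
            (B - 1) * Real.cos (limitAngle n) := by
        rw [chordFun, sin_mul_limitAngle, cos_mul_limitAngle]; ring
      rw [this]
      refine (abs_sub _ _).trans (add_le_add ((abs_sub _ _).trans (add_le_add ?_ ?_)) ?_)
      · exact abs_mul_le_of_abs_le le_rfl (Real.abs_cos_le_one _)
      · exact abs_mul_le_of_abs_le le_rfl (Real.abs_sin_le_one _)
      · exact abs_mul_le_of_abs_le le_rfl (Real.abs_cos_le_one _)
    rw [← div_eq_inv_mul, le_div_iff₀ hc]
    have h1 := abs_le.1 h0
    rcases le_total x (limitAngle n) with hle | hle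
    · have := hslope x hx _ hl hle
      rw [abs_of_nonpos (by linarith)]
      linarith
    · have := hslope _ hl x hx hle
      rw [abs_of_nonneg (by linarith)]
      linarith

/-- The vanishing of this function is the reflection law at the smoothened part, whose normal has
the angle `χ` to the vertical; `X`, `Y` are the coordinates of the point, `w` is the distance of the
center of the circular arc to the vertical axis, and `M` is the mean of the chord angles. -/
def angleDefect (n : ℕ) (X Y w χ M : ℝ) : ℝ :=
  Real.cos ((2 * n + 1) * M) * (X * Real.cos χ - Y * Real.sin χ) -
    w * Real.sin ((2 * n + 1) * M) * Real.sin χ - Real.sin M * Real.sin (χ / (2 * n + 1))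

/-- With x = M - χ/m and y = M + χ/m, the addition theorems turn the two line equations into
`chordFun` plus, respectively minus, `angleDefect`. -/
lemma chord_equations {n : ℕ} {X Y w χ M : ℝ}
    (h1 : chordFun n (Y * Real.cos χ + X * Real.sin χ) (w * Real.cos χ)
      (Real.cos (χ / (2 * n + 1))) M = 0) (h2 : angleDefect n X Y w χ M = 0) :
    (X - w) * Real.cos ((2 * n + 1) * (M - χ / (2 * n + 1))) +
        Y * Real.sin ((2 * n + 1) * (M - χ / (2 * n + 1))) = Real.cos (M - χ / (2 * n + 1)) ∧
      (-X - w) * Real.cos ((2 * n + 1) * (M + χ / (2 * n + 1))) +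
        Y * Real.sin ((2 * n + 1) * (M + χ / (2 * n + 1))) = Real.cos (M + χ / (2 * n + 1)) := by
  have hm : (2 * n + 1 : ℝ) ≠ 0 := by positivity
  rw [mul_sub, mul_add, mul_div_cancel₀ _ hm]
  rw [chordFun] at h1
  rw [angleDefect] at h2
  simp only [Real.cos_sub, Real.cos_add, Real.sin_sub, Real.sin_add] at *
  constructor
  · linear_combination h1 + h2
  · linear_combination h1 - h2

lemma abs_sin_sub_self_le {t : ℝ} (h0 : 0 ≤ t) (h1 : t ≤ 1) : |Real.sin t - t| ≤ t ^ 2 := by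
  have h2 := Real.sin_le h0
  rw [abs_of_nonpos (by linarith)]
  rcases h0.eq_or_lt with rfl | h0
  · simp
  have := Real.sin_gt_sub_cube h0
  nlinarith [pow_pos h0 2]

lemma abs_cos_sub_one_le (t : ℝ) : |Real.cos t - 1| ≤ t ^ 2 := by
  have h1 := Real.one_sub_sq_div_two_le_cos (x := t)
  have h2 := Real.cos_le_one t
  rw [abs_of_nonpos (by linarith)]
  linarith [sq_nonneg t]

/-- First-order expansion of `angleDefect`. -/
lemma abs_angleDefect_sub_le {n : ℕ} {X Y w χ M α K L C : ℝ} (hα : 0 < α) (hα1 : α ≤ 1)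
    (hK : 0 < K) (hC : 0 < C) (hL : L ∈ Icc 0 (K * α)) (hX : X ∈ Icc (L * Real.cos α) L)
    (hY : |Y - 1| ≤ (K + 1) * α ^ 2) (hw : |w| ≤ (K + 1) * α) (hχ : χ ∈ Icc 0 α)
    (hM : |M - limitAngle n| ≤ C * α) :
    |angleDefect n X Y w χ M - Real.sin (limitAngle n) * (L - χ - χ / (2 * n + 1))| ≤
      ((2 * n + 1) * C * (K + 1) + (3 * K + 2) + (K + 1) + (C + 1)) * α ^ 2 := by
  set m : ℝ := 2 * n + 1 with hm
  have hm1 : 1 ≤ m := by rw [hm]; linarith [Nat.cast_nonneg (α := ℝ) n]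
  have hm0 : 0 < m := by linarith
  set s := Real.sin (limitAngle n) with hs
  have hα2 : α ^ 2 ≤ α := by nlinarith
  have hχ0 := hχ.1
  have hχ1 := hχ.2
  have hχχ : χ ^ 2 ≤ α ^ 2 := pow_le_pow_left₀ hχ0 hχ1 2
  have hΔ0 : 0 ≤ χ / m := by positivity
  have hΔ1 : χ / m ≤ χ := div_le_self hχ0 hm1
  have hΔΔ : (χ / m) ^ 2 ≤ α ^ 2 := pow_le_pow_left₀ hΔ0 (hΔ1.trans hχ1) 2
  have a1 : |Real.cos (m * M) - s| ≤ m * C * α := by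
    rw [hs, ← cos_mul_limitAngle]
    refine (Real.abs_cos_sub_cos_le _ _).trans ?_
    rw [← hm, ← mul_sub, abs_mul, abs_of_pos hm0, mul_assoc]
    exact mul_le_mul_of_nonneg_left hM hm0.le
  have a2 : |Real.sin M - s| ≤ C * α := (Real.abs_sin_sub_sin_le _ _).trans hM
  have cα := abs_le.1 (abs_cos_sub_one_le α)
  have cχ := abs_cos_sub_one_le χ
  have sχ := abs_sin_sub_self_le hχ0 (hχ1.trans hα1)
  have sΔ := abs_sin_sub_self_le hΔ0 (hΔ1.trans (hχ1.trans hα1))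
  have hX0 : 0 ≤ L * Real.cos α := mul_nonneg hL.1
    (Real.cos_nonneg_of_mem_Icc ⟨by linarith [Real.pi_gt_three], by linarith [Real.pi_gt_three]⟩)
  have sχabs : |Real.sin χ| ≤ α := by
    rw [abs_of_nonneg (Real.sin_nonneg_of_nonneg_of_le_pi hχ0 (by linarith [Real.pi_gt_three]))]
    exact (Real.sin_le hχ0).trans hχ1
  -- the approximations of the factor in the first term
  have b1 : |X - L| ≤ K * α ^ 2 := by
    rw [abs_of_nonpos (by linarith [hX.2])]
    have : L * (1 - Real.cos α) ≤ K * α * α ^ 2 :=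
      mul_le_mul hL.2 (by linarith [cα.1]) (by linarith [Real.cos_le_one α]) (by positivity)
    have h3 : K * α * α ^ 2 ≤ K * 1 * α ^ 2 := by gcongr
    linarith [hX.1]
  have b2 : |X * (Real.cos χ - 1)| ≤ K * α ^ 2 := by
    rw [abs_mul, abs_of_nonneg (hX0.trans hX.1)]
    have : X * |Real.cos χ - 1| ≤ K * α * α ^ 2 :=
      mul_le_mul (hX.2.trans hL.2) (cχ.trans hχχ) (abs_nonneg _) (by positivity)
    have h3 : K * α * α ^ 2 ≤ K * 1 * α ^ 2 := by gcongr
    linarith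
  have b3 : |(Y - 1) * Real.sin χ| ≤ (K + 1) * α ^ 2 :=
    abs_mul_le_of_abs_le hY (Real.abs_sin_le_one _)
  have b4 : |X * Real.cos χ - Y * Real.sin χ - (L - χ)| ≤ (3 * K + 2) * α ^ 2 := by
    have : X * Real.cos χ - Y * Real.sin χ - (L - χ) = (X - L) + X * (Real.cos χ - 1) -
      (Y - 1) * Real.sin χ - (Real.sin χ - χ) := by ring
    rw [this]
    rw [abs_le] at *
    constructor <;> linarith
  have b5 : |(Real.cos (m * M) - s) * (L - χ)| ≤ m * C * (K + 1) * α ^ 2 := by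
    have : |L - χ| ≤ (K + 1) * α := by
      rw [abs_le]; constructor <;> linarith [hL.1, hL.2, mul_pos hK hα]
    rw [abs_mul]
    calc _ ≤ m * C * α * ((K + 1) * α) := mul_le_mul a1 this (abs_nonneg _) (by positivity)
      _ = _ := by ring
  have b6 : |w * Real.sin (m * M) * Real.sin χ| ≤ (K + 1) * α ^ 2 := by
    rw [abs_mul]
    calc _ ≤ (K + 1) * α * α := mul_le_mul (abs_mul_le_of_abs_le hw (Real.abs_sin_le_one _)) sχabs
          (abs_nonneg _) (by positivity)
      _ = _ := by ring
  have b7 : |(Real.sin M - s) * (χ / m)| ≤ C * α ^ 2 := by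
    rw [abs_mul, abs_of_nonneg hΔ0]
    calc _ ≤ C * α * α := mul_le_mul a2 (hΔ1.trans hχ1) hΔ0 (by positivity)
      _ = _ := by ring
  have b8 : |Real.sin M * (Real.sin (χ / m) - χ / m)| ≤ α ^ 2 := by
    rw [mul_comm]
    exact abs_mul_le_of_abs_le (sΔ.trans hΔΔ) (Real.abs_sin_le_one _)
  have b9 : |Real.cos (m * M) * (X * Real.cos χ - Y * Real.sin χ - (L - χ))| ≤
      (3 * K + 2) * α ^ 2 := by
    rw [mul_comm]
    exact abs_mul_le_of_abs_le b4 (Real.abs_cos_le_one _)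
  -- Replacing cos(mM) and sin M by sin l, X by L, Y by 1 and sines by their arguments leaves
  -- products of two O(α) factors or O(α²) remainders.
  have key : angleDefect n X Y w χ M - s * (L - χ - χ / m) =
      (Real.cos (m * M) - s) * (L - χ) +
      Real.cos (m * M) * (X * Real.cos χ - Y * Real.sin χ - (L - χ)) -
      w * Real.sin (m * M) * Real.sin χ - (Real.sin M - s) * (χ / m) -
      Real.sin M * (Real.sin (χ / m) - χ / m) := by
    rw [angleDefect]; ring
  rw [key]
  rw [abs_le] at b5 b6 b7 b8 b9 ⊢
  constructor <;> linarith

/-- If the first-order term of `angleDefect` is nonpositive and `w > 0`, then the second-order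
term makes it negative. -/
lemma angleDefect_neg {n : ℕ} {X Y w χ M α C c : ℝ} (hα : 0 < α) (hα1 : α ≤ 1)
    (hc : 0 < c) (hX : X ≤ χ + χ / (2 * n + 1)) (hX0 : 0 ≤ X) (hY : Real.cos α ≤ Y) (hw : c * α ≤ w)
    (hχ : χ ∈ Ioc 0 α) (hM : |M - limitAngle n| ≤ C * α) (hMl : limitAngle n ≤ M)
    (hMb : M ≤ Real.pi / (2 * (2 * n + 1)))
    (hα2 : (2 * n + 1) * C * α ≤ Real.cos (limitAngle n) / 2)
    (hα3 : 8 * α < c * Real.cos (limitAngle n)) : angleDefect n X Y w χ M < 0 := by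
  set m : ℝ := 2 * n + 1 with hm
  have hm1 : 1 ≤ m := by rw [hm]; linarith [Nat.cast_nonneg (α := ℝ) n]
  have hm0 : 0 < m := by linarith
  set s := Real.sin (limitAngle n) with hs
  set k := Real.cos (limitAngle n) with hk
  have hs0 : 0 < s := sin_limitAngle_pos n
  have hs1 : s ≤ 1 := Real.sin_le_one _
  have hl0 := limitAngle_pos n
  have hχ0 := hχ.1
  have hχ1 := hχ.2
  have hΔ0 : 0 < χ / m := by positivity
  have hΔ1 : χ / m ≤ χ := div_le_self hχ0.le hm1
  have hmM : m * M ≤ Real.pi / 2 := by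
    rw [le_div_iff₀ (by positivity)] at hMb; linarith
  have hmM0 : 0 < m * M := mul_pos hm0 (hl0.trans_le hMl)
  have hMm : M ≤ m * M := le_mul_of_one_le_left (hl0.le.trans hMl) hm1
  have c1 : 0 ≤ Real.cos (m * M) := Real.cos_nonneg_of_mem_Icc ⟨by linarith, hmM⟩
  have c2 : Real.cos (m * M) ≤ s := by
    rw [hs, ← cos_mul_limitAngle, ← hm]
    exact Real.cos_le_cos_of_nonneg_of_le_pi (by positivity) (by linarith [Real.pi_pos])
      (mul_le_mul_of_nonneg_left hMl hm0.le)
  have c3 : s ≤ Real.sin M :=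
    Real.sin_le_sin_of_le_of_le_pi_div_two (by linarith) (by linarith) hMl
  have c4 : k / 2 ≤ Real.sin (m * M) := by
    have h1 : |Real.sin (m * M) - k| ≤ m * C * α := by
      rw [hk, ← sin_mul_limitAngle]
      refine (Real.abs_sin_sub_sin_le _ _).trans ?_
      rw [← hm, ← mul_sub, abs_mul, abs_of_pos hm0, mul_assoc]
      exact mul_le_mul_of_nonneg_left hM hm0.le
    linarith [(abs_le.1 h1).1]
  have s1 := Real.sin_gt_sub_cube hχ0
  have s2 := Real.sin_gt_sub_cube hΔ0
  have hχ3 : χ ^ 3 ≤ χ * α ^ 2 := by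
    have : χ ^ 2 ≤ α ^ 2 := pow_le_pow_left₀ hχ0.le hχ1 2
    nlinarith
  have hΔ3 : (χ / m) ^ 3 ≤ χ * α ^ 2 := (pow_le_pow_left₀ hΔ0.le hΔ1 3).trans hχ3
  have hα21 : α ^ 2 ≤ 1 := by nlinarith
  have hχα : χ * α ^ 2 ≤ χ := mul_le_of_le_one_right hχ0.le hα21
  have hP0 : 0 < χ * α ^ 2 := by positivity
  have hsχ : χ / 2 ≤ Real.sin χ := by linarith
  have hsχ0 : 0 ≤ Real.sin χ := by linarith
  -- first term
  have e1 : X * Real.cos χ - Y * Real.sin χ ≤ χ / m + χ * α ^ 2 := by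
    have h1 : X * Real.cos χ ≤ X := mul_le_of_le_one_right hX0 (Real.cos_le_one _)
    have h2 : Real.cos α * Real.sin χ ≤ Y * Real.sin χ := mul_le_mul_of_nonneg_right hY hsχ0
    have h3 := Real.one_sub_sq_div_two_le_cos (x := α)
    have h4 : (1 - α ^ 2 / 2) * Real.sin χ ≤ Real.cos α * Real.sin χ :=
      mul_le_mul_of_nonneg_right h3 hsχ0
    have h5 : α ^ 2 / 2 * Real.sin χ ≤ α ^ 2 / 2 * χ :=
      mul_le_mul_of_nonneg_left (Real.sin_le hχ0.le) (by positivity)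
    linarith
  -- Since M ≥ l, cos(mM) ≤ sin l ≤ sin M. Hence the contributions χ/m of the first and third terms
  -- cancel up to errors of order χα², while the term with w contributes at least ckαχ/4.
  have e2 : Real.cos (m * M) * (X * Real.cos χ - Y * Real.sin χ) ≤ s * (χ / m + χ * α ^ 2) :=
    (mul_le_mul_of_nonneg_left e1 c1).trans (mul_le_mul_of_nonneg_right c2 (by positivity))
  -- second term
  have hk0 : 0 < k := cos_limitAngle_pos n
  have e3 : c * α * (k / 2) * (χ / 2) ≤ w * Real.sin (m * M) * Real.sin χ := by
    have hw0 : 0 < c * α := by positivity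
    exact mul_le_mul (mul_le_mul hw c4 (by positivity) (hw0.le.trans hw)) hsχ (by positivity)
      (mul_nonneg (hw0.le.trans hw) (le_trans (by positivity) c4))
  -- third term
  have e4 : s * (χ / m - χ * α ^ 2 / 4) ≤ Real.sin M * Real.sin (χ / m) := by
    have h1 : 0 ≤ Real.sin (χ / m) :=
      Real.sin_nonneg_of_nonneg_of_le_pi hΔ0.le (by linarith [Real.pi_gt_three])
    exact (mul_le_mul_of_nonneg_left (by linarith) hs0.le).trans
      (mul_le_mul_of_nonneg_right c3 h1)
  have e5 : s * (χ * α ^ 2) ≤ χ * α ^ 2 := mul_le_of_le_one_left (by positivity) hs1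
  have e6 : χ * α * (8 * α) < χ * α * (c * k) := mul_lt_mul_of_pos_left hα3 (by positivity)
  rw [angleDefect, ← hm]
  linarith

/-! ### The defect as a function of ζ and its sign changes -/

/-- The leading term of the reflection law at the smoothened part. -/
def leadingTerm (n : ℕ) (h : ℝ → ℝ) (ζ : ℝ) : ℝ :=
  (2 * n + 1) / (2 * n + 2) * (1 - ζ) - ∫ ξ in ζ..1, h ξ

/-- The equations for the chord angles `x` at the right arc and `y` at the left arc of an orbit that
is reflected at the point `ζ` of the smoothened part. -/
structure ChordSystem (α : ℝ) (h : ℝ → ℝ) (n : ℕ) (ζ x y : ℝ) : Prop where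
  right : ((boundary 1 α h (smoothPoint α h ζ)).re - (halfWidth 1 α h - 1)) *
        Real.cos ((2 * n + 1) * x) +
      (boundary 1 α h (smoothPoint α h ζ)).im * Real.sin ((2 * n + 1) * x) = Real.cos x
  left : (-(boundary 1 α h (smoothPoint α h ζ)).re - (halfWidth 1 α h - 1)) *
        Real.cos ((2 * n + 1) * y) +
      (boundary 1 α h (smoothPoint α h ζ)).im * Real.sin ((2 * n + 1) * y) = Real.cos y
  reflection : (2 * n + 1) * y = (2 * n + 1) * x + 2 * turn α h ζ

lemma eventually_mul_lt (a : ℝ) {b : ℝ} (hb : 0 < b) : ∀ᶠ α in 𝓝[>] (0 : ℝ), a * α < b := by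
  have h1 : ContinuousAt (fun α : ℝ => a * α) 0 := by fun_prop
  have h2 := h1.eventually_lt continuousAt_const (by simpa using hb)
  exact h2.filter_mono nhdsWithin_le_nhds

/-- Solving `chordFun` for M leaves one function G of ζ. The expansion fixes the sign of G where
`leadingTerm` is nonzero; the last clause covers the degenerate case, in which the sign comes from
order α². There K > 1 means that the centre of the right arc lies to the right of the vertical axis.
-/
lemma eventually_exists_defect (n : ℕ) {h : ℝ → ℝ} (hh : IsShape h) {K : ℝ}
    (hK : K = (∫ ξ in (0 : ℝ)..1, h ξ)⁻¹) :
    ∃ C > (0 : ℝ), ∀ᶠ α in 𝓝[>] (0 : ℝ), ∃ G : ℝ → ℝ, ContinuousOn G (Icc 0 1) ∧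
      (∀ ζ ∈ Icc (0 : ℝ) 1, |G ζ - Real.sin (limitAngle n) *
        ((2 * n + 2) / (2 * n + 1) * (K * α * leadingTerm n h ζ))| ≤ C * α ^ 2) ∧
      (∀ ζ ∈ Icc (0 : ℝ) 1, G ζ = 0 → ∃ x y, |x - limitAngle n| ≤ C * α ∧
        |y - limitAngle n| ≤ C * α ∧ ChordSystem α h n ζ x y) ∧
      (1 < K → ∀ ζ ∈ Ico (0 : ℝ) 1, leadingTerm n h ζ = 0 → G ζ < 0) := by
  obtain ⟨C₁, hC₁, η, hη, hch⟩ := exists_chordFun_bounds n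
  set m : ℝ := 2 * n + 1 with hm
  have hm1 : 1 ≤ m := by rw [hm]; linarith [Nat.cast_nonneg (α := ℝ) n]
  have hm0 : 0 < m := by linarith
  set s := Real.sin (limitAngle n) with hs
  set k := Real.cos (limitAngle n) with hk
  have hs0 : 0 < s := sin_limitAngle_pos n
  have hk0 : 0 < k := cos_limitAngle_pos n
  have hk1 : k ≤ 1 := Real.cos_le_one _
  have hK0 : 0 < K := hK ▸ inv_pos.2 hh.integral_pos
  -- For K > 1, w is (K - 1)α up to higher order, so w ≥ cα with c = (K - 1)/2. Otherwise c is a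
  -- dummy value.
  obtain ⟨c, hc, hcK⟩ : ∃ c > (0 : ℝ), 1 < K → 2 * c = K - 1 := by
    by_cases hK1 : 1 < K
    · exact ⟨(K - 1) / 2, by linarith, fun _ => by ring⟩
    · exact ⟨1, one_pos, fun h => absurd h hK1⟩
  -- `C₂` bounds |M - l|/α: the three coefficient errors sum to at most (3K+4)α. `C₃` is the
  -- constant of `abs_angleDefect_sub_le`, and it also covers C₂ + 1, needed for M ± χ/m.
  set C₂ := C₁ * (3 * K + 4) with hC₂
  have hC₂0 : 0 < C₂ := by positivity
  set C₃ := m * C₂ * (K + 1) + (3 * K + 2) + (K + 1) + (C₂ + 1) with hC₃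
  have hC₃1 : C₂ + 1 ≤ C₃ := by
    have : 0 ≤ m * C₂ * (K + 1) + (3 * K + 2) + (K + 1) := by positivity
    linarith
  refine ⟨C₃, by linarith, ?_⟩
  filter_upwards [self_mem_nhdsWithin, eventually_mul_lt 1 one_pos,
    eventually_mul_lt (2 * K + 2) hη,
    eventually_mul_lt K (b := 2 * c) (by positivity),
    eventually_mul_lt (2 * K + 3) (b := s * c / 2) (by positivity),
    eventually_mul_lt (m * C₂) (b := k / 2) (by positivity),
    eventually_mul_lt 8 (b := c * k) (by positivity)] with α hα hα1 hαη hαc hαs hαk hα8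
  rw [one_mul] at hα1
  have hα0 : 0 < α := hα
  have hα' : α < Real.pi / 2 := by linarith [Real.pi_gt_three]
  have hα2 : α ^ 2 ≤ α := by nlinarith
  set X : ℝ → ℝ := fun ζ => (boundary 1 α h (smoothPoint α h ζ)).re with hX
  set Y : ℝ → ℝ := fun ζ => (boundary 1 α h (smoothPoint α h ζ)).im with hY
  set w := halfWidth 1 α h - 1 with hw
  set χ : ℝ → ℝ := turn α h with hχ
  set A : ℝ → ℝ := fun ζ => Y ζ * Real.cos (χ ζ) + X ζ * Real.sin (χ ζ) with hA
  set D : ℝ → ℝ := fun ζ => w * Real.cos (χ ζ) with hD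
  set B : ℝ → ℝ := fun ζ => Real.cos (χ ζ / m) with hB
  have bw : |w| ≤ (K + 1) * α := hK ▸ abs_halfWidth_sub_one_le hh hα0 hα'
  have bχ : ∀ ζ ∈ Icc (0 : ℝ) 1, χ ζ ∈ Icc 0 α := fun ζ hζ =>
    ⟨turn_nonneg hh hα0 hζ, turn_le hh hα0 hζ⟩
  have bY : ∀ ζ ∈ Icc (0 : ℝ) 1, |Y ζ - 1| ≤ (K + 1) * α ^ 2 := fun ζ hζ =>
    hK ▸ abs_boundary_im_sub_one_le hh hα0 hα' hζ
  have bX0 : ∀ ζ ∈ Icc (0 : ℝ) 1, 0 ≤ X ζ := fun ζ hζ =>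
    boundary_re_smoothPoint_nonneg hh hα0 hα' hζ
  have bX1 : ∀ ζ ∈ Icc (0 : ℝ) 1, X ζ ≤ K * α := fun ζ hζ =>
    hK ▸ boundary_re_smoothPoint_le hh hα0 hα' hζ
  have bA : ∀ ζ ∈ Icc (0 : ℝ) 1, |A ζ - 1| ≤ (2 * K + 2) * α ^ 2 := by
    intro ζ hζ
    obtain ⟨h0, h1⟩ := bχ ζ hζ
    have h2 : χ ζ ^ 2 ≤ α ^ 2 := pow_le_pow_left₀ h0 h1 2
    have e1 := abs_mul_le_of_abs_le (bY ζ hζ) (Real.abs_cos_le_one (χ ζ))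
    have e2 := (abs_cos_sub_one_le (χ ζ)).trans h2
    have e3 : |X ζ * Real.sin (χ ζ)| ≤ K * α ^ 2 := by
      have h3 : 0 ≤ Real.sin (χ ζ) :=
        Real.sin_nonneg_of_nonneg_of_le_pi h0 (by linarith [Real.pi_gt_three])
      rw [abs_of_nonneg (mul_nonneg (bX0 ζ hζ) h3)]
      calc _ ≤ K * α * α := mul_le_mul (bX1 ζ hζ) ((Real.sin_le h0).trans h1) h3 (by positivity)
        _ = _ := by ring
    have e4 : A ζ - 1 = (Y ζ - 1) * Real.cos (χ ζ) + (Real.cos (χ ζ) - 1) +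
      X ζ * Real.sin (χ ζ) := by simp only [hA]; ring
    rw [e4]
    rw [abs_le] at *
    constructor <;> linarith
  have bD : ∀ ζ, |D ζ| ≤ (K + 1) * α := fun ζ => abs_mul_le_of_abs_le bw (Real.abs_cos_le_one _)
  have bB : ∀ ζ ∈ Icc (0 : ℝ) 1, |B ζ - 1| ≤ α ^ 2 := by
    intro ζ hζ
    obtain ⟨h0, h1⟩ := bχ ζ hζ
    refine (abs_cos_sub_one_le _).trans (pow_le_pow_left₀ (by positivity) ?_ 2)
    exact (div_le_self h0 hm1).trans h1
  have hp : ∀ ζ ∈ Icc (0 : ℝ) 1, _ := fun ζ hζ => hch (A ζ) (D ζ) (B ζ)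
    ((bA ζ hζ).trans (by nlinarith)) ((bD ζ).trans (by nlinarith [mul_pos hK0 hα0]))
    ((bB ζ hζ).trans (by nlinarith [mul_pos hK0 hα0]))
  have cP : Continuous (smoothPoint α h) := by unfold smoothPoint; fun_prop
  have cγ : Continuous (boundary 1 α h) := continuous_iff_continuousAt.2 fun t =>
    (hasStrictDerivAt_boundary hh hα0 hα' t).hasDerivAt.continuousAt
  have cX : ContinuousOn X (Icc 0 1) := (Complex.continuous_re.comp (cγ.comp cP)).continuousOn
  have cY : ContinuousOn Y (Icc 0 1) := (Complex.continuous_im.comp (cγ.comp cP)).continuousOn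
  have cχ : ContinuousOn χ (Icc 0 1) := by
    have : Continuous fun ζ => Real.pi - tangentAngle 1 α h (smoothPoint α h ζ) :=
      continuous_const.sub ((continuous_tangentAngle hh hα0 hα').comp cP)
    refine this.continuousOn.congr fun ζ hζ => ?_
    simp only [tangentAngle_smoothPoint hh hα0 hα' hζ, hχ, sub_sub_cancel]
  have cc := Real.continuous_cos.comp_continuousOn cχ
  have cs := Real.continuous_sin.comp_continuousOn cχ
  have cA : ContinuousOn A (Icc 0 1) := (cY.mul cc).add (cX.mul cs)
  have cD : ContinuousOn D (Icc 0 1) := continuousOn_const.mul cc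
  have cΔ : ContinuousOn (fun ζ => χ ζ / m) (Icc 0 1) := cχ.div_const m
  have cB : ContinuousOn B (Icc 0 1) := Real.continuous_cos.comp_continuousOn cΔ
  obtain ⟨M, cM, hM⟩ := exists_continuousOn_zero (a := 0) (b := Real.pi / (2 * m)) (by positivity)
    (s := Icc (0 : ℝ) 1) (f := fun ζ x => chordFun n (A ζ) (D ζ) (B ζ) x)
    (fun x _ => ((cA.mul continuousOn_const).sub (cD.mul continuousOn_const)).sub
      (cB.mul continuousOn_const))
    (fun ζ _ => by unfold chordFun; fun_prop)
    (fun ζ hζ => (hp ζ hζ).1) (fun ζ hζ => (hp ζ hζ).2.1) (fun ζ hζ => (hp ζ hζ).2.2.1)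
  have bM : ∀ ζ ∈ Icc (0 : ℝ) 1, |M ζ - limitAngle n| ≤ C₂ * α := by
    intro ζ hζ
    refine ((hp ζ hζ).2.2.2 (M ζ) (Ioo_subset_Icc_self (hM ζ hζ).1) (hM ζ hζ).2).trans ?_
    rw [hC₂, mul_assoc]
    refine mul_le_mul_of_nonneg_left ?_ hC₁.le
    have := bA ζ hζ
    have := bD ζ
    have := bB ζ hζ
    nlinarith
  refine ⟨fun ζ => angleDefect n (X ζ) (Y ζ) w (χ ζ) (M ζ), ?_, ?_, ?_, ?_⟩
  · have cmM : ContinuousOn (fun ζ => m * M ζ) (Icc 0 1) := continuousOn_const.mul cM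
    exact (((Real.continuous_cos.comp_continuousOn cmM).mul ((cX.mul cc).sub (cY.mul cs))).sub
      ((continuousOn_const.mul (Real.continuous_sin.comp_continuousOn cmM)).mul cs)).sub
      ((Real.continuous_sin.comp_continuousOn cM).mul (Real.continuous_sin.comp_continuousOn cΔ))
  · intro ζ hζ
    have hmem := boundary_re_smoothPoint_mem hh hα0 hα' hζ
    rw [smoothLength_eq, ← hK] at hmem
    have hL : K * α * (1 - ζ) ∈ Icc 0 (K * α) :=
      ⟨mul_nonneg (by positivity) (by linarith [hζ.2]),
        mul_le_of_le_one_right (by positivity) (by linarith [hζ.1])⟩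
    have := abs_angleDefect_sub_le (n := n) hα0 hα1.le hK0 hC₂0 hL hmem (bY ζ hζ) bw (bχ ζ hζ)
      (bM ζ hζ)
    have e : K * α * (1 - ζ) - χ ζ - χ ζ / (2 * n + 1) =
        (2 * n + 2) / (2 * n + 1) * (K * α * leadingTerm n h ζ) := by
      simp only [hχ, turn, leadingTerm, div_eq_mul_inv α, ← hK]
      field_simp
      ring
    rwa [e] at this
  · intro ζ hζ h0
    obtain ⟨e1, e2⟩ := chord_equations (hM ζ hζ).2 h0
    obtain ⟨h1, h2⟩ := bχ ζ hζ
    have h3 : 0 ≤ χ ζ / m := by positivity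
    have h4 : χ ζ / m ≤ χ ζ := div_le_self h1 hm1
    have h5 := abs_le.1 (bM ζ hζ)
    have h6 : (C₂ + 1) * α ≤ C₃ * α := mul_le_mul_of_nonneg_right hC₃1 hα0.le
    refine ⟨M ζ - χ ζ / m, M ζ + χ ζ / m, ?_, ?_, e1, e2, ?_⟩
    · rw [abs_le]; constructor <;> linarith
    · rw [abs_le]; constructor <;> linarith
    · rw [← hm, mul_add, mul_sub, mul_div_cancel₀ _ hm0.ne']
      ring
  · intro hK1 ζ hζ h0
    have hζ' : ζ ∈ Icc (0 : ℝ) 1 := ⟨hζ.1, hζ.2.le⟩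
    obtain ⟨h1, h2⟩ := bχ ζ hζ'
    have hcK' := hcK hK1
    have hmem := boundary_re_smoothPoint_mem hh hα0 hα' hζ'
    have hwm := halfWidth_sub_one_mem hh hα0 hα'
    rw [smoothLength_eq, ← hK] at hmem hwm
    have hsum : χ ζ + χ ζ / m = K * α * (1 - ζ) := by
      simp only [leadingTerm] at h0
      have h0' : ∫ ξ in ζ..1, h ξ = (2 * n + 1) / (2 * n + 2) * (1 - ζ) := by linarith
      simp only [hχ, turn, div_eq_mul_inv α, ← hK, h0', hm]
      field_simp
      ring
    have hχ0 : 0 < χ ζ := by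
      rcases h1.eq_or_lt with h3 | h3
      · rw [← h3, zero_div, add_zero] at hsum
        have : 0 < K * α * (1 - ζ) := mul_pos (by positivity) (by linarith [hζ.2])
        linarith
      · exact h3
    have hcosα := Real.one_sub_sq_div_two_le_cos (x := α)
    have hcw : c * α ≤ w := by
      have h3 := hwm.1
      have h4 := Real.sin_le hα0.le
      have h5 : K * α * (1 - α ^ 2 / 2) ≤ K * α * Real.cos α :=
        mul_le_mul_of_nonneg_left hcosα (by positivity)
      have h6 : K * α * α ^ 2 ≤ 2 * c * α := by
        have : K * α * α ^ 2 ≤ K * α * α := mul_le_mul_of_nonneg_left hα2 (by positivity)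
        have : K * α * α ≤ 2 * c * α := mul_le_mul_of_nonneg_right hαc.le hα0.le
        linarith
      have h7 : 2 * c * α = K * α - α := by rw [hcK']; ring
      linarith
    -- At the limit angle `chordFun` equals (A - B) cos l - D sin l with A - B at most of order α²
    -- and D ≥ cα/2, hence is negative. By monotonicity its zero lies to the right.
    have hMl : limitAngle n ≤ M ζ := by
      by_contra! hlt
      have hl : limitAngle n ∈ Icc 0 (Real.pi / (2 * m)) := by
        refine ⟨(limitAngle_pos n).le, ?_⟩
        rw [le_div_iff₀ (by positivity)]
        linarith [limitAngle_le n]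
      have h3 := (hp ζ hζ').1 (Ioo_subset_Icc_self (hM ζ hζ').1) hl hlt
      rw [(hM ζ hζ').2, chordFun, sin_mul_limitAngle, cos_mul_limitAngle] at h3
      have h4 := (abs_le.1 (bA ζ hζ')).2
      have h5 := (abs_le.1 (bB ζ hζ')).1
      have h6 : (A ζ - B ζ) * k ≤ (2 * K + 3) * α ^ 2 := by
        have h7 : A ζ - B ζ ≤ (2 * K + 3) * α ^ 2 := by linarith
        exact (mul_le_mul_of_nonneg_right h7 hk0.le).trans
          (mul_le_of_le_one_right (by positivity) hk1)
      have h8 : c * α / 2 ≤ D ζ := by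
        have h9 := (abs_le.1 (abs_cos_sub_one_le (χ ζ))).1
        have h10 : 1 / 2 ≤ Real.cos (χ ζ) := by
          have h11 := Real.one_sub_sq_div_two_le_cos (x := χ ζ)
          have h12 : χ ζ ^ 2 ≤ α ^ 2 := pow_le_pow_left₀ h1 h2 2
          linarith
        have : c * α * (1 / 2) ≤ w * Real.cos (χ ζ) :=
          mul_le_mul hcw h10 (by norm_num) (le_trans (by positivity) hcw)
        simp only [hD]; linarith
      have h9 : c * α / 2 * s ≤ D ζ * s := mul_le_mul_of_nonneg_right h8 hs0.le
      have h10 : (2 * K + 3) * α * α < s * c / 2 * α := mul_lt_mul_of_pos_right hαs hα0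
      linarith
    exact angleDefect_neg (n := n) hα0 hα1.le hc (by rw [← hm, hsum]; exact hmem.2) (bX0 ζ hζ')
      (boundary_im_smoothPoint_mem hh hα0 hα' hζ').1 hcw ⟨hχ0, h2⟩ (bM ζ hζ') hMl
      (hM ζ hζ').1.2.le hαk.le hα8

lemma exists_zero_Ioo {G : ℝ → ℝ} (hG : ContinuousOn G (Icc 0 1)) {a b : ℝ} (ha : a ∈ Ioo (0 : ℝ) 1)
    (hb : b ∈ Ioo (0 : ℝ) 1) (hGa : G a < 0) (hGb : 0 < G b) :
    ∃ ζ ∈ uIcc a b, ζ ∈ Ioo (0 : ℝ) 1 ∧ G ζ = 0 := by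
  have hsub : uIcc a b ⊆ Ioo 0 1 := fun x hx =>
    ⟨(lt_min ha.1 hb.1).trans_le hx.1, hx.2.trans_lt (max_lt ha.2 hb.2)⟩
  have := intermediate_value_uIcc (hG.mono (hsub.trans Ioo_subset_Icc_self))
  obtain ⟨ζ, hζ, h0⟩ := this (mem_uIcc.2 (Or.inl ⟨hGa.le, hGb.le⟩) : (0 : ℝ) ∈ uIcc (G a) (G b))
  exact ⟨ζ, hζ, hsub hζ, h0⟩

lemma IsShape.hasDerivAt_leadingTerm {h : ℝ → ℝ} (hh : IsShape h) (n : ℕ) {ζ : ℝ}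
    (hζ : ζ ∈ Ioo (0 : ℝ) 1) :
    HasDerivAt (leadingTerm n h) (h ζ - (2 * n + 1) / (2 * n + 2)) ζ := by
  have hcont : ContinuousAt h ζ := hh.cont.continuousAt (Icc_mem_nhds hζ.1 hζ.2)
  have hmeas : StronglyMeasurableAtFilter h (𝓝 ζ) :=
    hh.cont.mono Ioo_subset_Icc_self |>.stronglyMeasurableAtFilter isOpen_Ioo _ hζ
  have hd := intervalIntegral.integral_hasDerivAt_left
    (hh.intervalIntegrable (Ioo_subset_Icc_self hζ) ⟨zero_le_one, le_rfl⟩) hmeas hcont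
  have h1 : HasDerivAt (fun ζ : ℝ => (2 * (n : ℝ) + 1) / (2 * n + 2) * (1 - ζ))
      ((2 * (n : ℝ) + 1) / (2 * n + 2) * (-1)) ζ :=
    ((hasDerivAt_id ζ).const_sub 1).const_mul _
  refine (h1.sub hd).congr_deriv ?_
  ring

lemma IsShape.continuousOn_leadingTerm {h : ℝ → ℝ} (hh : IsShape h) (n : ℕ) :
    ContinuousOn (leadingTerm n h) (Icc 0 1) := by
  have : Continuous fun ζ => (2 * (n : ℝ) + 1) / (2 * n + 2) * (1 - ζ) -
      ∫ ξ in ζ..1, extend h ξ := by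
    have hc := hh.continuous_extend
    have h2 : Continuous fun ζ : ℝ => ∫ ξ in ζ..1, extend h ξ := by
      simp only [intervalIntegral.integral_symm 1]
      exact (intervalIntegral.continuous_primitive
        (fun a b => hc.intervalIntegrable a b) 1).neg
    fun_prop
  refine this.continuousOn.congr fun ζ hζ => ?_
  simp only [leadingTerm, IsShape.integral_extend hζ ⟨zero_le_one, le_rfl⟩]

/-- Near 1 the function h is below (2n+1)/(2n+2) because h(1) = 0; integrate this over [ζ, 1]. -/
lemma IsShape.exists_leadingTerm_pos {h : ℝ → ℝ} (hh : IsShape h) (n : ℕ) :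
    ∃ ζ ∈ Ioo (0 : ℝ) 1, 0 < leadingTerm n h ζ := by
  have hc : ContinuousWithinAt h (Icc 0 1) 1 := hh.cont 1 ⟨zero_le_one, le_rfl⟩
  have hn : (0 : ℝ) < (2 * n + 1) / (2 * n + 2) := by positivity
  have hev : ∀ᶠ ξ in 𝓝[Icc 0 1] (1 : ℝ), h ξ < (2 * n + 1) / (2 * n + 2) :=
    hc.eventually_lt continuousWithinAt_const (by rw [hh.one]; exact hn)
  obtain ⟨ε, hε, hball⟩ := Metric.mem_nhdsWithin_iff.1 hev
  set ζ := max (1 / 2) (1 - ε / 2) with hζ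
  have hζ0 : 0 < ζ := lt_of_lt_of_le (by norm_num) (le_max_left _ _)
  have hζ1 : ζ < 1 := max_lt (by norm_num) (by linarith)
  have hζε : 1 - ε / 2 ≤ ζ := le_max_right _ _
  refine ⟨ζ, ⟨hζ0, hζ1⟩, ?_⟩
  have hlt : ∀ ξ ∈ Icc ζ 1, h ξ < (2 * n + 1) / (2 * n + 2) := fun ξ hξ => by
    refine hball ⟨?_, hζ0.le.trans hξ.1, hξ.2⟩
    rw [Metric.mem_ball, Real.dist_eq, abs_lt]
    constructor <;> linarith [hξ.1, hξ.2]
  have hint := intervalIntegral.integral_lt_integral_of_continuousOn_of_le_of_exists_lt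
    (f := h) (g := fun _ => (2 * (n : ℝ) + 1) / (2 * n + 2)) hζ1
    (hh.cont.mono (Icc_subset_Icc hζ0.le le_rfl)) continuousOn_const
    (fun x hx => (hlt x ⟨hx.1.le, hx.2⟩).le) ⟨1, ⟨hζ1.le, le_rfl⟩, hlt 1 ⟨hζ1.le, le_rfl⟩⟩
  rw [intervalIntegral.integral_const, smul_eq_mul] at hint
  rw [leadingTerm]
  linarith

lemma eventually_exists_chordSystem (n : ℕ) {h : ℝ → ℝ} (hh : IsShape h) {ζs : ℝ}
    (hζs : ζs ∈ Ioo (0 : ℝ) 1) (h0 : leadingTerm n h ζs = 0) :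
    ∃ C > (0 : ℝ), ∀ᶠ α in 𝓝[>] (0 : ℝ), ∃ ζ ∈ Ioo (0 : ℝ) 1, ∃ x y,
      |x - limitAngle n| ≤ C * α ∧ |y - limitAngle n| ≤ C * α ∧ ChordSystem α h n ζ x y := by
  obtain ⟨C, hC, hev⟩ := eventually_exists_defect n hh rfl
  set K := (∫ ξ in (0 : ℝ)..1, h ξ)⁻¹ with hK
  have hK0 : 0 < K := inv_pos.2 hh.integral_pos
  set r := Real.sin (limitAngle n) * ((2 * n + 2) / (2 * n + 1) * K) with hr
  have hr0 : 0 < r := by have := sin_limitAngle_pos n; positivity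
  refine ⟨C, hC, ?_⟩
  obtain ⟨b, hb, hb0⟩ := hh.exists_leadingTerm_pos n
  -- If `leadingTerm` is nowhere negative, letting ζ tend to 0 gives I ≤ (2n+1)/(2n+2) < 1, so K >
  -- 1, and a = ζ_* is a zero of the degenerate kind.
  have hsign : ∃ a ∈ Ioo (0 : ℝ) 1, leadingTerm n h a < 0 ∨ (leadingTerm n h a = 0 ∧ 1 < K) := by
    by_contra! hcon
    have hnn : ∀ a ∈ Ioo (0 : ℝ) 1, 0 ≤ leadingTerm n h a := fun a ha => (hcon a ha).1
    have hF0 : 0 ≤ leadingTerm n h 0 := by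
      have hmem : (0 : ℝ) ∈ closure (Ioo (0 : ℝ) 1) := by
        rw [closure_Ioo zero_ne_one]; exact ⟨le_rfl, zero_le_one⟩
      have hcl : ContinuousWithinAt (leadingTerm n h) (Ioo 0 1) 0 :=
        (hh.continuousOn_leadingTerm n 0 ⟨le_rfl, zero_le_one⟩).mono Ioo_subset_Icc_self
      have : (𝓝[Ioo (0 : ℝ) 1] 0).NeBot := mem_closure_iff_nhdsWithin_neBot.1 hmem
      exact ge_of_tendsto hcl (by filter_upwards [self_mem_nhdsWithin] with a ha using hnn a ha)
    have hK1 := (hcon ζs hζs).2 h0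
    rw [leadingTerm, sub_zero, mul_one] at hF0
    have hn : (2 * (n : ℝ) + 1) / (2 * n + 2) < 1 := by
      rw [div_lt_one (by positivity)]; linarith
    have : 1 < K := by
      rw [hK, one_lt_inv₀ hh.integral_pos]; linarith
    linarith
  obtain ⟨a, ha, hasign⟩ := hsign
  have key : ∀ᶠ α in 𝓝[>] (0 : ℝ), leadingTerm n h a < 0 → C * α < r * -leadingTerm n h a := by
    by_cases hlt : leadingTerm n h a < 0
    · filter_upwards [eventually_mul_lt C (b := r * -leadingTerm n h a)
        (mul_pos hr0 (by linarith))] with α hα _ using hα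
    · exact Eventually.of_forall fun _ hc => absurd hc hlt
  filter_upwards [hev, key, eventually_mul_lt C (b := r * leadingTerm n h b) (mul_pos hr0 hb0),
    self_mem_nhdsWithin] with α ⟨G, hGc, hG1, hG2, hG3⟩ hka hkb hα
  have hα0 : 0 < α := hα
  have hGb : 0 < G b := by
    have e := (abs_le.1 (hG1 b (Ioo_subset_Icc_self hb))).1
    have e2 : C * α * α < r * leadingTerm n h b * α := mul_lt_mul_of_pos_right hkb hα0
    rw [hr] at e2
    linarith
  have hGa : G a < 0 := by
    rcases hasign with hneg | ⟨hz, hK1⟩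
    · have e := (abs_le.1 (hG1 a (Ioo_subset_Icc_self ha))).2
      have e2 : C * α * α < r * -leadingTerm n h a * α := mul_lt_mul_of_pos_right (hka hneg) hα0
      rw [hr] at e2
      linarith
    · exact hG3 hK1 a ⟨ha.1.le, ha.2⟩ hz
  obtain ⟨ζ, -, hζ, hζ0⟩ := exists_zero_Ioo hGc ha hb hGa hGb
  obtain ⟨x, y, hx, hy, hsys⟩ := hG2 ζ (Ioo_subset_Icc_self hζ) hζ0
  exact ⟨ζ, hζ, x, y, hx, hy, hsys⟩

/-- Here the zero of `leadingTerm` is simple with positive derivative, so G already changes sign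
between ζ_* - Bα and ζ_* + Bα. -/
lemma eventually_exists_chordSystem_near (n : ℕ) {h : ℝ → ℝ} (hh : IsShape h) {ζs : ℝ}
    (hζs : ζs ∈ Ioo (0 : ℝ) 1) (h0 : leadingTerm n h ζs = 0)
    (h1 : (2 * (n : ℝ) + 1) / (2 * n + 2) < h ζs) :
    ∃ C > (0 : ℝ), ∀ᶠ α in 𝓝[>] (0 : ℝ), ∃ ζ ∈ Ioo (0 : ℝ) 1, |ζ - ζs| ≤ C * α ∧ ∃ x y,
      |x - limitAngle n| ≤ C * α ∧ |y - limitAngle n| ≤ C * α ∧ ChordSystem α h n ζ x y := by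
  obtain ⟨C, hC, hev⟩ := eventually_exists_defect n hh rfl
  set K := (∫ ξ in (0 : ℝ)..1, h ξ)⁻¹ with hK
  have hK0 : 0 < K := inv_pos.2 hh.integral_pos
  set r := Real.sin (limitAngle n) * ((2 * n + 2) / (2 * n + 1) * K) with hr
  have hr0 : 0 < r := by have := sin_limitAngle_pos n; positivity
  set d := h ζs - (2 * (n : ℝ) + 1) / (2 * n + 2) with hd
  have hd0 : 0 < d := by linarith
  have hder := hh.hasDerivAt_leadingTerm n hζs
  have hlin : ∀ᶠ ζ in 𝓝 ζs, |leadingTerm n h ζ - d * (ζ - ζs)| ≤ d / 2 * |ζ - ζs| := by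
    have := (hasDerivAt_iff_isLittleO.1 hder).def (c := d / 2) (by linarith)
    filter_upwards [this] with ζ hζ
    rw [h0, sub_zero, smul_eq_mul, Real.norm_eq_abs, Real.norm_eq_abs, ← hd, mul_comm _ d] at hζ
    exact hζ
  obtain ⟨ε, hε, hball⟩ := Metric.eventually_nhds_iff.1
    (hlin.and (Ioo_mem_nhds hζs.1 hζs.2))
  -- At distance Bα the leading term is at least dBα/2, so the main part of G is at least r α ·
  -- dBα/2 = 2Cα², twice the error bound.
  set B := 4 * C / (r * d) with hB
  have hB0 : 0 < B := by positivity
  have hBe : r * (d / 2 * B) = 2 * C := by rw [hB]; field_simp; norm_num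
  refine ⟨B + C, by positivity, ?_⟩
  filter_upwards [hev, eventually_mul_lt B hε, self_mem_nhdsWithin]
    with α ⟨G, hGc, hG1, hG2, _⟩ hBα hα
  have hα0 : 0 < α := hα
  have hBα0 : 0 < B * α := by positivity
  have hCα2 : 0 < C * α ^ 2 := by positivity
  obtain ⟨p1, p2⟩ := hball (y := ζs + B * α) (by
    rw [Real.dist_eq, add_sub_cancel_left, abs_of_pos hBα0]; exact hBα)
  obtain ⟨q1, q2⟩ := hball (y := ζs - B * α) (by
    rw [Real.dist_eq, sub_sub_cancel_left, abs_neg, abs_of_pos hBα0]; exact hBα)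
  rw [add_sub_cancel_left, abs_of_pos hBα0] at p1
  rw [sub_sub_cancel_left, abs_neg, abs_of_pos hBα0] at q1
  have hGb : 0 < G (ζs + B * α) := by
    have e := (abs_le.1 (hG1 _ (Ioo_subset_Icc_self p2))).1
    have e1 : d / 2 * (B * α) ≤ leadingTerm n h (ζs + B * α) := by linarith [(abs_le.1 p1).1]
    have e2 := mul_le_mul_of_nonneg_left e1 (mul_pos hr0 hα0).le
    have e3 : r * α * (d / 2 * (B * α)) = 2 * (C * α ^ 2) := by
      rw [show r * α * (d / 2 * (B * α)) = r * (d / 2 * B) * α ^ 2 by ring, hBe]; ring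
    rw [e3, hr] at e2
    linarith
  have hGa : G (ζs - B * α) < 0 := by
    have e := (abs_le.1 (hG1 _ (Ioo_subset_Icc_self q2))).2
    have e1 : d / 2 * (B * α) ≤ -leadingTerm n h (ζs - B * α) := by linarith [(abs_le.1 q1).2]
    have e2 := mul_le_mul_of_nonneg_left e1 (mul_pos hr0 hα0).le
    have e3 : r * α * (d / 2 * (B * α)) = 2 * (C * α ^ 2) := by
      rw [show r * α * (d / 2 * (B * α)) = r * (d / 2 * B) * α ^ 2 by ring, hBe]; ring
    rw [e3, hr] at e2
    linarith
  obtain ⟨ζ, hζu, hζ, hζ0⟩ := exists_zero_Ioo hGc q2 p2 hGa hGb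
  rw [uIcc_of_le (by linarith)] at hζu
  obtain ⟨x, y, hx, hy, hsys⟩ := hG2 ζ (Ioo_subset_Icc_self hζ) hζ0
  have hle1 : B * α ≤ (B + C) * α := mul_le_mul_of_nonneg_right (by linarith) hα0.le
  have hle2 : C * α ≤ (B + C) * α := mul_le_mul_of_nonneg_right (by linarith) hα0.le
  refine ⟨ζ, hζ, ?_, x, y, hx.trans hle2, hy.trans hle2, hsys⟩
  rw [abs_le]
  constructor <;> linarith [hζu.1, hζu.2]

/-! ### From the chord equations to a periodic orbit -/

section extension
variable {α : ℝ} {h : ℝ → ℝ}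

/-- Half an orbit, from the midpoint of the right component to the midpoint of the left one, extends
to a periodic orbit by reflection at the horizontal axis. -/
lemma exists_orbit_of_half (hh : IsShape h) (hα : 0 < α) (hα' : α < Real.pi / 2) {N : ℕ}
    (hN : 0 < N) {a : ℕ → ℝ × ℝ} (hs : ∀ i < N, BilliardStep 1 α h (a i) (a (i + 1)))
    (hlt : ∀ i < N, (a i).1 < (a (i + 1)).1) (h0 : (a 0).1 = 0)
    (hNq : (a N).1 = 2 * quarterLength 1 α h) :
    ∃ z : ℕ → ℝ × ℝ, (∀ i ≤ N, z i = a i) ∧ (∀ i, BilliardStep 1 α h (z i) (z (i + 1))) ∧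
      StrictMono (fun i => (z i).1) ∧
      (∀ i, z (i + 2 * N) = ((z i).1 + perimeter 1 α h, (z i).2)) ∧
      (starRingEnd ℂ) '' reflectionPoints 1 α h z = reflectionPoints 1 α h z := by
  set P := perimeter 1 α h with hP
  have hPq : P = 4 * quarterLength 1 α h := rfl
  -- One full period: the given half, then its mirror image backwards. The two formulas agree at r =
  -- N because a N is the midpoint of the left copy.
  set b : ℕ → ℝ × ℝ := fun r => if r ≤ N then a r else (P - (a (2 * N - r)).1, (a (2 * N - r)).2)
    with hb
  have hb1 : ∀ r ≤ N, b r = a r := fun r hr => by simp [hb, hr]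
  have hb2 : ∀ r, N ≤ r → b r = (P - (a (2 * N - r)).1, (a (2 * N - r)).2) := fun r hr => by
    rcases hr.eq_or_lt with rfl | hlt
    · rw [hb1 N le_rfl, show 2 * N - N = N by omega]
      refine Prod.ext ?_ rfl
      simp only [hNq, hPq]; ring
    · simp [hb, hlt]
  have hbs : ∀ r < 2 * N, BilliardStep 1 α h (b r) (b (r + 1)) ∧ (b r).1 < (b (r + 1)).1 := by
    intro r hr
    rcases lt_or_ge r N with h1 | h1
    · rw [hb1 r h1.le, hb1 (r + 1) h1]
      exact ⟨hs r h1, hlt r h1⟩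
    · rw [hb2 r h1, hb2 (r + 1) (by omega)]
      have e : 2 * N - (r + 1) + 1 = 2 * N - r := by omega
      have h2 := (hs (2 * N - (r + 1)) (by omega)).perimeter_sub hh hα hα'
      have h3 := hlt (2 * N - (r + 1)) (by omega)
      rw [e] at h2 h3
      exact ⟨h2, by simp only; linarith⟩
  set z : ℕ → ℝ × ℝ := fun j => ((b (j % (2 * N))).1 + (j / (2 * N) : ℕ) * P, (b (j % (2 * N))).2)
    with hz
  -- The end r = 2N is included so that the step from one period to the next needs no separate case.
  have hzb : ∀ r ≤ 2 * N, ∀ k : ℕ, z (r + 2 * N * k) = ((b r).1 + k * P, (b r).2) := by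
    intro r hr k
    rcases hr.eq_or_lt with rfl | hlt
    · have e : 2 * N + 2 * N * k = 2 * N * (k + 1) := by ring
      simp only [hz]
      rw [e, Nat.mul_mod_right, Nat.mul_div_cancel_left _ (by omega), hb2 (2 * N) (by omega),
        Nat.sub_self, hb1 0 (by omega), h0]
      refine Prod.ext ?_ rfl
      push_cast; ring
    · simp only [hz]
      rw [Nat.add_mul_mod_self_left, Nat.mod_eq_of_lt hlt, Nat.add_mul_div_left _ _ (by omega),
        Nat.div_eq_of_lt hlt, zero_add]
  have hrep : ∀ j, ∃ r < 2 * N, ∃ k, j = r + 2 * N * k := fun j =>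
    ⟨j % (2 * N), Nat.mod_lt _ (by omega), j / (2 * N), (Nat.mod_add_div _ _).symm⟩
  have hstep : ∀ i, BilliardStep 1 α h (z i) (z (i + 1)) ∧ (z i).1 < (z (i + 1)).1 := by
    intro i
    obtain ⟨r, hr, k, rfl⟩ := hrep i
    rw [add_right_comm, hzb r hr.le k, hzb (r + 1) hr k]
    obtain ⟨h1, h2⟩ := hbs r hr
    exact ⟨h1.add_perimeter hh hα hα' k, by simp only; linarith⟩
  have hconj : ∀ i, ∃ j, boundary 1 α h (z j).1 = (starRingEnd ℂ) (boundary 1 α h (z i).1) := by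
    intro i
    obtain ⟨r, hr, k, rfl⟩ := hrep i
    refine ⟨2 * N - r, ?_⟩
    have e1 := hzb (2 * N - r) (by omega) 0
    rw [mul_zero, add_zero] at e1
    rw [e1, hzb r hr.le k]
    have e2 : (b (2 * N - r)).1 = P - (b r).1 := by
      rcases le_total r N with h1 | h1
      · rw [hb1 r h1, hb2 _ (by omega), show 2 * N - (2 * N - r) = r by omega]
      · rw [hb2 r h1, hb1 _ (by omega)]
        simp only; ring
    simp only [Nat.cast_zero, zero_mul, add_zero]
    rw [e2, hP, boundary_perimeter_sub hh hα hα', boundary_add_mul_perimeter hh hα hα']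
  refine ⟨z, fun i hi => ?_, fun i => (hstep i).1, strictMono_nat_of_lt_succ fun i => (hstep i).2,
    fun i => ?_, ?_⟩
  · have := hzb i (by omega) 0
    rw [mul_zero, add_zero] at this
    rw [this, hb1 i hi]
    simp
  · obtain ⟨r, hr, k, rfl⟩ := hrep i
    rw [show r + 2 * N * k + 2 * N = r + 2 * N * (k + 1) by ring, hzb r hr.le, hzb r hr.le]
    refine Prod.ext ?_ rfl
    push_cast; ring
  · apply Subset.antisymm
    · rintro _ ⟨_, ⟨i, rfl⟩, rfl⟩
      obtain ⟨j, hj⟩ := hconj i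
      exact ⟨j, hj⟩
    · rintro _ ⟨i, rfl⟩
      obtain ⟨j, hj⟩ := hconj i
      exact ⟨_, ⟨j, rfl⟩, by simp only [hj, Complex.conj_conj]⟩

end extension

/-- The chords on the left copy are built as chords on the right arc and carried over by the
symmetry t ↦ 2q - t, which reverses their direction. -/
lemma ChordSystem.exists_isOrbit {n : ℕ} {α : ℝ} {h : ℝ → ℝ} (hh : IsShape h) (hα : 0 < α)
    (hα' : α < Real.pi / 2) {ζ x y : ℝ} (hζ : ζ ∈ Ioo (0 : ℝ) 1) (hsys : ChordSystem α h n ζ x y)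
    (hx : 0 < x) (hy : 0 < y) (hxA : 2 * n * x < Real.pi / 2 - α)
    (hyA : 2 * n * y < Real.pi / 2 - α)
    (hx' : 0 < Real.pi / 2 - turn α h ζ - (2 * n + 1) * x)
    (hτx : 0 < (boundary 1 α h (smoothPoint α h ζ)).im * Real.cos ((2 * n + 1) * x) -
      ((boundary 1 α h (smoothPoint α h ζ)).re - (halfWidth 1 α h - 1)) *
        Real.sin ((2 * n + 1) * x) + Real.sin x)
    (hτy : 0 < (boundary 1 α h (smoothPoint α h ζ)).im * Real.cos ((2 * n + 1) * y) -
      (-(boundary 1 α h (smoothPoint α h ζ)).re - (halfWidth 1 α h - 1)) *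
        Real.sin ((2 * n + 1) * y) + Real.sin y) :
    ∃ z : ℕ → ℝ × ℝ, IsOrbit 1 α h n ζ z := by
  have hζ' : ζ ∈ Icc (0 : ℝ) 1 := Ioo_subset_Icc_self hζ
  set q := quarterLength 1 α h with hq
  set t := smoothPoint α h ζ with ht
  set x' := Real.pi / 2 - turn α h ζ - (2 * n + 1) * x with hx'd
  have hx'y : x' = Real.pi / 2 + turn α h ζ - (2 * n + 1) * y := by
    rw [hx'd, hsys.reflection]; ring
  have hS := smoothLength_pos hh hα
  have hA := arcLength_one (α := α)
  have htA : arcLength 1 α < t := by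
    rw [ht, smoothPoint]; linarith [mul_pos hζ.1 hS]
  have htq : t < q := by
    have := mul_lt_of_lt_one_left hS hζ.2
    rw [ht, smoothPoint, hq, quarterLength]; linarith
  have ht0 := turn_nonneg hh hα hζ'
  have hn0 : (0 : ℝ) ≤ n := Nat.cast_nonneg n
  have hnx : 0 ≤ 2 * n * x := by positivity
  have hny : 0 ≤ 2 * n * y := by positivity
  have hxm : (2 * n + 1) * x = 2 * n * x + x := by ring
  have hym : (2 * n + 1) * y = 2 * n * y + y := by ring
  have hxπ : x < Real.pi := by linarith [Real.pi_pos]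
  have hyπ : y < Real.pi := by linarith [Real.pi_pos, turn_le hh hα hζ']
  have hx'π : x' < Real.pi := by linarith [Real.pi_pos]
  have hcirc : ∀ {u : ℝ}, 0 < u → u < Real.pi → 2 * n * u < Real.pi / 2 - α → ∀ i < n,
      BilliardStep 1 α h (2 * i * u, Real.pi / 2 - u) (2 * (i + 1 : ℕ) * u, Real.pi / 2 - u) := by
    intro u hu huπ huA i hi
    have h1 : (2 : ℝ) * (i + 1 : ℕ) * u = 2 * i * u + 2 * u := by push_cast; ring
    have h2 : ((i + 1 : ℕ) : ℝ) ≤ n := by exact_mod_cast hi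
    have h3 : (2 : ℝ) * (i + 1 : ℕ) * u ≤ 2 * n * u := by gcongr
    have h4 : 0 ≤ (2 : ℝ) * i * u := by positivity
    rw [h1]
    refine billiardStep_circle hh hα hα' ?_ ⟨hu, huπ⟩ ?_
    · rw [abs_of_nonneg h4]; linarith
    · rw [abs_of_nonneg (by linarith)]; linarith
  have hright : BilliardStep 1 α h (2 * n * x, Real.pi / 2 - x) (t, Real.pi / 2 - x') := by
    refine billiardStep_of_circle hh hα hα' (by rw [abs_of_nonneg hnx]; linarith) ⟨hx, hxπ⟩
      ⟨hx', hx'π⟩ ?_ ?_ ?_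
    · rw [ht, tangentAngle_smoothPoint hh hα hα' hζ']; linarith
    · rw [← hxm]; exact hsys.right
    · rw [← hxm]; exact hτx
  have hleft : BilliardStep 1 α h (2 * n * y, Real.pi / 2 - y) (2 * q - t, Real.pi / 2 - x') := by
    refine billiardStep_of_circle hh hα hα' (by rw [abs_of_nonneg hny]; linarith) ⟨hy, hyπ⟩
      ⟨hx', hx'π⟩ ?_ ?_ ?_
    · rw [ht, hq, tangentAngle_half_sub hh hα hα', tangentAngle_smoothPoint hh hα hα' hζ']; linarith
    · rw [← hym, hq, boundary_half_sub hh hα hα', Complex.neg_re, Complex.neg_im, Complex.conj_re,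
        Complex.conj_im, neg_neg]
      exact hsys.left
    · rw [← hym, hq, boundary_half_sub hh hα hα', Complex.neg_re, Complex.neg_im, Complex.conj_re,
        Complex.conj_im, neg_neg]
      exact hτy
  set a : ℕ → ℝ × ℝ := fun i => if i ≤ n then (2 * i * x, Real.pi / 2 - x) else
    if i = n + 1 then (t, Real.pi / 2 - x') else
      (2 * q - 2 * (2 * n + 2 - i : ℕ) * y, Real.pi / 2 - y) with ha
  have ha1 : ∀ i ≤ n, a i = (2 * i * x, Real.pi / 2 - x) := fun i hi => by simp [ha, hi]
  have ha2 : a (n + 1) = (t, Real.pi / 2 - x') := by simp [ha]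
  have ha3 : ∀ i, n + 2 ≤ i → a i = (2 * q - 2 * (2 * n + 2 - i : ℕ) * y, Real.pi / 2 - y) :=
    fun i hi => by
      have h1 : ¬ i ≤ n := by omega
      have h2 : i ≠ n + 1 := by omega
      simp [ha, h1, h2]
  have hstep : ∀ i < 2 * n + 2, BilliardStep 1 α h (a i) (a (i + 1)) ∧ (a i).1 < (a (i + 1)).1 := by
    intro i hi
    rcases lt_trichotomy i n with h1 | h1 | h1
    · rw [ha1 i h1.le, ha1 (i + 1) h1]
      refine ⟨hcirc hx hxπ hxA i h1, ?_⟩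
      simp only; push_cast; linarith
    · rw [h1, ha1 n le_rfl, ha2]
      exact ⟨hright, by simp only; linarith⟩
    · rcases (Nat.succ_le_iff.2 h1).eq_or_lt with h2 | h2
      · rw [← h2, Nat.succ_eq_add_one, ha2, ha3 (n + 1 + 1) le_rfl,
          show 2 * n + 2 - (n + 1 + 1) = n by omega]
        have := hleft.half_sub hh hα hα'
        simp only [← hq, sub_sub_cancel] at this
        exact ⟨this, by simp only; linarith⟩
      · obtain ⟨j, hj, hjn⟩ : ∃ j, i = 2 * n + 2 - (j + 1) ∧ j < n :=
          ⟨2 * n + 1 - i, by omega, by omega⟩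
        rw [ha3 i h2, ha3 (i + 1) (by omega), show 2 * n + 2 - i = j + 1 by omega,
          show 2 * n + 2 - (i + 1) = j by omega]
        refine ⟨(hcirc hy hyπ hyA j hjn).half_sub hh hα hα', ?_⟩
        simp only; push_cast; linarith
  obtain ⟨z, hza, hzs, hzm, hzp, hzc⟩ := exists_orbit_of_half hh hα hα' (N := 2 * n + 2) (by omega)
    (fun i hi => (hstep i hi).1) (fun i hi => (hstep i hi).2) (by simp [ha1 0 (Nat.zero_le n)])
    (by rw [ha3 _ (by omega), Nat.sub_self]; simp [hq])
  have hN4 : 2 * (2 * n + 2) = 4 * (n + 1) := by ring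
  rw [hN4] at hzp
  have hz0 : (z 0).1 = 0 := by rw [hza 0 (by omega), ha1 0 (by omega)]; simp
  have hpmul : ∀ r k : ℕ, z (r + 4 * (n + 1) * k) = ((z r).1 + k * perimeter 1 α h, (z r).2) := by
    intro r k
    induction k with
    | zero => simp
    | succ k ih =>
      rw [mul_add, mul_one, ← add_assoc, hzp, ih]
      refine Prod.ext ?_ rfl
      push_cast; ring
  refine ⟨z, hzs, hzm, hzp, hz0, ?_, ?_, hζ, ?_, hzc, ?_⟩
  · rw [hza _ le_rfl, ha3 _ (by omega), Nat.sub_self]; simp [hq]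
  · rw [hza _ (by omega), ha2]; rfl
  · intro i hi hne
    rw [hza i hi]
    rcases lt_or_gt_of_ne hne with h1 | h1
    · rw [ha1 i (by omega)]
      have h2 : (i : ℝ) ≤ n := by exact_mod_cast (by omega : i ≤ n)
      have h3 : (2 : ℝ) * i * x ≤ 2 * n * x := by gcongr
      have h4 : 0 ≤ (2 : ℝ) * i * x := by positivity
      simp only
      rw [midDist_of_abs_le hh hα hα', abs_of_nonneg h4]
      · linarith
      · rw [abs_of_nonneg h4]; linarith
    · rw [ha3 i (by omega)]
      have h2 : ((2 * n + 2 - i : ℕ) : ℝ) ≤ n := by exact_mod_cast (by omega : 2 * n + 2 - i ≤ n)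
      have h3 : (2 : ℝ) * (2 * n + 2 - i : ℕ) * y ≤ 2 * n * y := by gcongr
      have h4 : 0 ≤ (2 : ℝ) * (2 * n + 2 - i : ℕ) * y := by positivity
      simp only
      rw [sub_eq_neg_add, midDist_add, midDist_neg, midDist_of_abs_le hh hα hα', abs_of_nonneg h4]
      · linarith
      · rw [abs_of_nonneg h4]; linarith
  -- The mirror image of the smoothened point has parameter 2q - t. This lies strictly between
  -- reflections n + 1 and n + 2, since t < q and 2ny < `arcLength 1 α` < t, so it is not a
  -- reflection point.
  · intro heq
    have hmem : -(starRingEnd ℂ) (boundary 1 α h (z (n + 1)).1) ∈ reflectionPoints 1 α h z := by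
      rw [← heq]
      exact mem_image_of_mem _ (mem_range_self (n + 1))
    obtain ⟨j, hj⟩ := hmem
    have hzn : (z (n + 1)).1 = t := by rw [hza _ (by omega), ha2]
    have hzn2 : (z (n + 2)).1 = 2 * q - 2 * n * y := by
      rw [hza _ (by omega), ha3 _ le_rfl, show 2 * n + 2 - (n + 2) = n by omega]
    have hlt : j % (4 * (n + 1)) < 4 * (n + 1) := Nat.mod_lt _ (by omega)
    have e := hpmul (j % (4 * (n + 1))) (j / (4 * (n + 1)))
    rw [Nat.mod_add_div] at e
    simp only [e, boundary_add_mul_perimeter hh hα hα', hzn, ← boundary_half_sub hh hα hα'] at hj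
    set r := j % (4 * (n + 1))
    have hr0 : 0 ≤ (z r).1 := by
      have := hzm.monotone (Nat.zero_le r)
      simp only [hz0] at this
      exact this
    have hrP : (z r).1 < perimeter 1 α h := by
      have h1 := hzm hlt
      have h2 := hzp 0
      rw [zero_add] at h2
      simp only [h2, hz0, zero_add] at h1
      exact h1
    have hq0 := quarterLength_pos hh hα hα'
    have hA0 := arcLength_pos hα'
    have := boundary_injOn hh hα hα' (x₁ := (z r).1) (x₂ := 2 * q - t) ⟨hr0, hrP⟩
      ⟨by linarith, by rw [perimeter, ← hq]; linarith⟩ hj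
    rcases le_or_gt r (n + 1) with h1 | h1
    · have h2 := hzm.monotone h1
      simp only [hzn] at h2
      linarith
    · have h2 := hzm.monotone (show n + 2 ≤ r from h1)
      simp only [hzn2] at h2
      linarith

/-- For small `α` every solution of the chord equations close to the limit angle is an orbit. -/
lemma eventually_exists_isOrbit (n : ℕ) {h : ℝ → ℝ} (hh : IsShape h) {C : ℝ} (hC : 0 < C) :
    ∀ᶠ α in 𝓝[>] (0 : ℝ), ∀ ζ ∈ Ioo (0 : ℝ) 1, ∀ x y, |x - limitAngle n| ≤ C * α →
      |y - limitAngle n| ≤ C * α → ChordSystem α h n ζ x y →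
        ∃ z : ℕ → ℝ × ℝ, IsOrbit 1 α h n ζ z := by
  set K := (∫ ξ in (0 : ℝ)..1, h ξ)⁻¹ with hK
  have hK0 : 0 < K := inv_pos.2 hh.integral_pos
  set m : ℝ := 2 * n + 1 with hm
  have hm1 : 1 ≤ m := by rw [hm]; linarith [Nat.cast_nonneg (α := ℝ) n]
  have hl0 := limitAngle_pos n
  have hml : m * limitAngle n = Real.pi / 2 - limitAngle n := mul_limitAngle n
  -- The third condition keeps mx and my below π/2 - α, so that the last circular points are
  -- interior to the arcs and x' is positive. The fourth makes the lengths of the two long chords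
  -- positive.
  filter_upwards [self_mem_nhdsWithin, eventually_mul_lt 1 one_pos,
    eventually_mul_lt (m * C + 1) hl0, eventually_mul_lt (2 * K + 1 + C) (sin_limitAngle_pos n)]
    with α hα hα1 hαl hαs ζ hζ x y hx hy hsys
  rw [one_mul] at hα1
  have hα0 : 0 < α := hα
  have hα' : α < Real.pi / 2 := by linarith [Real.pi_gt_three]
  have hζ' := Ioo_subset_Icc_self hζ
  have bw := abs_le.1 (abs_halfWidth_sub_one_le hh hα0 hα')
  have bX0 := boundary_re_smoothPoint_nonneg hh hα0 hα' hζ'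
  have bX1 := boundary_re_smoothPoint_le hh hα0 hα' hζ'
  have bY : 0 ≤ (boundary 1 α h (smoothPoint α h ζ)).im :=
    (Real.cos_nonneg_of_mem_Icc ⟨by linarith, hα'.le⟩).trans
      (boundary_im_smoothPoint_mem hh hα0 hα' hζ').1
  have ht := turn_le hh hα0 hζ'
  rw [← hK] at bw bX1
  have key : ∀ u, |u - limitAngle n| ≤ C * α → 0 < u ∧ 2 * n * u < Real.pi / 2 - α ∧
      m * u ≤ Real.pi / 2 - limitAngle n + m * C * α ∧
      ∀ d, |d| ≤ (2 * K + 1) * α → 0 < (boundary 1 α h (smoothPoint α h ζ)).im *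
        Real.cos (m * u) - d * Real.sin (m * u) + Real.sin u := by
    intro u hu
    have h1 := abs_le.1 hu
    have hCm : C * α ≤ m * C * α := by
      rw [mul_assoc]; exact le_mul_of_one_le_left (by positivity) hm1
    have hu0 : 0 < u := by linarith
    have hmu : m * u ≤ Real.pi / 2 - limitAngle n + m * C * α := by
      rw [← hml, mul_assoc, ← mul_add]
      exact mul_le_mul_of_nonneg_left (by linarith) (by linarith)
    refine ⟨hu0, ?_, hmu, fun d hd => ?_⟩
    · have : 2 * n * u = m * u - u := by rw [hm]; ring
      linarith
    · have h2 : 0 ≤ Real.cos (m * u) := Real.cos_nonneg_of_mem_Icc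
        ⟨by linarith [mul_pos (show 0 < m by linarith) hu0, Real.pi_pos], by linarith⟩
      have h3 := (abs_le.1 (abs_mul_le_of_abs_le hd (Real.abs_sin_le_one (m * u)))).2
      have h4 := (abs_le.1 ((Real.abs_sin_sub_sin_le _ _).trans hu)).1
      have h5 := mul_nonneg bY h2
      linarith
  obtain ⟨x1, x2, x3, x4⟩ := key x hx
  obtain ⟨y1, y2, -, y4⟩ := key y hy
  refine hsys.exists_isOrbit hh hα0 hα' hζ x1 y1 x2 y2 ?_ (x4 _ ?_) (y4 _ ?_)
  · rw [← hm]; linarith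
  · rw [abs_le]; constructor <;> linarith
  · rw [abs_le]; constructor <;> linarith

/-! ### Scaling in the radius -/

section scaling

variable {ρ α : ℝ} {h : ℝ → ℝ}

lemma arcLength_scale : arcLength ρ α = ρ * arcLength 1 α := by
  simp [arcLength]

lemma smoothLength_scale : smoothLength ρ α h = ρ * smoothLength 1 α h := by
  simp [smoothLength, mul_div_assoc]

lemma quarterLength_scale : quarterLength ρ α h = ρ * quarterLength 1 α h := by
  rw [quarterLength, quarterLength, arcLength_scale, smoothLength_scale, mul_add]

lemma perimeter_scale : perimeter ρ α h = ρ * perimeter 1 α h := by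
  rw [perimeter, perimeter, quarterLength_scale, mul_left_comm]

lemma midDist_scale (hρ : 0 < ρ) (t : ℝ) : midDist ρ α h (ρ * t) = ρ * midDist 1 α h t := by
  rw [midDist, midDist, quarterLength_scale, mul_left_comm 2 ρ, mul_div_mul_left _ _ hρ.ne',
    mul_assoc ρ, ← mul_sub, abs_mul, abs_of_pos hρ]

lemma curvature_scale (hρ : 0 < ρ) (t : ℝ) :
    ρ * curvature ρ α h (ρ * t) = curvature 1 α h t := by
  rw [curvature, curvature, midDist_scale hρ, arcLength_scale, smoothLength_scale, ← mul_sub,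
    mul_div_mul_left _ _ hρ.ne']
  simp only [mul_le_mul_iff_right₀ hρ]
  split_ifs
  · field_simp
  · field_simp

lemma tangentAngle_scale (hρ : 0 < ρ) (t : ℝ) :
    tangentAngle ρ α h (ρ * t) = tangentAngle 1 α h t := by
  have := intervalIntegral.mul_integral_comp_mul_left (a := 0) (b := t)
    (f := curvature ρ α h) (c := ρ)
  rw [mul_zero] at this
  rw [tangentAngle, tangentAngle, ← this, ← intervalIntegral.integral_const_mul]
  simp_rw [curvature_scale hρ]

lemma tangent_scale (hρ : 0 < ρ) (t : ℝ) : tangent ρ α h (ρ * t) = tangent 1 α h t := by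
  rw [tangent, tangent, tangentAngle_scale hρ]

lemma halfWidth_scale (hρ : 0 < ρ) : halfWidth ρ α h = ρ * halfWidth 1 α h := by
  have := intervalIntegral.mul_integral_comp_mul_left (a := 0) (b := quarterLength 1 α h)
    (f := fun r => Real.cos (tangentAngle ρ α h r)) (c := ρ)
  rw [mul_zero, ← quarterLength_scale] at this
  rw [halfWidth, halfWidth, ← this, mul_neg]
  simp_rw [tangentAngle_scale hρ]

lemma boundary_scale (hρ : 0 < ρ) (t : ℝ) :
    boundary ρ α h (ρ * t) = ρ * boundary 1 α h t := by
  have := intervalIntegral.smul_integral_comp_mul_left (a := 0) (b := t) (tangent ρ α h) ρ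
  rw [mul_zero] at this
  rw [boundary, boundary, ← this, halfWidth_scale hρ, mul_add, Complex.real_smul]
  simp_rw [tangent_scale hρ]
  push_cast
  rfl

/-- Scaling of the arc length parameter by `ρ`. -/
def scale (ρ : ℝ) (z : ℝ × ℝ) : ℝ × ℝ := (ρ * z.1, z.2)

lemma scale_scale_inv (hρ : 0 < ρ) (z : ℝ × ℝ) : scale ρ (scale ρ⁻¹ z) = z := by
  simp [scale, hρ.ne']

lemma billiardStep_scale (hρ : 0 < ρ) {z w : ℝ × ℝ} :
    BilliardStep ρ α h (scale ρ z) (scale ρ w) ↔ BilliardStep 1 α h z w := by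
  have hρ' : (ρ : ℂ) ≠ 0 := by exact_mod_cast hρ.ne'
  simp only [BilliardStep, scale, boundary_scale hρ, tangent_scale hρ]
  refine and_congr_right fun _ => and_congr_right fun _ => and_congr_left fun _ => ⟨?_, ?_⟩
  · rintro ⟨τ, hτ, e⟩
    refine ⟨τ / ρ, div_pos hτ hρ, mul_left_cancel₀ hρ' ?_⟩
    rw [e]
    push_cast
    field_simp
  · rintro ⟨τ, hτ, e⟩
    refine ⟨ρ * τ, mul_pos hρ hτ, ?_⟩
    rw [e]
    push_cast
    ring

lemma BilliardIter.scale (hρ : 0 < ρ) {p : ℕ} {z w : ℝ × ℝ} (hz : BilliardIter 1 α h p z w) :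
    BilliardIter ρ α h p (scale ρ z) (scale ρ w) := by
  obtain ⟨x, rfl, rfl, hx⟩ := hz
  exact ⟨fun i => SmoothStadium.scale ρ (x i), rfl, rfl,
    fun i hi => (billiardStep_scale hρ).2 (hx i hi)⟩

lemma reflectionPoints_scale (hρ : 0 < ρ) (z : ℕ → ℝ × ℝ) :
    reflectionPoints ρ α h (fun i => scale ρ (z i)) =
      (fun P : ℂ => ρ * P) '' reflectionPoints 1 α h z := by
  rw [reflectionPoints, reflectionPoints, ← range_comp]
  simp only [scale, boundary_scale hρ, Function.comp_def]

lemma isOrbit_scale (hρ : 0 < ρ) {n : ℕ} {ζ : ℝ} {z : ℕ → ℝ × ℝ} :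
    IsOrbit ρ α h n ζ (fun i => scale ρ (z i)) ↔ IsOrbit 1 α h n ζ z := by
  have hρ' : (ρ : ℂ) ≠ 0 := by exact_mod_cast hρ.ne'
  have hinj : Function.Injective fun P : ℂ => (ρ : ℂ) * P := mul_right_injective₀ hρ'
  have himg : ∀ (f : ℂ → ℂ), (∀ P, f (ρ * P) = ρ * f P) →
      (f '' reflectionPoints ρ α h (fun i => scale ρ (z i)) =
        reflectionPoints ρ α h (fun i => scale ρ (z i)) ↔
          f '' reflectionPoints 1 α h z = reflectionPoints 1 α h z) := by
    intro f hf
    rw [reflectionPoints_scale hρ, image_image]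
    simp_rw [hf]
    rw [← image_image (fun P : ℂ => (ρ : ℂ) * P) f]
    exact hinj.image_injective.eq_iff
  have hstep : (∀ i, BilliardStep ρ α h (scale ρ (z i)) (scale ρ (z (i + 1)))) ↔
      ∀ i, BilliardStep 1 α h (z i) (z (i + 1)) := forall_congr' fun i => billiardStep_scale hρ
  have hmono : (StrictMono fun i => (scale ρ (z i)).1) ↔ StrictMono fun i => (z i).1 := by
    simp only [StrictMono, scale, mul_lt_mul_iff_right₀ hρ]
  have hper : (∀ i, scale ρ (z (i + 4 * (n + 1))) =
      ((scale ρ (z i)).1 + perimeter ρ α h, (scale ρ (z i)).2)) ↔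
      ∀ i, z (i + 4 * (n + 1)) = ((z i).1 + perimeter 1 α h, (z i).2) := by
    refine forall_congr' fun i => ?_
    rw [perimeter_scale (ρ := ρ), scale, scale, Prod.mk.injEq, Prod.ext_iff, ← mul_add,
      mul_right_inj' hρ.ne']
  have hconj : ∀ P : ℂ, (starRingEnd ℂ) (ρ * P) = ρ * (starRingEnd ℂ) P := by simp
  have h0 : (scale ρ (z 0)).1 = 0 ↔ (z 0).1 = 0 := by simp [scale, hρ.ne']
  have hl : (scale ρ (z (2 * n + 2))).1 = 2 * quarterLength ρ α h ↔
      (z (2 * n + 2)).1 = 2 * quarterLength 1 α h := by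
    rw [quarterLength_scale (ρ := ρ), scale, mul_left_comm, mul_right_inj' hρ.ne']
  have hs : (scale ρ (z (n + 1))).1 = arcLength ρ α + ζ * smoothLength ρ α h ↔
      (z (n + 1)).1 = arcLength 1 α + ζ * smoothLength 1 α h := by
    rw [arcLength_scale (ρ := ρ), smoothLength_scale (ρ := ρ), scale, mul_left_comm, ← mul_add,
      mul_right_inj' hρ.ne']
  have hc : (∀ i ≤ 2 * n + 2, i ≠ n + 1 → midDist ρ α h (scale ρ (z i)).1 < arcLength ρ α) ↔
      ∀ i ≤ 2 * n + 2, i ≠ n + 1 → midDist 1 α h (z i).1 < arcLength 1 α := by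
    simp only [scale, midDist_scale hρ, arcLength_scale (ρ := ρ), mul_lt_mul_iff_right₀ hρ]
  have h1 := himg (starRingEnd ℂ) hconj
  have h2 := himg (fun P => -(starRingEnd ℂ) P) (fun P => by rw [hconj, mul_neg])
  constructor
  · intro H
    exact ⟨hstep.1 H.step, hmono.1 H.strictMono, hper.1 H.periodic, h0.1 H.mid_right,
      hl.1 H.mid_left, hs.1 H.smooth, H.mem, hc.1 H.circular, h1.1 H.symm_horizontal,
      fun e => H.not_symm_vertical (h2.2 e)⟩
  · intro H
    exact ⟨hstep.2 H.step, hmono.2 H.strictMono, hper.2 H.periodic, h0.2 H.mid_right,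
      hl.2 H.mid_left, hs.2 H.smooth, H.mem, hc.2 H.circular, h1.2 H.symm_horizontal,
      fun e => H.not_symm_vertical (h2.1 e)⟩

/-- Scaling of the arc length parameter as a continuous linear equivalence. -/
def scaleEquiv (hρ : 0 < ρ) : (ℝ × ℝ) ≃L[ℝ] ℝ × ℝ :=
  (ContinuousLinearEquiv.unitsEquivAut ℝ (Units.mk0 ρ hρ.ne')).prodCongr
    (ContinuousLinearEquiv.refl ℝ ℝ)

lemma scaleEquiv_apply (hρ : 0 < ρ) (z : ℝ × ℝ) : scaleEquiv hρ z = scale ρ z := by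
  simp [scaleEquiv, scale, mul_comm]

lemma LinearlyStable.scale (hρ : 0 < ρ) {p : ℕ} {z : ℕ → ℝ × ℝ} (hz : LinearlyStable 1 α h p z) :
    LinearlyStable ρ α h p (fun i => scale ρ (z i)) := by
  obtain ⟨M, ⟨R, hR, hiter, hder⟩, htr⟩ := hz
  set S := scaleEquiv hρ with hS
  have hSa : ∀ w, SmoothStadium.scale ρ w = S w := fun w => (scaleEquiv_apply hρ w).symm
  have hder' : HasFDerivAt R M (S.symm (S (z 0))) := by rwa [S.symm_apply_apply]
  refine ⟨(S : ℝ × ℝ →L[ℝ] ℝ × ℝ) ∘L M ∘L (S.symm : ℝ × ℝ →L[ℝ] ℝ × ℝ),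
    ⟨fun w => S (R (S.symm w)), ?_, ?_, ?_⟩, ?_⟩
  · simp only [hSa, S.symm_apply_apply, hR]
  · have ht : Tendsto S.symm (𝓝 (SmoothStadium.scale ρ (z 0))) (𝓝 (z 0)) := by
      have := S.symm.continuous.tendsto (S (z 0))
      rwa [S.symm_apply_apply, ← hSa] at this
    filter_upwards [ht.eventually hiter] with w hw
    have := BilliardIter.scale hρ hw
    rwa [hSa, hSa, S.apply_symm_apply] at this
  · simp only [hSa]
    exact S.hasFDerivAt.comp (S (z 0)) (hder'.comp (S (z 0)) S.symm.hasFDerivAt)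
  -- Scaling conjugates the monodromy matrix, so its trace is unchanged.
  · have : (((S : ℝ × ℝ →L[ℝ] ℝ × ℝ) ∘L M ∘L (S.symm : ℝ × ℝ →L[ℝ] ℝ × ℝ) :
        ℝ × ℝ →L[ℝ] ℝ × ℝ) : ℝ × ℝ →ₗ[ℝ] ℝ × ℝ) =
        S.toLinearEquiv.conj (M : ℝ × ℝ →ₗ[ℝ] ℝ × ℝ) := by
      ext <;> rfl
    rwa [this, LinearMap.trace_conj']

end scaling

end SmoothStadium

end

/-! ### Assembly of the two parts -/

theorem mainTheorem4 (n : ℕ) (h : ℝ → ℝ) (hcont : ContinuousOn h (Set.Icc 0 1))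
    (hnonneg : ∀ ξ ∈ Set.Icc (0 : ℝ) 1, 0 ≤ h ξ) (h_zero : h 0 = 1) (h_one : h 1 = 0)
    (ζs : ℝ) (hζs : ζs ∈ Set.Ioo (0 : ℝ) 1)
    (heq : (2 * (n : ℝ) + 1) / (2 * (n : ℝ) + 2) * (1 - ζs) = ∫ ξ in ζs..1, h ξ) :
    (∃ α₀ > (0 : ℝ), ∀ ρ > (0 : ℝ), ∀ α ∈ Set.Ioo 0 α₀,
      ∃ (ζ : ℝ) (z : ℕ → ℝ × ℝ), SmoothStadium.IsOrbit ρ α h n ζ z) ∧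
    (((n : ℝ) + 1 / 2) / ((n : ℝ) + 1) < h ζs → h ζs < 1 →
      h ζs ≠ ((n : ℝ) + 3 / 4) / ((n : ℝ) + 1) →
      ∃ C > (0 : ℝ), ∃ ε > (0 : ℝ), ∃ α₀ > (0 : ℝ), ∀ ρ > (0 : ℝ), ∀ α ∈ Set.Ioo 0 α₀,
        (∃ (ζ : ℝ) (z : ℕ → ℝ × ℝ), SmoothStadium.IsOrbit ρ α h n ζ z ∧
          |ζ - ζs| ≤ C * α ∧ SmoothStadium.LinearlyStable ρ α h (4 * (n + 1)) z) ∧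
        ∀ (ζ : ℝ) (z : ℕ → ℝ × ℝ), SmoothStadium.IsOrbit ρ α h n ζ z → |ζ - ζs| < ε →
          SmoothStadium.LinearlyStable ρ α h (4 * (n + 1)) z) := by
  have hh : SmoothStadium.IsShape h := ⟨hcont, hnonneg, h_zero, h_one⟩
  have h0 : SmoothStadium.leadingTerm n h ζs = 0 := sub_eq_zero.2 heq
  refine ⟨?_, fun h1 h2 h3 => ?_⟩
  · obtain ⟨C, hC, hsys⟩ := SmoothStadium.eventually_exists_chordSystem n hh hζs h0
    obtain ⟨α₀, hα₀, hα⟩ := mem_nhdsGT_iff_exists_Ioo_subset.1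
      (hsys.and (SmoothStadium.eventually_exists_isOrbit n hh hC))
    refine ⟨α₀, hα₀, fun ρ hρ α hαm => ?_⟩
    obtain ⟨⟨ζ, hζ, x, y, hx, hy, hxy⟩, horb⟩ := hα hαm
    obtain ⟨z, hz⟩ := horb ζ hζ x y hx hy hxy
    exact ⟨ζ, _, (SmoothStadium.isOrbit_scale hρ).2 hz⟩
  · obtain ⟨ε, hε, α₁, hα₁, hstab⟩ := SmoothStadium.exists_linearlyStable n hh hζs h1 h2 h3
    have h1' : (2 * (n : ℝ) + 1) / (2 * (n : ℝ) + 2) < h ζs := by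
      convert h1 using 1
      field_simp
    obtain ⟨C, hC, hsys⟩ := SmoothStadium.eventually_exists_chordSystem_near n hh hζs h0 h1'
    -- The condition Cα < ε places the constructed orbit in the neighbourhood where every orbit is
    -- stable.
    obtain ⟨α₂, hα₂, hα⟩ := mem_nhdsGT_iff_exists_Ioo_subset.1
      ((hsys.and (SmoothStadium.eventually_exists_isOrbit n hh hC)).and
        (SmoothStadium.eventually_mul_lt C hε))
    refine ⟨C, hC, ε, hε, min α₁ α₂, lt_min hα₁ hα₂, fun ρ hρ α hαm => ?_⟩
    have hαm1 : α ∈ Ioo 0 α₁ := ⟨hαm.1, hαm.2.trans_le (min_le_left _ _)⟩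
    obtain ⟨⟨⟨ζ, hζ, hnear, x, y, hx, hy, hxy⟩, horb⟩, hCε⟩ :=
      hα (show α ∈ Ioo 0 α₂ from ⟨hαm.1, hαm.2.trans_le (min_le_right _ _)⟩)
    obtain ⟨z, hz⟩ := horb ζ hζ x y hx hy hxy
    have hstab' : ∀ (ζ : ℝ) (z : ℕ → ℝ × ℝ), SmoothStadium.IsOrbit ρ α h n ζ z → |ζ - ζs| < ε →
        SmoothStadium.LinearlyStable ρ α h (4 * (n + 1)) z := by
      intro ζ z hz hζ
      have e : (fun i => SmoothStadium.scale ρ (SmoothStadium.scale ρ⁻¹ (z i))) = z :=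
        funext fun i => SmoothStadium.scale_scale_inv hρ (z i)
      rw [← e] at hz ⊢
      exact (hstab α hαm1 ζ _ ((SmoothStadium.isOrbit_scale hρ).1 hz) hζ).scale hρ
    have hz' := (SmoothStadium.isOrbit_scale hρ).2 hz
    exact ⟨⟨ζ, _, hz', hnear, hstab' _ _ hz' (hnear.trans_lt hCε)⟩, hstab'⟩
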